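/- **Setting.** Let $d\ge 1$, and let $(X,W,Y(0),Y(1))$ be random variables with $X\in\mathbb R^d$ (features), $W\in\{0,1\}$ (treatment indicator) and integrable real potential outcomes $Y(0),Y(1)$; the observed response is $Y=Y(0)(1-W)+Y(1)W$. Assume unconfoundedness: $(Y(0),Y(1))$ and $W$ are conditionally independent given $X$. The heterogeneous treatment effect is $\tau(z)=\mathbb E[Y(1)-Y(0)\mid X=z]$, and $\tau(x)$ is the value at $x$ of a version that is continuous at $x$. For $a\in\{1,0\}$ (treated, control) let $(X_a,Y_a)$ have the conditional distribution of $(X,Y)$ given $W=a$. Let $x\in\mathrm{supp}(X_1)\cap\mathrm{supp}(X_0)$ and assume, for $a=1$ and $a=0$: $Y_a=\mu_a(X_a)+\varepsilon_a$ with $\mu_a$ a (measurable) regression function and noise $\varepsilon_a$ independent of $X_a$, $\mathbb E\,\varepsilon_a=0$, $0<\mathrm{var}(\varepsilon_a)<\infty$; $\mathbb E\,Y_a^2<\infty$; $X_a$ has a Lebesgue density $f_a$; and there is an open neighborhood $U$ of $x$ such that $f_a$ is bounded away from $0$ and $\infty$ on $U\cap\mathrm{supp}(X_a)$ and $f_a,\mu_a$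 are twice continuously differentiable on $U$ with bounded second derivatives. **Estimator.** For a sample $(x_1,y_1),\dots,(x_n,y_n)$ and $1\le s\le n$, let $D_n(s)(x)$ be the average, over all $\binom ns$ subsets $I\subset\{1,\dots,n\}$ of size $s$, of the response $y_i$ of the point $x_i$, $i\in I$, nearest to $x$ in Euclidean distance (ties broken by the smallest index). For $s_1\ne s_2$ put $$D_n(s_1,s_2)(x)=w_1D_n(s_1)(x)+w_2D_n(s_2)(x),\qquad w_1+w_2=1,\quad w_1s_1^{-2/d}+w_2s_2^{-2/d}=0 .$$ **Theorem.** Along a sequence of sample sizes $n_1,n_0$ and subsampling scales $s_i^{(a)}$ with $1\le s_i^{(a)}\le n_a$ and $s_1^{(a)}\neq s_2^{(a)}$, suppose $s_i^{(a)}\to\infty$ and $s_i^{(a)}/n_a\to0$ for $i=1,2$ and $a=1,0$. For each term of the sequence, let an i.i.d. sample of size $n_1$ from the law of $(X_1,Y_1)$ and, independent of it, an i.i.d. sample of size $n_0$ from the law of $(X_0,Y_0)$ be given, and let $D^{(1)}$ and $D^{(0)}$ be the two-scale estimators $D_{n_1}(s^{(1)}_1,s^{(1)}_2)(x)$ and $D_{n_0}(s^{(0)}_1,s^{(0)}_2)(x)$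 computed from them. Then the bias $\Lambda=\mathbb E[D^{(1)}-D^{(0)}]-\tau(x)$ is finite and satisfies $$\Lambda=o\Big((s_1^{(1)})^{-2/d}+(s_2^{(1)})^{-2/d}+(s_1^{(0)})^{-2/d}+(s_2^{(0)})^{-2/d}\Big),$$ and there are $\sigma>0$ (depending on the term of the sequence) with $$\sigma^2=O\Big(\frac{s_1^{(1)}}{n_1}+\frac{s_2^{(1)}}{n_1}+\frac{s_1^{(0)}}{n_0}+\frac{s_2^{(0)}}{n_0}\Big)\quad\text{and}\quad \frac{D^{(1)}-D^{(0)}-\tau(x)-\Lambda}{\sigma}\ \xrightarrow{\ \mathscr D\ }\ N(0,1).$$ -/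

import Mathlib

open MeasureTheory ProbabilityTheory Filter Topology Asymptotics

/-! ### The population: features, binary treatment, potential outcomes -/

section Population

variable {Ω : Type*} [MeasurableSpace Ω] {d : ℕ}

/-- The observed response `Y(0) (1 - W) + Y(1) W`, that is `Y(W)`.  The treatment indicator `W`
takes the values `1` (treated) and `0` (control), and `Y a` is the potential outcome in arm `a`. -/
def observedResponse (W : Ω → Fin 2) (Y : Fin 2 → Ω → ℝ) (ω : Ω) : ℝ := Y (W ω) ω

/-- The population of the arm `a`: the conditional distribution given `W = a`. -/
noncomputable def armMeasure (P : Measure Ω) (W : Ω → Fin 2) (a : Fin 2) : Measure Ω :=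
  ProbabilityTheory.cond P (W ⁻¹' {a})

/-- Unconfoundedness: `(Y(0), Y(1))` and `W` are conditionally independent given `X`. -/
def Unconfounded [StandardBorelSpace Ω] (P : Measure Ω) [IsFiniteMeasure P]
    (X : Ω → EuclideanSpace ℝ (Fin d)) (hX : Measurable X) (W : Ω → Fin 2)
    (Y : Fin 2 → Ω → ℝ) : Prop :=
  CondIndepFun (MeasurableSpace.comap X inferInstance) hX.comap_le
    (fun ω => (Y 0 ω, Y 1 ω)) W P

/-- `τ` is a version of the heterogeneous treatment effect `z ↦ E[Y(1) - Y(0) | X = z]`. -/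
def IsTreatmentEffect (P : Measure Ω) (X : Ω → EuclideanSpace ℝ (Fin d)) (Y : Fin 2 → Ω → ℝ)
    (τ : EuclideanSpace ℝ (Fin d) → ℝ) : Prop :=
  (fun ω => τ (X ω)) =ᵐ[P] P[fun ω => Y 1 ω - Y 0 ω | MeasurableSpace.comap X inferInstance]

/-- The nonparametric regression model `R = μ(X) + ε` on a population `G`, together with the
regularity conditions at the point `x`; here `f` is the density of `X` and `ε = R - μ(X)`. -/
structure RegularModelAt (G : Measure Ω) (X : Ω → EuclideanSpace ℝ (Fin d)) (R : Ω → ℝ)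
    (f μ : EuclideanSpace ℝ (Fin d) → ℝ) (x : EuclideanSpace ℝ (Fin d)) : Prop where
  measurable_density : Measurable f
  density_nonneg : ∀ z, 0 ≤ f z
  map_eq_withDensity : G.map X = volume.withDensity (fun z => ENNReal.ofReal (f z))
  measurable_regression : Measurable μ
  noise_indep : IndepFun X (fun ω => R ω - μ (X ω)) G
  noise_memLp : MemLp (fun ω => R ω - μ (X ω)) 2 G
  noise_mean : ∫ ω, (R ω - μ (X ω)) ∂G = 0
  noise_variance_pos : 0 < variance (fun ω => R ω - μ (X ω)) G
  response_memLp : MemLp R 2 G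
  exists_nhds : ∃ U : Set (EuclideanSpace ℝ (Fin d)), IsOpen U ∧ x ∈ U ∧
    (∃ c C : ℝ, 0 < c ∧ ∀ z ∈ U ∩ (G.map X).support, c ≤ f z ∧ f z ≤ C) ∧
    ContDiffOn ℝ 2 f U ∧ ContDiffOn ℝ 2 μ U ∧
    ∃ M : ℝ, ∀ z ∈ U, ‖iteratedFDeriv ℝ 2 f z‖ ≤ M ∧ ‖iteratedFDeriv ℝ 2 μ z‖ ≤ M

/-- `Z` is an i.i.d. sample of size `n` from the distribution `Q` of a feature-response pair. -/
structure IsIIDSample {n : ℕ} (ν : Measure Ω) (Q : Measure (EuclideanSpace ℝ (Fin d) × ℝ))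
    (Z : Fin n → Ω → EuclideanSpace ℝ (Fin d) × ℝ) : Prop where
  hasLaw : ∀ i, HasLaw (Z i) Q ν
  indep : iIndepFun Z ν

end Population

/-! ### Distributional nearest neighbors -/

section Estimator

variable {d n : ℕ}

/-- Among the observations with index in `I`, the one with index `i` is the nearest neighbor of
`x`, ties being broken in favor of the smallest index. -/
def IsNearest (x : EuclideanSpace ℝ (Fin d)) (z : Fin n → EuclideanSpace ℝ (Fin d) × ℝ)
    (I : Finset (Fin n)) (i : Fin n) : Prop :=
  i ∈ I ∧ ∀ j ∈ I, ‖(z i).1 - x‖ < ‖(z j).1 - x‖ ∨ (‖(z i).1 - x‖ = ‖(z j).1 - x‖ ∧ i ≤ j)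

/-- A nonempty subsample has exactly one nearest neighbor. -/
theorem existsUnique_isNearest (x : EuclideanSpace ℝ (Fin d))
    (z : Fin n → EuclideanSpace ℝ (Fin d) × ℝ) (I : Finset (Fin n)) (hI : I.Nonempty) :
    ∃! i, IsNearest x z I i := by
  obtain ⟨i, hi, hmin⟩ :=
    Finset.exists_min_image I (fun j => toLex (‖(z j).1 - x‖, j)) hI
  refine ⟨i, ⟨hi, fun j hj => ?_⟩, fun j hj => ?_⟩
  · simpa [Prod.Lex.toLex_le_toLex] using hmin j hj
  · have h1 := hmin j hj.1
    rw [Prod.Lex.toLex_le_toLex] at h1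
    have h2 := hj.2 i hi
    rcases h1 with h1 | ⟨h1, h1'⟩ <;> rcases h2 with h2 | ⟨h2, h2'⟩
    · exact absurd h1 (not_lt.mpr h2.le)
    · exact absurd h1 (by simp [h2])
    · exact absurd h2 (by simp at h1; simp [h1])
    · exact le_antisymm h2' h1'

open Classical in
/-- The 1-nearest neighbor estimator `Φ` of the subsample with index set `I`: the response of its
nearest neighbor (exactly one summand is selected when `I` is nonempty). -/
noncomputable def oneNN (x : EuclideanSpace ℝ (Fin d))
    (z : Fin n → EuclideanSpace ℝ (Fin d) × ℝ) (I : Finset (Fin n)) : ℝ :=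
  ∑ i : Fin n, if IsNearest x z I i then (z i).2 else 0

/-- The DNN estimator `D_n(s)(x)`: the average of the 1-nearest neighbor estimators over all
subsamples of size `s`. -/
noncomputable def dnn (x : EuclideanSpace ℝ (Fin d)) (s : ℕ)
    (z : Fin n → EuclideanSpace ℝ (Fin d) × ℝ) : ℝ :=
  ((n.choose s : ℝ))⁻¹ * ∑ I ∈ (Finset.univ : Finset (Fin n)).powersetCard s, oneNN x z I

/-- `s ^ (-2 / d)`. -/
noncomputable def scaleRate (d s : ℕ) : ℝ := (s : ℝ) ^ (-(2 : ℝ) / (d : ℝ))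

/-- The two-scale DNN estimator `w₁ D_n(s₁)(x) + w₂ D_n(s₂)(x)`, where `w₁ + w₂ = 1` and
`w₁ s₁^(-2/d) + w₂ s₂^(-2/d) = 0`. -/
noncomputable def twoScaleDNN (x : EuclideanSpace ℝ (Fin d)) (s₁ s₂ : ℕ)
    (z : Fin n → EuclideanSpace ℝ (Fin d) × ℝ) : ℝ :=
  scaleRate d s₂ / (scaleRate d s₂ - scaleRate d s₁) * dnn x s₁ z +
    -scaleRate d s₁ / (scaleRate d s₂ - scaleRate d s₁) * dnn x s₂ z

end Estimator

/-- The estimator of the heterogeneous treatment effect at `x`: the two-scale DNN estimator of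
the treated sample `z₁` minus that of the control sample `z₀`. -/
noncomputable def effectEstimator {d n₁ n₀ : ℕ} (x : EuclideanSpace ℝ (Fin d))
    (s₁₁ s₁₂ s₀₁ s₀₂ : ℕ) (z₁ : Fin n₁ → EuclideanSpace ℝ (Fin d) × ℝ)
    (z₀ : Fin n₀ → EuclideanSpace ℝ (Fin d) × ℝ) : ℝ :=
  twoScaleDNN x s₁₁ s₁₂ z₁ - twoScaleDNN x s₀₁ s₀₂ z₀

/-! Rank a sample by distance to `x`. Averaging over subsamples turns the estimator into a sum of
responses with deterministic weights attached to the ranks (`dnn_eq_sum_nnWeight`). If `s < t` are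
the two scales of an arm, the two-scale estimator is `(1 + ω) D(t) - ω D(s)` with `ω = extrapolation
d s t`. In the model `Y = μ(X) + ε` it splits into `μ(x)`, a weighted noise sum, and the two-scale
estimator of `μ - μ(x)`, a function of the features alone (`armEstimator_eq`). Nothing keeps `s / t`
away from `1`, so `ω` may be unbounded and every estimate has to be uniform in `s < t`.

Noise. `ω (t - s) ≤ (d / 2) t`, while the weights of the two scales differ by at most `(t - s) / n`.
Hence the two-scale weights are `O(t / n)`, their absolute sum is bounded, and their sum of squares
`Q` is of exact order `t / n`. Given the features, the noise sum has the same weights in another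
order, so its characteristic function is a product free of the features (`integral_exp_sum_nnRank`).
As the largest squared weight is negligible against `Q`, this product is asymptotically Gaussian
with variance `var(ε) Q`.

Regression part. It is a U-statistic with a kernel of `t` arguments, so Hoeffding's inequality
bounds its variance by `2 (t / n)` times the second moment of the kernel. That moment tends to `0`,
because `μ` is continuous at `x` and the nearest neighbor is far from `x` with geometrically small
probability. The variance is therefore `o(t / n)`, negligible against the noise
(`exists_variance_twoScaleDNN_le`).

Bias. With `m = μ - μ(x)` and `φ(r)` the mass of the ball of radius `r`, put `H(s) = s^(1+2/d) ∫ m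
(1 - φ(‖z - x‖))^(s-1)`. The two-scale bias is the quotient `(H(t) - H(s)) / (t^(2/d) - s^(2/d))`,
which Cauchy's mean value theorem expresses through `H'(ξ)` with `s < ξ < t`. After rescaling by
`s^(-1/d)` the limit governing `H'` is an integral of a quadratic form that vanishes by homogeneity
(`integral_gaussian_type_eq_zero`), so the bias is `o(s^(-2/d))`.

Assembly. Unconfoundedness, continuity and positive densities at `x` give `τ(x) = μ₁(x) - μ₀(x)`
(`treatmentEffect_eq`). The arms are independent, so their characteristic functions multiply, and
`σ² = var(ε₁) Q₁ + var(ε₀) Q₀` makes the Gaussian factors multiply to `exp(-u²/2)`. -/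

/-! ### Nearest neighbor weights -/

/-- The fraction of the subsets of size `s` of `n` ranked points in which the point of rank `i`
(counted from `0`) is the smallest. -/
noncomputable def nnWeight (n s i : ℕ) : ℝ := ((n - 1 - i).choose (s - 1) : ℝ) / (n.choose s : ℝ)

theorem nnWeight_nonneg (n s i : ℕ) : 0 ≤ nnWeight n s i := by
  unfold nnWeight; positivity

theorem cast_choose_succ_mul (M t : ℕ) :
    (M.choose (t + 1) : ℝ) * (t + 1) = M.choose t * (M - t) := by
  rcases le_or_gt t M with h | h
  · have := Nat.choose_succ_right_eq M t
    rw [← Nat.cast_sub h]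
    exact_mod_cast this
  · rw [Nat.choose_eq_zero_of_lt h, Nat.choose_eq_zero_of_lt (h.trans (Nat.lt_succ_self t))]
    simp

/-- The ratio of binomial coefficients `C(N - i, t) / C(N, t)`. -/
noncomputable def chooseRatio (N i t : ℕ) : ℝ := ((N - i).choose t : ℝ) / (N.choose t : ℝ)

theorem chooseRatio_nonneg (N i t : ℕ) : 0 ≤ chooseRatio N i t := by
  unfold chooseRatio; positivity

/-- One more draw multiplies the ratio by `1 - i / (N - t)`. Monotonicity in `t` and the geometric
bound `chooseRatio_le_pow` both come from this recursion. -/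
theorem chooseRatio_succ {N i t : ℕ} (hi : i ≤ N) (ht : t < N) :
    chooseRatio N i (t + 1) * (N - t) = chooseRatio N i t * (N - i - t) := by
  unfold chooseRatio
  have h1 := cast_choose_succ_mul N t
  have h2 := cast_choose_succ_mul (N - i) t
  rw [Nat.cast_sub hi] at h2
  have p1 : (0 : ℝ) < N.choose t := by exact_mod_cast Nat.choose_pos ht.le
  have p2 : (0 : ℝ) < N.choose (t + 1) := by exact_mod_cast Nat.choose_pos ht
  have p3 : (0 : ℝ) < t + 1 := by positivity
  rw [div_mul_eq_mul_div, div_mul_eq_mul_div, div_eq_div_iff p2.ne' p1.ne']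
  apply mul_right_cancel₀ p3.ne'
  linear_combination (-((N - i).choose (t + 1) : ℝ) * (t + 1)) * h1 + (N.choose (t + 1) * (t + 1) : ℝ) * h2

theorem chooseRatio_succ_le {N i t : ℕ} (hi : i ≤ N) (ht : t < N) :
    chooseRatio N i (t + 1) ≤ chooseRatio N i t * (1 - i / N) := by
  have h := chooseRatio_succ hi ht
  have hN : (0 : ℝ) < N - t := by
    have : (t : ℝ) < N := by exact_mod_cast ht
    linarith
  have hN' : (0 : ℝ) < N := by exact_mod_cast (Nat.zero_le t).trans_lt ht
  have h1 : chooseRatio N i (t + 1) = chooseRatio N i t * (1 - i / (N - t)) := by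
    field_simp
    linarith
  rw [h1]
  apply mul_le_mul_of_nonneg_left _ (chooseRatio_nonneg _ _ _)
  have : (i : ℝ) / N ≤ i / (N - t) := by
    apply div_le_div_of_nonneg_left (by positivity) hN
    have : (0 : ℝ) ≤ t := by positivity
    linarith
  linarith

theorem chooseRatio_antitone {N i s t : ℕ} (hi : i ≤ N) (hst : s ≤ t) (ht : t ≤ N) :
    chooseRatio N i t ≤ chooseRatio N i s := by
  induction t, hst using Nat.le_induction with
  | base => exact le_rfl
  | succ t hst ih =>
    refine (chooseRatio_succ_le hi ht).trans (le_trans ?_ (ih (by omega)))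
    have : (0 : ℝ) ≤ i / N := by positivity
    nlinarith [chooseRatio_nonneg N i t]

theorem chooseRatio_zero (N i : ℕ) : chooseRatio N i 0 = 1 := by simp [chooseRatio]

theorem chooseRatio_le_pow {N i t : ℕ} (hi : i ≤ N) (ht : t ≤ N) :
    chooseRatio N i t ≤ (1 - i / N : ℝ) ^ t := by
  have h0 : (0 : ℝ) ≤ 1 - i / N := by
    rw [sub_nonneg]
    exact div_le_one_of_le₀ (by exact_mod_cast hi) (by positivity)
  induction t with
  | zero => simp [chooseRatio_zero]
  | succ t ih =>
    rw [pow_succ]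
    exact (chooseRatio_succ_le hi ht).trans (mul_le_mul_of_nonneg_right (ih (by omega)) h0)

/-- Mark `i` of the `N` points: the left side counts the `(t + 1)`-subsets that contain at most one
marked point. -/
theorem mul_choose_le_choose_succ {N i : ℕ} (t : ℕ) (hi : i ≤ N) :
    (N - i).choose (t + 1) + i * (N - i).choose t ≤ N.choose (t + 1) := by
  induction i with
  | zero => simp
  | succ i ih =>
    refine le_trans ?_ (ih (by omega))
    obtain ⟨M, hM⟩ : ∃ M, N - i = M + 1 := ⟨N - i - 1, by omega⟩
    have hM' : N - (i + 1) = M := by omega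
    rw [hM, hM', Nat.choose_succ_succ M t]
    have : M.choose t ≤ (M + 1).choose t := Nat.choose_le_choose t (Nat.le_succ M)
    nlinarith

theorem mul_chooseRatio_le {N i t : ℕ} (hi : i ≤ N) (ht : t ≤ N) :
    (t + 1) * (i * chooseRatio N i t) ≤ N - t := by
  have p1 : (0 : ℝ) < N.choose t := by exact_mod_cast Nat.choose_pos ht
  have h := cast_choose_succ_mul N t
  have h2 : (i : ℝ) * (N - i).choose t ≤ N.choose (t + 1) := by
    have := mul_choose_le_choose_succ t hi
    exact_mod_cast (by omega : i * (N - i).choose t ≤ N.choose (t + 1))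
  unfold chooseRatio
  rw [mul_div_assoc', mul_div_assoc', div_le_iff₀ p1]
  have p3 : (0 : ℝ) < t + 1 := by positivity
  nlinarith

/-- A random `s`-subset contains the given point with probability `s / n`, and its other `s - 1`
elements must then avoid the `i` points of smaller rank. For `s > n` both sides are quotients by
zero, hence `0`. -/
theorem nnWeight_eq {n s i : ℕ} (hs : 1 ≤ s) (hn : 1 ≤ n) :
    nnWeight n s i = (s / n : ℝ) * chooseRatio (n - 1) i (s - 1) := by
  obtain ⟨N, rfl⟩ : ∃ N, n = N + 1 := ⟨n - 1, by omega⟩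
  obtain ⟨t, rfl⟩ : ∃ t, s = t + 1 := ⟨s - 1, by omega⟩
  unfold nnWeight chooseRatio
  simp only [Nat.add_sub_cancel]
  have h : ((N + 1 : ℕ) : ℝ) * (N.choose t : ℝ) = ((N + 1).choose (t + 1) : ℝ) * ((t + 1 : ℕ) : ℝ) := by
    exact_mod_cast Nat.add_one_mul_choose_eq N t
  have h2 : ((t + 1 : ℕ) : ℝ) ≠ 0 := by positivity
  have h3 : ((N + 1 : ℕ) : ℝ) ≠ 0 := by positivity
  rcases eq_or_ne (N.choose t : ℝ) 0 with h0 | h0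
  · rw [h0, mul_zero] at h
    have : ((N + 1).choose (t + 1) : ℝ) = 0 := by
      rcases mul_eq_zero.mp h.symm with h | h
      · exact h
      · exact absurd h h2
    rw [h0, this]; simp
  · have : ((N + 1).choose (t + 1) : ℝ) ≠ 0 := by
      intro h'
      rw [h', zero_mul] at h
      exact (mul_ne_zero h3 h0) h
    field_simp
    linear_combination ((N - i).choose t : ℝ) * h

theorem nnWeight_le_mul {n s t i : ℕ} (hs : 1 ≤ s) (hst : s ≤ t) (ht : t ≤ n) (hi : i < n) :
    nnWeight n t i ≤ (t / s : ℝ) * nnWeight n s i := by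
  rw [nnWeight_eq hs (by omega), nnWeight_eq (hs.trans hst) (by omega)]
  have h := chooseRatio_antitone (N := n - 1) (i := i) (s := s - 1) (t := t - 1)
    (by omega) (by omega) (by omega)
  have : (s : ℝ) ≠ 0 := by positivity
  have e : (t / s : ℝ) * (s / n * chooseRatio (n - 1) i (s - 1))
    = t / n * chooseRatio (n - 1) i (s - 1) := by field_simp
  rw [e]
  exact mul_le_mul_of_nonneg_left h (by positivity)

theorem nnWeight_le {n s i : ℕ} (hs : 1 ≤ s) (hsn : s ≤ n) (hi : i < n) :
    nnWeight n s i ≤ s / n := by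
  rw [nnWeight_eq hs (by omega)]
  have h := chooseRatio_antitone (N := n - 1) (i := i) (s := 0) (t := s - 1)
    (by omega) (by omega) (by omega)
  rw [chooseRatio_zero] at h
  exact mul_le_of_le_one_right (by positivity) h

/-- The weights are Lipschitz in the scale with constant `1 / n`, uniformly in the rank. The upper
bound holds because weight divided by scale is nonincreasing in the scale; the lower bound is
`mul_chooseRatio_le`. -/
theorem abs_nnWeight_succ_sub_le {n s i : ℕ} (hs : 1 ≤ s) (hsn : s < n) (hi : i < n) :
    |nnWeight n (s + 1) i - nnWeight n s i| ≤ 1 / n := by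
  have hn : (0 : ℝ) < n := by exact_mod_cast (by omega : 0 < n)
  have hs' : (0 : ℝ) < s := by exact_mod_cast hs
  rw [abs_le]
  constructor
  · rw [nnWeight_eq hs (by omega), nnWeight_eq (by omega) (by omega)]
    obtain ⟨t, rfl⟩ : ∃ t, s = t + 1 := ⟨s - 1, by omega⟩
    simp only [Nat.add_sub_cancel]
    have h1 := chooseRatio_succ (N := n - 1) (i := i) (t := t) (by omega) (by omega)
    have h2 := mul_chooseRatio_le (N := n - 1) (i := i) (t := t) (by omega) (by omega)
    have h3 : (0 : ℝ) < ((n - 1 : ℕ) : ℝ) - t := by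
      have : (t : ℝ) < ((n - 1 : ℕ) : ℝ) := by exact_mod_cast (by omega : t < n - 1)
      linarith
    set a := chooseRatio (n - 1) i (t + 1)
    set b := chooseRatio (n - 1) i t
    have ha : 0 ≤ a := chooseRatio_nonneg _ _ _
    set K := ((n - 1 : ℕ) : ℝ) - t
    have h5 : (b - a) * K = b * i := by
      have : ((n - 1 : ℕ) : ℝ) - i - t = K - i := by simp only [K]; ring
      rw [this] at h1
      linear_combination -h1
    have h4 : (t + 1) * (b - a) ≤ 1 := by
      have : ((t + 1) * (b - a)) * K ≤ 1 * K := by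
        rw [mul_assoc, h5]; linarith
      exact le_of_mul_le_mul_right this h3
    push_cast
    have e : (t + 1 + 1 : ℝ) / n * a - (t + 1) / n * b = (a - (t + 1) * (b - a)) / n := by
      field_simp; ring
    rw [e, ← neg_div, div_le_div_iff_of_pos_right hn]
    linarith
  · have h1 := nnWeight_le_mul hs (Nat.le_succ s) hsn hi
    have h2 := nnWeight_le hs hsn.le hi
    have e : (((s + 1 : ℕ) : ℝ) / s) * nnWeight n s i = nnWeight n s i + nnWeight n s i / s := by
      push_cast; field_simp
    rw [Nat.succ_eq_add_one, e] at h1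
    have h3 : nnWeight n s i / s ≤ (s / n) / s := by gcongr
    have h4 : ((s : ℝ) / n) / s = 1 / n := by field_simp
    linarith

theorem abs_nnWeight_sub_le {n s t i : ℕ} (hs : 1 ≤ s) (hst : s ≤ t) (ht : t ≤ n) (hi : i < n) :
    |nnWeight n t i - nnWeight n s i| ≤ (t - s) / n := by
  induction t, hst using Nat.le_induction with
  | base => simp
  | succ t hst ih =>
    have h1 := ih (by omega)
    have h2 := abs_nnWeight_succ_sub_le (hs.trans hst) ht hi
    have h3 := abs_sub_le (nnWeight n (t + 1) i) (nnWeight n t i) (nnWeight n s i)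
    have : ((t + 1 : ℕ) - s : ℝ) / n = 1 / n + (t - s) / n := by push_cast; ring
    linarith

/-- `chooseRatio n m s` is the probability that a random `s`-subset misses the `m` best ranks; the
identity telescopes by Pascal's rule. -/
theorem sum_nnWeight_range {n s m : ℕ} (hs : 1 ≤ s) (hsn : s ≤ n) (hm : m ≤ n) :
    ∑ i ∈ Finset.range m, nnWeight n s i = 1 - chooseRatio n m s := by
  have p : (0 : ℝ) < n.choose s := by exact_mod_cast Nat.choose_pos hsn
  induction m with
  | zero => simp [chooseRatio, p.ne']
  | succ m ih =>
    rw [Finset.sum_range_succ, ih (by omega)]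
    unfold chooseRatio nnWeight
    obtain ⟨t, rfl⟩ : ∃ t, s = t + 1 := ⟨s - 1, by omega⟩
    obtain ⟨M, hM⟩ : ∃ M, n - m = M + 1 := ⟨n - m - 1, by omega⟩
    have hM' : n - (m + 1) = M := by omega
    have hM'' : n - 1 - m = M := by omega
    rw [hM, hM', hM'', Nat.choose_succ_succ M t]
    simp only [Nat.add_sub_cancel]
    push_cast
    field_simp
    ring

theorem sum_nnWeight {n s : ℕ} (hs : 1 ≤ s) (hsn : s ≤ n) :
    ∑ i ∈ Finset.range n, nnWeight n s i = 1 := by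
  rw [sum_nnWeight_range hs hsn le_rfl]
  simp [chooseRatio, Nat.choose_eq_zero_of_lt (show 0 < s by omega)]

/-! ### Two-scale weights -/

/-- For `s < t`, the number `ω` such that the two-scale estimator with scales `s` and `t` is
`(1 + ω) D(t) - ω D(s)`. -/
noncomputable def extrapolation (d s t : ℕ) : ℝ :=
  scaleRate d t / (scaleRate d s - scaleRate d t)

theorem scaleRate_pos {d s : ℕ} (hs : 1 ≤ s) : 0 < scaleRate d s :=
  Real.rpow_pos_of_pos (by exact_mod_cast hs) _

theorem scaleRate_lt {d s t : ℕ} (hd : 0 < d) (hs : 1 ≤ s) (hst : s < t) :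
    scaleRate d t < scaleRate d s := by
  have hd' : (0 : ℝ) < d := by exact_mod_cast hd
  apply Real.rpow_lt_rpow_of_neg (by exact_mod_cast hs) (by exact_mod_cast hst)
  rw [neg_div]
  have : 0 < 2 / (d : ℝ) := by positivity
  linarith

theorem extrapolation_pos {d s t : ℕ} (hd : 0 < d) (hs : 1 ≤ s) (hst : s < t) :
    0 < extrapolation d s t :=
  div_pos (scaleRate_pos (by omega)) (sub_pos.mpr (scaleRate_lt hd hs hst))

/-- The coefficient can grow like `t / (t - s)` when the scales are close, and this bound says that
it grows no faster. The inequalities `log y ≥ 1 - 1/y` and `exp y ≥ 1 + y` give `scaleRate d s /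
scaleRate d t - 1 ≥ (2 / d) (1 - s / t)`. -/
theorem extrapolation_mul_sub_le {d s t : ℕ} (hd : 0 < d) (hs : 1 ≤ s) (hst : s < t) :
    extrapolation d s t * (t - s) ≤ d / 2 * t := by
  have hd' : (0 : ℝ) < d := by exact_mod_cast hd
  have hs' : (0 : ℝ) < s := by exact_mod_cast hs
  have ht' : (0 : ℝ) < t := by exact_mod_cast (by omega : 0 < t)
  have h1 := sub_pos.mpr (scaleRate_lt hd hs hst)
  have ht := scaleRate_pos (d := d) (s := t) (by omega)
  have hlog : 1 - (s : ℝ) / t ≤ Real.log (t / s) := by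
    have := Real.one_sub_inv_le_log_of_pos (show (0 : ℝ) < t / s by positivity)
    rwa [inv_div] at this
  have hexp : (2 / d : ℝ) * Real.log (t / s) + 1 ≤ scaleRate d s / scaleRate d t := by
    have : scaleRate d s / scaleRate d t = Real.exp (2 / d * Real.log (t / s)) := by
      unfold scaleRate
      rw [Real.rpow_def_of_pos hs', Real.rpow_def_of_pos ht', ← Real.exp_sub,
        Real.log_div ht'.ne' hs'.ne']
      congr 1; ring
    rw [this]; exact Real.add_one_le_exp _
  rw [extrapolation, div_mul_eq_mul_div, div_le_iff₀ h1]
  have h2 : scaleRate d s = scaleRate d s / scaleRate d t * scaleRate d t := by field_simp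
  have h3 : (2 / d : ℝ) * (1 - s / t) ≤ scaleRate d s / scaleRate d t - 1 := by
    have := mul_le_mul_of_nonneg_left hlog (show (0 : ℝ) ≤ 2 / d by positivity)
    linarith
  have h4 : (t - s : ℝ) ≤ d / 2 * t * (scaleRate d s / scaleRate d t - 1) := by
    have := mul_le_mul_of_nonneg_left h3 (show (0 : ℝ) ≤ d / 2 * t by positivity)
    have e : (d / 2 * t : ℝ) * (2 / d * (1 - s / t)) = t - s := by field_simp
    linarith
  calc scaleRate d t * (t - s)
      ≤ scaleRate d t * (d / 2 * t * (scaleRate d s / scaleRate d t - 1)) := by gcongr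
    _ = d / 2 * t * (scaleRate d s - scaleRate d t) := by field_simp

/-- The weight of the observation of rank `i` in the two-scale estimator. -/
noncomputable def twoScaleWeight (d n s t i : ℕ) : ℝ :=
  nnWeight n t i + extrapolation d s t * (nnWeight n t i - nnWeight n s i)

theorem sum_twoScaleWeight {d n s t : ℕ} (hs : 1 ≤ s) (hst : s < t) (htn : t ≤ n) :
    ∑ i ∈ Finset.range n, twoScaleWeight d n s t i = 1 := by
  unfold twoScaleWeight
  rw [Finset.sum_add_distrib, ← Finset.mul_sum, Finset.sum_sub_distrib,
    sum_nnWeight (by omega) htn, sum_nnWeight hs (by omega)]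
  simp

/-- The factor `t - s` in the Lipschitz bound `abs_nnWeight_sub_le` absorbs the possible blow-up of
the extrapolation coefficient, so the constant depends on `d` only. -/
theorem abs_twoScaleWeight_le {d n s t i : ℕ} (hd : 0 < d) (hs : 1 ≤ s) (hst : s < t)
    (htn : t ≤ n) (hi : i < n) :
    |twoScaleWeight d n s t i| ≤ (1 + d) * (t / n) := by
  have hw := extrapolation_pos hd hs hst
  have h1 := nnWeight_le (n := n) (s := t) (i := i) (by omega) htn hi
  have h0 := nnWeight_nonneg n t i
  have h2 := abs_nnWeight_sub_le (n := n) hs hst.le htn hi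
  have h3 := extrapolation_mul_sub_le hd hs hst
  have hn : (0 : ℝ) < n := by exact_mod_cast (by omega : 0 < n)
  unfold twoScaleWeight
  calc _ ≤ |nnWeight n t i| + |extrapolation d s t * (nnWeight n t i - nnWeight n s i)| :=
        abs_add_le _ _
    _ = nnWeight n t i + extrapolation d s t * |nnWeight n t i - nnWeight n s i| := by
        rw [abs_of_nonneg h0, abs_mul, abs_of_pos hw]
    _ ≤ t / n + extrapolation d s t * ((t - s) / n) := by gcongr
    _ = t / n + (extrapolation d s t * (t - s)) / n := by ring
    _ ≤ t / n + (d / 2 * t) / n := by gcongr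
    _ = (1 + d / 2) * (t / n) := by ring
    _ ≤ _ := by
      gcongr
      have : (0 : ℝ) ≤ d := by positivity
      linarith

/-- The differences sum to zero, so their absolute sum is twice the sum of their positive parts, and
each positive part is at most `(1 - s / t)` times the weight at scale `t`. -/
theorem sum_abs_nnWeight_sub_le {n s t : ℕ} (hs : 1 ≤ s) (hst : s ≤ t) (htn : t ≤ n) :
    ∑ i ∈ Finset.range n, |nnWeight n t i - nnWeight n s i| ≤ 2 * (1 - s / t) := by
  have hs' : (0 : ℝ) < s := by exact_mod_cast hs
  have ht' : (0 : ℝ) < t := by exact_mod_cast (by omega : 0 < t)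
  have hle : (s : ℝ) / t ≤ 1 := div_le_one_of_le₀ (by exact_mod_cast hst) ht'.le
  have key : ∀ i ∈ Finset.range n, |nnWeight n t i - nnWeight n s i| ≤
      2 * (1 - s / t) * nnWeight n t i - (nnWeight n t i - nnWeight n s i) := by
    intro i hi
    rw [Finset.mem_range] at hi
    have h1 := nnWeight_le_mul (n := n) hs hst htn hi
    have h0 := nnWeight_nonneg n t i
    have h2 : (s / t : ℝ) * nnWeight n t i ≤ nnWeight n s i := by
      calc (s / t : ℝ) * nnWeight n t i ≤ (s / t : ℝ) * ((t / s : ℝ) * nnWeight n s i) := by gcongr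
        _ = nnWeight n s i := by field_simp
    have h3 : 0 ≤ (1 - s / t : ℝ) * nnWeight n t i := mul_nonneg (by linarith) h0
    rw [abs_le]
    constructor <;> nlinarith
  refine (Finset.sum_le_sum key).trans (le_of_eq ?_)
  rw [Finset.sum_sub_distrib, ← Finset.mul_sum, Finset.sum_sub_distrib,
    sum_nnWeight (by omega) htn, sum_nnWeight hs (by omega)]
  ring

theorem sum_abs_twoScaleWeight_le {d n s t : ℕ} (hd : 0 < d) (hs : 1 ≤ s) (hst : s < t)
    (htn : t ≤ n) : ∑ i ∈ Finset.range n, |twoScaleWeight d n s t i| ≤ 1 + d := by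
  have hw := extrapolation_pos hd hs hst
  have ht' : (0 : ℝ) < t := by exact_mod_cast (by omega : 0 < t)
  have h3 := extrapolation_mul_sub_le hd hs hst
  calc ∑ i ∈ Finset.range n, |twoScaleWeight d n s t i|
      ≤ ∑ i ∈ Finset.range n,
        (nnWeight n t i + extrapolation d s t * |nnWeight n t i - nnWeight n s i|) := by
        refine Finset.sum_le_sum fun i _ => ?_
        refine (abs_add_le _ _).trans (le_of_eq ?_)
        rw [abs_of_nonneg (nnWeight_nonneg n t i), abs_mul, abs_of_pos hw]
    _ = 1 + extrapolation d s t * ∑ i ∈ Finset.range n, |nnWeight n t i - nnWeight n s i| := by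
        rw [Finset.sum_add_distrib, ← Finset.mul_sum, sum_nnWeight (by omega) htn]
    _ ≤ 1 + extrapolation d s t * (2 * (1 - s / t)) := by
        gcongr
        exact sum_abs_nnWeight_sub_le hs hst.le htn
    _ = 1 + 2 * (extrapolation d s t * (t - s)) / t := by field_simp
    _ ≤ 1 + 2 * (d / 2 * t) / t := by gcongr
    _ = 1 + d := by field_simp

theorem sum_sq_twoScaleWeight_le {d n s t : ℕ} (hd : 0 < d) (hs : 1 ≤ s) (hst : s < t)
    (htn : t ≤ n) :
    ∑ i ∈ Finset.range n, twoScaleWeight d n s t i ^ 2 ≤ (1 + d) ^ 2 * (t / n) := by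
  calc ∑ i ∈ Finset.range n, twoScaleWeight d n s t i ^ 2
      ≤ ∑ i ∈ Finset.range n, (1 + d) * (t / n) * |twoScaleWeight d n s t i| := by
        refine Finset.sum_le_sum fun i hi => ?_
        rw [← sq_abs, sq]
        gcongr
        exact abs_twoScaleWeight_le hd hs hst htn (Finset.mem_range.mp hi)
    _ = (1 + d) * (t / n) * ∑ i ∈ Finset.range n, |twoScaleWeight d n s t i| := by
        rw [Finset.mul_sum]
    _ ≤ (1 + d) * (t / n) * (1 + d) := by
        gcongr
        exact sum_abs_twoScaleWeight_le hd hs hst htn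
    _ = _ := by ring

/-- About `n / t` best ranks already carry half of the total weight; Cauchy–Schwarz on these ranks
bounds the sum of squares from below. This makes the noise dominate the regression fluctuations. -/
theorem le_sum_sq_twoScaleWeight {d n s t : ℕ} (hd : 0 < d) (hs : 1 ≤ s) (hst : s < t)
    (htn : t ≤ n) :
    (t / n : ℝ) / 8 ≤ ∑ i ∈ Finset.range n, twoScaleWeight d n s t i ^ 2 := by
  have hn : (0 : ℝ) < n := by exact_mod_cast (by omega : 0 < n)
  have ht' : (0 : ℝ) < t := by exact_mod_cast (by omega : 0 < t)
  have hw := extrapolation_pos hd hs hst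
  set m : ℕ := ⌈(n : ℝ) / t⌉₊ with hm
  have h1 : (n : ℝ) / t ≤ m := Nat.le_ceil _
  have hnt : (1 : ℝ) ≤ n / t := by
    rw [le_div_iff₀ ht', one_mul]; exact_mod_cast htn
  have h2 : (m : ℝ) ≤ 2 * (n / t) := by
    have := Nat.ceil_lt_add_one (show (0 : ℝ) ≤ n / t by positivity)
    linarith
  have hmn : m ≤ n := by
    apply Nat.ceil_le.mpr
    apply div_le_self hn.le
    exact_mod_cast (by omega : 1 ≤ t)
  have hpart : 1 / 2 ≤ ∑ i ∈ Finset.range m, twoScaleWeight d n s t i := by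
    unfold twoScaleWeight
    rw [Finset.sum_add_distrib, ← Finset.mul_sum, Finset.sum_sub_distrib,
      sum_nnWeight_range (by omega) htn hmn, sum_nnWeight_range hs (by omega) hmn]
    -- The larger scale puts at least as much mass on the first `m` ranks, so the extrapolation term
    -- contributes nonnegatively.
    have ha := chooseRatio_antitone hmn hst.le htn
    have hb : chooseRatio n m t ≤ Real.exp (-1) := by
      refine (chooseRatio_le_pow hmn htn).trans ?_
      have h0 : (0 : ℝ) ≤ 1 - m / n := by
        rw [sub_nonneg]
        exact div_le_one_of_le₀ (by exact_mod_cast hmn) (by positivity)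
      have h5 : (1 - m / n : ℝ) ≤ Real.exp (-(m / n)) := by
        have := Real.add_one_le_exp (-(m / n : ℝ))
        linarith
      refine (pow_le_pow_left₀ h0 h5 t).trans ?_
      rw [← Real.exp_nat_mul]
      apply Real.exp_le_exp.mpr
      rw [div_le_iff₀ ht'] at h1
      have : 1 ≤ (m : ℝ) * t / n := by rwa [le_div_iff₀ hn, one_mul]
      have e : (t : ℝ) * -(m / n) = -(m * t / n) := by ring
      rw [e]; linarith
    have hc : Real.exp (-1) ≤ 1 / 2 := by
      rw [Real.exp_neg, inv_le_comm₀ (Real.exp_pos _) (by norm_num)]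
      have := Real.add_one_le_exp (1 : ℝ)
      norm_num; linarith
    nlinarith
  have hcs : (∑ i ∈ Finset.range m, twoScaleWeight d n s t i) ^ 2 ≤
      m * ∑ i ∈ Finset.range m, twoScaleWeight d n s t i ^ 2 := by
    have := sq_sum_le_card_mul_sum_sq (s := Finset.range m) (f := twoScaleWeight d n s t)
    simpa using this
  have hsub : ∑ i ∈ Finset.range m, twoScaleWeight d n s t i ^ 2 ≤
      ∑ i ∈ Finset.range n, twoScaleWeight d n s t i ^ 2 :=
    Finset.sum_le_sum_of_subset_of_nonneg (Finset.range_subset_range.mpr hmn)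
      fun i _ _ => sq_nonneg _
  set S := ∑ i ∈ Finset.range n, twoScaleWeight d n s t i ^ 2
  have hS : 0 ≤ S := Finset.sum_nonneg fun i _ => sq_nonneg _
  have h6 : 1 / 4 ≤ 2 * (n / t) * S := by
    calc (1 / 4 : ℝ) = (1 / 2) ^ 2 := by norm_num
      _ ≤ (∑ i ∈ Finset.range m, twoScaleWeight d n s t i) ^ 2 := by gcongr
      _ ≤ _ := hcs
      _ ≤ m * S := by gcongr
      _ ≤ _ := by gcongr
  calc (t / n : ℝ) / 8 = (t / n) / 2 * (1 / 4) := by ring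
    _ ≤ (t / n) / 2 * (2 * (n / t) * S) := by gcongr
    _ = S := by field_simp

/-! ### Ranks -/

section Rank

variable {d n : ℕ}

/-- The sort key of an observation: its distance to `x`, then its index. -/
noncomputable def nnKey (x : EuclideanSpace ℝ (Fin d)) (X : Fin n → EuclideanSpace ℝ (Fin d))
    (j : Fin n) : ℝ ×ₗ Fin n := toLex (‖X j - x‖, j)

open Classical in
/-- The rank of an observation, counted from `0`. -/
noncomputable def nnRank (x : EuclideanSpace ℝ (Fin d)) (X : Fin n → EuclideanSpace ℝ (Fin d))
    (j : Fin n) : ℕ := (Finset.univ.filter fun l => nnKey x X l < nnKey x X j).card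

theorem nnKey_injective (x : EuclideanSpace ℝ (Fin d)) (X : Fin n → EuclideanSpace ℝ (Fin d)) :
    Function.Injective (nnKey x X) := fun i j h => by
  have := congrArg ofLex h
  exact (Prod.mk.inj this).2

theorem isNearest_iff (x : EuclideanSpace ℝ (Fin d)) (z : Fin n → EuclideanSpace ℝ (Fin d) × ℝ)
    (I : Finset (Fin n)) (i : Fin n) :
    IsNearest x z I i ↔
      i ∈ I ∧ ∀ j ∈ I, nnKey x (fun l => (z l).1) i ≤ nnKey x (fun l => (z l).1) j := by
  simp [IsNearest, nnKey, Prod.Lex.toLex_le_toLex]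

theorem nnRank_lt (x : EuclideanSpace ℝ (Fin d)) (X : Fin n → EuclideanSpace ℝ (Fin d))
    (j : Fin n) : nnRank x X j < n := by
  classical
  have : (Finset.univ.filter fun l => nnKey x X l < nnKey x X j) ⊂ Finset.univ := by
    refine Finset.filter_ssubset.mpr ⟨j, Finset.mem_univ j, lt_irrefl _⟩
  simpa [nnRank] using Finset.card_lt_card this

theorem nnRank_injective (x : EuclideanSpace ℝ (Fin d)) (X : Fin n → EuclideanSpace ℝ (Fin d)) :
    Function.Injective (nnRank x X) := by
  classical
  have mono : ∀ i j, nnKey x X i < nnKey x X j → nnRank x X i < nnRank x X j := by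
    intro i j h
    apply Finset.card_lt_card
    rw [Finset.ssubset_iff_of_subset]
    · exact ⟨i, by simpa using h, by simp⟩
    · intro l hl
      simp only [Finset.mem_filter, Finset.mem_univ, true_and] at hl ⊢
      exact hl.trans h
  intro i j h
  rcases lt_trichotomy (nnKey x X i) (nnKey x X j) with h' | h' | h'
  · exact absurd h (mono _ _ h').ne
  · exact nnKey_injective x X h'
  · exact absurd h (mono _ _ h').ne'

/-- The rank as a permutation of the indices. -/
noncomputable def rankPerm (x : EuclideanSpace ℝ (Fin d))
    (X : Fin n → EuclideanSpace ℝ (Fin d)) : Equiv.Perm (Fin n) :=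
  Equiv.ofBijective (fun j => ⟨nnRank x X j, nnRank_lt x X j⟩)
    (Finite.injective_iff_bijective.mp fun i j h => nnRank_injective x X (by simpa using h))

/-- Ranks form a permutation of `0, ..., n - 1`, so a symmetric expression in them does not depend
on the features. This is what makes the conditional law of the noise sum easy to handle. -/
theorem prod_nnRank {M : Type*} [CommMonoid M] (x : EuclideanSpace ℝ (Fin d))
    (X : Fin n → EuclideanSpace ℝ (Fin d)) (F : ℕ → M) :
    ∏ j, F (nnRank x X j) = ∏ i ∈ Finset.range n, F i := by
  rw [← Fin.prod_univ_eq_prod_range]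
  exact Equiv.prod_comp (rankPerm x X) fun i : Fin n => F i

theorem sum_nnRank {M : Type*} [AddCommMonoid M] (x : EuclideanSpace ℝ (Fin d))
    (X : Fin n → EuclideanSpace ℝ (Fin d)) (F : ℕ → M) :
    ∑ j, F (nnRank x X j) = ∑ i ∈ Finset.range n, F i := by
  rw [← Fin.sum_univ_eq_sum_range]
  exact Equiv.sum_comp (rankPerm x X) fun i : Fin n => F i

-- The subsets in which `j` is nearest are `{j}` together with `s - 1` indices of larger key.
-- Breaking ties by index makes the key injective, so no genericity of the features is needed.
open Classical in
theorem card_filter_isNearest (x : EuclideanSpace ℝ (Fin d))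
    (z : Fin n → EuclideanSpace ℝ (Fin d) × ℝ) {s : ℕ} (hs : 1 ≤ s) (j : Fin n) :
    (((Finset.univ : Finset (Fin n)).powersetCard s).filter fun I => IsNearest x z I j).card =
      (n - 1 - nnRank x (fun l => (z l).1) j).choose (s - 1) := by
  set X : Fin n → EuclideanSpace ℝ (Fin d) := fun l => (z l).1
  set G := Finset.univ.filter fun l => nnKey x X j < nnKey x X l with hG
  have hcard : G.card = n - 1 - nnRank x X j := by
    have h1 : (Finset.univ.filter fun l => nnKey x X l < nnKey x X j).card +
        (Finset.univ.filter fun l => ¬ nnKey x X l < nnKey x X j).card = n := by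
      rw [Finset.card_filter_add_card_filter_not]; simp
    have h2 : (Finset.univ.filter fun l => ¬ nnKey x X l < nnKey x X j) = insert j G := by
      ext l
      simp only [hG, Finset.mem_filter, Finset.mem_univ, true_and, Finset.mem_insert, not_lt]
      constructor
      · intro h
        rcases h.eq_or_lt with h | h
        · exact Or.inl (nnKey_injective x X h.symm)
        · exact Or.inr h
      · rintro (rfl | h)
        · exact le_rfl
        · exact h.le
    rw [h2, Finset.card_insert_of_notMem (by simp [hG])] at h1
    unfold nnRank
    omega
  rw [← hcard, ← Finset.card_powersetCard]
  symm
  have hjG : ∀ T ∈ G.powersetCard (s - 1), j ∉ T := by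
    intro T hT hj
    have := (Finset.mem_powersetCard.mp hT).1 hj
    simp [hG] at this
  refine Finset.card_bij (fun T _ => insert j T) ?_ ?_ ?_
  · intro T hT
    have hT' := Finset.mem_powersetCard.mp hT
    rw [Finset.mem_filter, Finset.mem_powersetCard, isNearest_iff]
    refine ⟨⟨Finset.subset_univ _, ?_⟩, Finset.mem_insert_self _ _, ?_⟩
    · rw [Finset.card_insert_of_notMem (hjG T hT), hT'.2]; omega
    · intro l hl
      rcases Finset.mem_insert.mp hl with rfl | hl
      · exact le_rfl
      · have := hT'.1 hl
        simp only [hG, Finset.mem_filter, Finset.mem_univ, true_and] at this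
        exact this.le
  · intro T hT T' hT' h
    rw [← Finset.erase_insert (hjG T hT), ← Finset.erase_insert (hjG T' hT'), h]
  · intro I hI
    rw [Finset.mem_filter, Finset.mem_powersetCard, isNearest_iff] at hI
    obtain ⟨⟨_, hIc⟩, hjI, hmin⟩ := hI
    refine ⟨I.erase j, ?_, Finset.insert_erase hjI⟩
    rw [Finset.mem_powersetCard]
    refine ⟨fun l hl => ?_, by rw [Finset.card_erase_of_mem hjI, hIc]⟩
    rw [Finset.mem_erase] at hl
    simp only [hG, Finset.mem_filter, Finset.mem_univ, true_and]
    exact (hmin l hl.2).lt_of_ne fun h => hl.1 (nnKey_injective x X h).symm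

theorem dnn_eq_sum_nnWeight (x : EuclideanSpace ℝ (Fin d))
    (z : Fin n → EuclideanSpace ℝ (Fin d) × ℝ) {s : ℕ} (hs : 1 ≤ s) :
    dnn x s z = ∑ j, nnWeight n s (nnRank x (fun l => (z l).1) j) * (z j).2 := by
  classical
  unfold dnn oneNN nnWeight
  rw [Finset.sum_comm, Finset.mul_sum]
  refine Finset.sum_congr rfl fun j _ => ?_
  rw [← card_filter_isNearest x z hs j, Finset.card_filter]
  push_cast
  rw [div_mul_eq_mul_div, Finset.sum_mul, inv_mul_eq_div]
  congr 1
  refine Finset.sum_congr rfl fun I _ => ?_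
  split_ifs <;> simp

theorem twoScaleDNN_comm (x : EuclideanSpace ℝ (Fin d)) (s t : ℕ)
    (z : Fin n → EuclideanSpace ℝ (Fin d) × ℝ) : twoScaleDNN x s t z = twoScaleDNN x t s z := by
  unfold twoScaleDNN
  rw [← neg_sub (scaleRate d t) (scaleRate d s), div_neg, div_neg]
  ring

theorem twoScaleDNN_eq_extrapolation (x : EuclideanSpace ℝ (Fin d)) {s t : ℕ} (hd : 0 < d)
    (hs : 1 ≤ s) (hst : s < t) (z : Fin n → EuclideanSpace ℝ (Fin d) × ℝ) :
    twoScaleDNN x s t z =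
      (1 + extrapolation d s t) * dnn x t z - extrapolation d s t * dnn x s z := by
  have h1 := sub_pos.mpr (scaleRate_lt hd hs hst)
  have h2 : scaleRate d t - scaleRate d s ≠ 0 := by linarith
  unfold twoScaleDNN extrapolation
  rw [← neg_sub (scaleRate d s) (scaleRate d t), div_neg, div_neg]
  field_simp
  ring

theorem twoScaleDNN_eq_sum (x : EuclideanSpace ℝ (Fin d)) {s t : ℕ} (hd : 0 < d)
    (hs : 1 ≤ s) (hst : s < t) (z : Fin n → EuclideanSpace ℝ (Fin d) × ℝ) :
    twoScaleDNN x s t z =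
      ∑ j, twoScaleWeight d n s t (nnRank x (fun l => (z l).1) j) * (z j).2 := by
  rw [twoScaleDNN_eq_extrapolation x hd hs hst, dnn_eq_sum_nnWeight x z hs,
    dnn_eq_sum_nnWeight x z (by omega), Finset.mul_sum, Finset.mul_sum, ← Finset.sum_sub_distrib]
  refine Finset.sum_congr rfl fun j _ => ?_
  unfold twoScaleWeight
  ring

end Rank

/-! ### Averages over permutations -/

theorem exists_perm_map_eq {α : Type*} [Fintype α] [DecidableEq α] {T T' : Finset α}
    (h : T.card = T'.card) : ∃ σ : Equiv.Perm α, T.map σ.toEmbedding = T' := by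
  let e : {x // x ∈ T} ≃ {x // x ∈ T'} := Finset.equivOfCardEq h
  refine ⟨e.extendSubtype, Finset.eq_of_subset_of_card_le ?_ (by simp [h])⟩
  intro y hy
  obtain ⟨a, ha, rfl⟩ := Finset.mem_map.mp hy
  exact e.extendSubtype_mem a ha

/-- Double counting of the sum of `F (I.map π)` over all `I` and `π`: the sum over `π` is the same
for every `I` of size `s`, and the sum over `I` is the same for every `π`. -/
theorem choose_mul_sum_perm_map {n s : ℕ} (F : Finset (Fin n) → ℝ) {T : Finset (Fin n)}
    (hT : T.card = s) :
    (n.choose s : ℝ) * ∑ π : Equiv.Perm (Fin n), F (T.map π.toEmbedding) =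
      n.factorial * ∑ I ∈ (Finset.univ : Finset (Fin n)).powersetCard s, F I := by
  have hinv : ∀ I ∈ (Finset.univ : Finset (Fin n)).powersetCard s,
      ∑ π : Equiv.Perm (Fin n), F (I.map π.toEmbedding) =
        ∑ π : Equiv.Perm (Fin n), F (T.map π.toEmbedding) := by
    intro I hI
    obtain ⟨σ, hσ⟩ := exists_perm_map_eq (hT.trans (Finset.mem_powersetCard.mp hI).2.symm)
    rw [← Equiv.sum_comp (Equiv.mulRight σ) fun π : Equiv.Perm (Fin n) => F (T.map π.toEmbedding)]
    refine Finset.sum_congr rfl fun π _ => ?_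
    rw [← hσ, Finset.map_map]
    rfl
  have hperm : ∀ π : Equiv.Perm (Fin n),
      ∑ I ∈ (Finset.univ : Finset (Fin n)).powersetCard s, F (I.map π.toEmbedding) =
        ∑ I ∈ (Finset.univ : Finset (Fin n)).powersetCard s, F I := by
    intro π
    refine Finset.sum_bij' (fun I _ => I.map π.toEmbedding)
      (fun I _ => I.map π.symm.toEmbedding) ?_ ?_ ?_ ?_ ?_
    · intro I hI; simpa [Finset.mem_powersetCard] using hI
    · intro I hI; simpa [Finset.mem_powersetCard] using hI
    · intro I _; ext; simp [Finset.map_map]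
    · intro I _; ext; simp [Finset.map_map]
    · intro I _; rfl
  have h1 := Finset.sum_congr rfl hinv
  rw [Finset.sum_comm, Finset.sum_congr rfl fun π _ => hperm π] at h1
  simp only [Finset.sum_const, nsmul_eq_mul, Finset.card_univ, Fintype.card_perm,
    Fintype.card_fin, Finset.card_powersetCard] at h1
  exact h1.symm

section

variable {d n m : ℕ}

/-- Reindexing does not preserve the order of the indices, hence not the tie-breaking rule; this is
why the distances are assumed distinct. -/
theorem oneNN_comp (x : EuclideanSpace ℝ (Fin d)) (z : Fin n → EuclideanSpace ℝ (Fin d) × ℝ)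
    (hz : Function.Injective fun j => ‖(z j).1 - x‖) (e : Fin m ↪ Fin n) (T : Finset (Fin m)) :
    oneNN x (z ∘ e) T = oneNN x z (T.map e) := by
  classical
  have hlt : ∀ {i j : Fin n}, i ≠ j →
      (‖(z i).1 - x‖ ≤ ‖(z j).1 - x‖ ↔ ‖(z i).1 - x‖ < ‖(z j).1 - x‖) := fun h =>
    ⟨fun h' => h'.lt_of_ne fun h'' => h (hz h''), le_of_lt⟩
  have hiff : ∀ i, IsNearest x (z ∘ e) T i ↔ IsNearest x z (T.map e) (e i) := by
    intro i
    unfold IsNearest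
    simp only [Finset.mem_map', Finset.forall_mem_map, Function.comp]
    refine and_congr_right fun _ => forall₂_congr fun j _ => ?_
    rcases eq_or_ne i j with rfl | hij
    · simp
    · have : ‖(z (e i)).1 - x‖ ≠ ‖(z (e j)).1 - x‖ := fun h => hij (e.injective (hz h))
      simp [this]
  unfold oneNN
  refine Fintype.sum_of_injective e e.injective _ _ ?_ ?_
  · intro i hi
    rw [if_neg]
    intro h
    obtain ⟨j, _, rfl⟩ := Finset.mem_map.mp h.1
    exact hi ⟨j, rfl⟩
  · intro i
    simp [hiff i]

/-- Averaging the estimator of `m` of the points over all relabelings recovers the full estimator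
for any scale `s ≤ m`. Both scales of the two-scale estimator thus share one kernel, of `t`
arguments. -/
theorem sum_perm_dnn (x : EuclideanSpace ℝ (Fin d)) (z : Fin n → EuclideanSpace ℝ (Fin d) × ℝ)
    (hz : Function.Injective fun j => ‖(z j).1 - x‖) (e : Fin m ↪ Fin n) {s : ℕ} (hs : s ≤ m) :
    ∑ π : Equiv.Perm (Fin n), dnn x s (z ∘ (e.trans π.toEmbedding)) =
      n.factorial * dnn x s z := by
  have hmn : m ≤ n := by simpa using Fintype.card_le_of_embedding e
  have p1 : (0 : ℝ) < n.choose s := by exact_mod_cast Nat.choose_pos (hs.trans hmn)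
  have p2 : (0 : ℝ) < m.choose s := by exact_mod_cast Nat.choose_pos hs
  unfold dnn
  rw [← Finset.mul_sum, Finset.sum_comm]
  have : ∀ T ∈ (Finset.univ : Finset (Fin m)).powersetCard s,
      ∑ π : Equiv.Perm (Fin n), oneNN x (z ∘ (e.trans π.toEmbedding)) T =
      n.factorial * ((n.choose s : ℝ)⁻¹ *
        ∑ I ∈ (Finset.univ : Finset (Fin n)).powersetCard s, oneNN x z I) := by
    intro T hT
    have h := choose_mul_sum_perm_map (oneNN x z) (T := T.map e) (s := s)
      (by rw [Finset.card_map]; exact (Finset.mem_powersetCard.mp hT).2)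
    simp_rw [oneNN_comp x z hz]
    simp_rw [Finset.map_map] at h
    field_simp
    linarith
  rw [Finset.sum_congr rfl this, Finset.sum_const, Finset.card_powersetCard, Finset.card_univ,
    Fintype.card_fin, nsmul_eq_mul]
  field_simp

theorem sum_perm_twoScaleDNN (x : EuclideanSpace ℝ (Fin d))
    (z : Fin n → EuclideanSpace ℝ (Fin d) × ℝ)
    (hz : Function.Injective fun j => ‖(z j).1 - x‖) (e : Fin m ↪ Fin n) {s t : ℕ}
    (hs : s ≤ m) (ht : t ≤ m) :
    ∑ π : Equiv.Perm (Fin n), twoScaleDNN x s t (z ∘ (e.trans π.toEmbedding)) =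
      n.factorial * twoScaleDNN x s t z := by
  unfold twoScaleDNN
  rw [Finset.sum_add_distrib, ← Finset.mul_sum, ← Finset.mul_sum, sum_perm_dnn x z hz e hs,
    sum_perm_dnn x z hz e ht]
  ring

end

/-! ### The variance of a generalized U-statistic -/

section Hoeffding

variable {α : Type*} [MeasurableSpace α] (Q : Measure α) [IsProbabilityMeasure Q] {n t : ℕ}

theorem iIndepFun_eval_pi {ι : Type*} [Fintype ι] :
    iIndepFun (fun (i : ι) (z : ι → α) => z i) (Measure.pi fun _ => Q) :=
  iIndepFun_pi (μ := fun _ : ι => Q) (X := fun _ => id) fun _ => aemeasurable_id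

theorem measurePreserving_comp_embedding (e : Fin t ↪ Fin n) :
    MeasurePreserving (fun z : Fin n → α => z ∘ e) (Measure.pi fun _ => Q)
      (Measure.pi fun _ => Q) := by
  refine ⟨by fun_prop, ?_⟩
  have h := (iIndepFun_eval_pi Q (ι := Fin n)).precomp e.injective
  rw [iIndepFun_iff_map_fun_eq_pi_map fun i => (measurable_pi_apply (e i)).aemeasurable] at h
  refine h.trans ?_
  congr 1
  funext i
  exact (measurePreserving_eval (fun _ : Fin n => Q) (e i)).map_eq

theorem indepFun_comp_embedding {e e' : Fin t ↪ Fin n}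
    (h : ∀ i j, e i ≠ e' j) :
    IndepFun (fun z : Fin n → α => z ∘ e) (fun z => z ∘ e') (Measure.pi fun _ => Q) := by
  have hd : Disjoint (Finset.univ.map e) (Finset.univ.map e') := by
    rw [Finset.disjoint_left]
    intro a ha ha'
    obtain ⟨i, _, rfl⟩ := Finset.mem_map.mp ha
    obtain ⟨j, _, hj⟩ := Finset.mem_map.mp ha'
    exact h i j hj.symm
  have h1 := (iIndepFun_eval_pi Q (ι := Fin n)).indepFun_finset _ _ hd (by fun_prop)
  exact h1.comp
    (φ := fun w (i : Fin t) => w ⟨e i, Finset.mem_map_of_mem e (Finset.mem_univ i)⟩)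
    (ψ := fun w (i : Fin t) => w ⟨e' i, Finset.mem_map_of_mem e' (Finset.mem_univ i)⟩)
    (by fun_prop) (by fun_prop)

/-- The `b`-th block of `t` consecutive indices. -/
def blockEmbedding (n t : ℕ) (b : Fin (n / t)) : Fin t ↪ Fin n where
  toFun i := ⟨b * t + i, by
    have h1 : (b + 1) * t ≤ n / t * t := Nat.mul_le_mul_right t b.2
    have h2 := Nat.div_mul_le_self n t
    have h3 := i.2
    nlinarith⟩
  inj' i j h := by
    simp only [Fin.mk.injEq, add_right_inj] at h
    exact Fin.ext h

theorem blockEmbedding_ne {b b' : Fin (n / t)} (hb : b ≠ b') (i j : Fin t) :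
    blockEmbedding n t b i ≠ blockEmbedding n t b' j := by
  intro h
  have h' : (b : ℕ) * t + i = b' * t + j := congrArg Fin.val h
  have e1 : ((b : ℕ) * t + i) / t = b := by
    rw [mul_comm, Nat.mul_add_div i.pos, Nat.div_eq_of_lt i.2, add_zero]
  have e2 : ((b' : ℕ) * t + j) / t = b' := by
    rw [mul_comm, Nat.mul_add_div i.pos, Nat.div_eq_of_lt j.2, add_zero]
  exact hb (Fin.ext (e1.symm.trans ((congrArg (· / t) h').trans e2)))

/-- Hoeffding's variance inequality. -/
theorem variance_le_of_sum_perm (ht : 1 ≤ t) (htn : t ≤ n) {U : (Fin n → α) → ℝ}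
    {K : (Fin t → α) → ℝ} (hK : MemLp K 2 (Measure.pi fun _ => Q))
    (hU : AEMeasurable U (Measure.pi fun _ => Q))
    (hUK : ∀ e : Fin t ↪ Fin n, ∀ᵐ z ∂(Measure.pi fun _ : Fin n => Q),
      ∑ π : Equiv.Perm (Fin n), K (z ∘ (e.trans π.toEmbedding)) = n.factorial * U z) :
    variance U (Measure.pi fun _ => Q) ≤ 2 * (t / n) * ∫ z, K z ^ 2 ∂(Measure.pi fun _ => Q) := by
  set 𝔪 : Measure (Fin n → α) := Measure.pi fun _ => Q
  set r := n / t with hr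
  have hr0 : 0 < r := Nat.div_pos htn ht
  have hr0' : (0 : ℝ) < r := by exact_mod_cast hr0
  have hfac : (0 : ℝ) < n.factorial := by exact_mod_cast n.factorial_pos
  -- Hoeffding's device: `A π` averages the kernel over `⌊n / t⌋` disjoint blocks of the relabeled
  -- sample, hence over independent copies, and `U` is the mean of the `A π`.
  let A : Equiv.Perm (Fin n) → (Fin n → α) → ℝ := fun π z =>
    (r : ℝ)⁻¹ * ∑ b : Fin r, K (z ∘ ((blockEmbedding n t b).trans π.toEmbedding))
  have hKe : ∀ e : Fin t ↪ Fin n, MemLp (fun z : Fin n → α => K (z ∘ e)) 2 𝔪 := fun e =>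
    hK.comp_measurePreserving (measurePreserving_comp_embedding Q e)
  have hA : ∀ π, MemLp (A π) 2 𝔪 := fun π =>
    (memLp_finsetSum _ fun b _ => hKe _).const_mul _
  set k := ∫ z, K z ∂(Measure.pi fun _ => Q) with hk
  have hKint : ∀ e : Fin t ↪ Fin n, ∫ z, K (z ∘ e) ∂𝔪 = k := fun e => by
    have h := (measurePreserving_comp_embedding Q e)
    rw [hk, ← h.map_eq, integral_map h.measurable.aemeasurable]
    rw [h.map_eq]; exact hK.1
  have hAint : ∀ π, ∫ z, A π z ∂𝔪 = k := fun π => by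
    simp only [A]
    rw [integral_const_mul, integral_finsetSum _ fun b _ => (hKe _).integrable (by norm_num)]
    simp_rw [hKint]
    simp [hr0'.ne']
  have hUA : ∀ᵐ z ∂𝔪, U z = (n.factorial : ℝ)⁻¹ * ∑ π, A π z := by
    have := ae_all_iff.mpr fun b : Fin r => hUK (blockEmbedding n t b)
    filter_upwards [this] with z hz
    simp only [A]
    rw [← Finset.mul_sum, Finset.sum_comm, Finset.sum_congr rfl fun b _ => hz b]
    simp only [Finset.sum_const, Finset.card_univ, Fintype.card_fin, nsmul_eq_mul]
    field_simp
  have hUint : ∫ z, U z ∂𝔪 = k := by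
    rw [integral_congr_ae hUA, integral_const_mul,
      integral_finsetSum _ fun b _ => (hA _).integrable (by norm_num)]
    simp_rw [hAint]
    simp [Fintype.card_perm, hfac.ne']
  have hvarK : ∀ e : Fin t ↪ Fin n, variance (fun z : Fin n → α => K (z ∘ e)) 𝔪 ≤
      ∫ z, K z ^ 2 ∂(Measure.pi fun _ => Q) := fun e => by
    have h := (measurePreserving_comp_embedding Q e)
    have h1 := variance_map (X := K) (Y := fun z : Fin n → α => z ∘ e) (μ := 𝔪)
      (by rw [h.map_eq]; exact hK.1.aemeasurable) h.measurable.aemeasurable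
    rw [h.map_eq] at h1
    refine (le_of_eq h1.symm).trans ?_
    exact variance_le_expectation_sq hK.1
  have hvarA : ∀ π, variance (A π) 𝔪 ≤
      (r : ℝ)⁻¹ * ∫ z, K z ^ 2 ∂(Measure.pi fun _ => Q) := fun π => by
    have e1 : A π = fun z => (r : ℝ)⁻¹ *
        (∑ b : Fin r, fun z : Fin n → α => K (z ∘ ((blockEmbedding n t b).trans π.toEmbedding))) z
        := by
      funext z; simp [A]
    rw [e1, variance_const_mul, IndepFun.variance_sum (fun b _ => hKe _)]
    · refine (mul_le_mul_of_nonneg_left (Finset.sum_le_sum fun b _ => hvarK _)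
        (sq_nonneg _)).trans (le_of_eq ?_)
      simp only [Finset.sum_const, Finset.card_univ, Fintype.card_fin, nsmul_eq_mul]
      field_simp
    · intro b _ b' _ hbb'
      have h0 := indepFun_comp_embedding Q (e := (blockEmbedding n t b).trans π.toEmbedding)
        (e' := (blockEmbedding n t b').trans π.toEmbedding)
        (fun i j h => blockEmbedding_ne hbb' i j (π.injective h))
      have hK' := hK.1.aemeasurable
      refine h0.comp₀ (measurePreserving_comp_embedding Q _).measurable.aemeasurable
        (measurePreserving_comp_embedding Q _).measurable.aemeasurable ?_ ?_
      · rw [(measurePreserving_comp_embedding Q _).map_eq]; exact hK'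
      · rw [(measurePreserving_comp_embedding Q _).map_eq]; exact hK'
  have hdiff : ∀ π, MemLp (fun z => A π z - k) 2 𝔪 := fun π => (hA π).sub (memLp_const k)
  -- By convexity of the square, the variance of a mean of identically centered variables is at most
  -- the mean of their variances.
  have hvarU : variance U 𝔪 ≤ (r : ℝ)⁻¹ * ∫ z, K z ^ 2 ∂(Measure.pi fun _ => Q) := by
    rw [variance_eq_integral hU, hUint]
    calc ∫ z, (U z - k) ^ 2 ∂𝔪
        ≤ ∫ z, (n.factorial : ℝ)⁻¹ * ∑ π, (A π z - k) ^ 2 ∂𝔪 := by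
          apply integral_mono_of_nonneg (ae_of_all _ fun z => sq_nonneg _)
          · exact (integrable_finsetSum _ fun π _ => (hdiff π).integrable_sq).const_mul _
          · filter_upwards [hUA] with z hz
            have h1 : U z - k = (n.factorial : ℝ)⁻¹ * ∑ π, (A π z - k) := by
              rw [hz, Finset.sum_sub_distrib]
              simp only [Finset.sum_const, Finset.card_univ, Fintype.card_perm, Fintype.card_fin,
                nsmul_eq_mul]
              field_simp
            have h2 := sq_sum_le_card_mul_sum_sq (s := Finset.univ)
              (f := fun π : Equiv.Perm (Fin n) => A π z - k)
            rw [Finset.card_univ, Fintype.card_perm, Fintype.card_fin] at h2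
            rw [h1, mul_pow]
            calc _ ≤ ((n.factorial : ℝ)⁻¹) ^ 2 * (n.factorial * ∑ π, (A π z - k) ^ 2) := by gcongr
              _ = _ := by field_simp
      _ = (n.factorial : ℝ)⁻¹ * ∑ π, variance (A π) 𝔪 := by
          rw [integral_const_mul, integral_finsetSum _ fun π _ => (hdiff π).integrable_sq]
          congr 1
          refine Finset.sum_congr rfl fun π _ => ?_
          rw [variance_eq_integral (hA π).1.aemeasurable, hAint]
      _ ≤ (n.factorial : ℝ)⁻¹ * ∑ π : Equiv.Perm (Fin n),
            (r : ℝ)⁻¹ * ∫ z, K z ^ 2 ∂(Measure.pi fun _ => Q) := by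
          gcongr with π _
          exact hvarA π
      _ = _ := by
          simp only [Finset.sum_const, Finset.card_univ, Fintype.card_perm, Fintype.card_fin,
            nsmul_eq_mul]
          field_simp
  refine hvarU.trans ?_
  refine mul_le_mul_of_nonneg_right ?_ (integral_nonneg fun z => sq_nonneg _)
  have ht0 : (0 : ℝ) < t := by exact_mod_cast ht
  have hn0 : (0 : ℝ) < n := by exact_mod_cast (by omega : 0 < n)
  -- `n < (r + 1) t ≤ 2 r t` replaces the number of blocks `r` by `n / t` at the cost of the factor
  -- `2`.
  have h1 : n < (r + 1) * t := by
    have := Nat.lt_div_mul_add (a := n) ht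
    rw [add_mul, one_mul]; exact this
  have h2 : n ≤ 2 * (t * r) := by nlinarith
  have h3 : (n : ℝ) ≤ 2 * (t * r) := by exact_mod_cast h2
  rw [inv_eq_one_div, mul_div_assoc', div_le_div_iff₀ hr0' hn0]
  linarith

end Hoeffding

/-! ### Moments of the nearest neighbor estimators of an i.i.d. sample -/

section Moments

variable {d n : ℕ}

theorem measurable_nnRank (x : EuclideanSpace ℝ (Fin d)) (j : Fin n) :
    Measurable fun X : Fin n → EuclideanSpace ℝ (Fin d) => nnRank x X j := by
  classical
  have h : ∀ l, MeasurableSet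
      {X : Fin n → EuclideanSpace ℝ (Fin d) | nnKey x X l < nnKey x X j} := by
    intro l
    have : {X : Fin n → EuclideanSpace ℝ (Fin d) | nnKey x X l < nnKey x X j} =
        {X | ‖X l - x‖ < ‖X j - x‖} ∪ ({X | ‖X l - x‖ = ‖X j - x‖} ∩ {_X | l < j}) := by
      ext X
      simp [nnKey, Prod.Lex.toLex_lt_toLex]
    rw [this]
    refine (measurableSet_lt (by fun_prop) (by fun_prop)).union
      ((measurableSet_eq_fun (by fun_prop) (by fun_prop)).inter (MeasurableSet.const _))
  have e : (fun X : Fin n → EuclideanSpace ℝ (Fin d) => nnRank x X j) = fun X =>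
      ∑ l, if nnKey x X l < nnKey x X j then 1 else 0 := by
    funext X
    rw [nnRank, Finset.card_filter]
  rw [e]
  exact Finset.measurable_fun_sum _ fun l _ =>
    Measurable.ite (h l) measurable_const measurable_const

theorem measurable_comp_nnRank (x : EuclideanSpace ℝ (Fin d)) (F : ℕ → ℝ) (j : Fin n) :
    Measurable fun X : Fin n → EuclideanSpace ℝ (Fin d) => F (nnRank x X j) :=
  (measurable_from_nat (f := F)).comp (measurable_nnRank x j)

theorem abs_comp_nnRank_le (x : EuclideanSpace ℝ (Fin d)) (F : ℕ → ℝ) (j : Fin n)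
    (X : Fin n → EuclideanSpace ℝ (Fin d)) :
    |F (nnRank x X j)| ≤ ∑ i ∈ Finset.range n, |F i| :=
  Finset.single_le_sum (f := fun i => |F i|) (fun _ _ => abs_nonneg _)
    (Finset.mem_range.mpr (nnRank_lt x X j))

variable (ρ : Measure (EuclideanSpace ℝ (Fin d))) [IsProbabilityMeasure ρ]
  (x : EuclideanSpace ℝ (Fin d))

/-- The mass of the closed ball of radius `r` around `x`. -/
noncomputable def ballMass (r : ℝ) : ℝ := ρ.real (Metric.closedBall x r)

theorem ballMass_le_one (r : ℝ) : ballMass ρ x r ≤ 1 := measureReal_le_one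

theorem ballMass_mono : Monotone (ballMass ρ x) := fun _ _ h =>
  measureReal_mono (Metric.closedBall_subset_closedBall h)

theorem measurable_ballMass_norm :
    Measurable fun z : EuclideanSpace ℝ (Fin d) => ballMass ρ x ‖z - x‖ :=
  (ballMass_mono ρ x).measurable.comp (by fun_prop)

variable {x} in
theorem measureReal_norm_lt (r : ℝ) : ρ.real {z | r < ‖z - x‖} = 1 - ballMass ρ x r := by
  have : {z : EuclideanSpace ℝ (Fin d) | r < ‖z - x‖} = (Metric.closedBall x r)ᶜ := by
    ext z; simp [dist_eq_norm]
  rw [this, measureReal_compl Metric.isClosed_closedBall.measurableSet, probReal_univ, ballMass]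

variable {ρ} in
theorem memLp_sum_nnRank {p : ENNReal} (F : ℕ → ℝ) {g : EuclideanSpace ℝ (Fin d) → ℝ}
    (hg : MemLp g p ρ) :
    MemLp (fun X : Fin n → EuclideanSpace ℝ (Fin d) => ∑ j, F (nnRank x X j) * g (X j)) p
      (Measure.pi fun _ => ρ) := by
  refine memLp_finsetSum _ fun j _ => ?_
  have h1 : MemLp (fun X : Fin n → EuclideanSpace ℝ (Fin d) => g (X j)) p
      (Measure.pi fun _ => ρ) :=
    hg.comp_measurePreserving (measurePreserving_eval (fun _ : Fin n => ρ) j)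
  refine MemLp.of_le_mul (c := ∑ i ∈ Finset.range n, |F i|) h1
    ((measurable_comp_nnRank x F j).aestronglyMeasurable.mul h1.1) (ae_of_all _ fun X => ?_)
  rw [norm_mul, Real.norm_eq_abs]
  exact mul_le_mul_of_nonneg_right (abs_comp_nnRank_le x F j X) (norm_nonneg _)

variable {ρ x} in
-- By Fubini, two independent features share a distance to `x` with probability zero, since spheres
-- around `x` are null.
theorem ae_injective_norm_sub (hρ : ∀ r, ρ {z | ‖z - x‖ = r} = 0) :
    ∀ᵐ X ∂(Measure.pi fun _ : Fin n => ρ), Function.Injective fun j => ‖X j - x‖ := by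
  have h : ∀ i j : Fin n, i ≠ j →
      ∀ᵐ X ∂(Measure.pi fun _ : Fin n => ρ), ‖X i - x‖ ≠ ‖X j - x‖ := by
    intro i j hij
    have h1 := (iIndepFun_eval_pi ρ (ι := Fin n)).indepFun hij
    rw [indepFun_iff_map_prod_eq_prod_map_map (measurable_pi_apply i).aemeasurable
      (measurable_pi_apply j).aemeasurable,
      (measurePreserving_eval (fun _ : Fin n => ρ) i).map_eq,
      (measurePreserving_eval (fun _ : Fin n => ρ) j).map_eq] at h1
    have hS : MeasurableSet {p : EuclideanSpace ℝ (Fin d) × EuclideanSpace ℝ (Fin d) |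
        ‖p.1 - x‖ = ‖p.2 - x‖} := measurableSet_eq_fun (by fun_prop) (by fun_prop)
    have h2 : (ρ.prod ρ) {p | ‖p.1 - x‖ = ‖p.2 - x‖} = 0 := by
      rw [Measure.measure_prod_null hS]
      refine ae_of_all _ fun a => ?_
      simpa [eq_comm] using hρ ‖a - x‖
    rw [← h1, Measure.map_apply (by fun_prop) hS] at h2
    rw [ae_iff]
    simpa using h2
  have h' := ae_all_iff.mpr fun i => ae_all_iff.mpr fun j => (Filter.eventually_imp_distrib_left
    (p := i ≠ j)).mpr (h i j)
  filter_upwards [h'] with X hX i j hij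
  by_contra hne
  exact hX i j hne hij

theorem measureReal_pi_forall_norm_lt (J : Finset (Fin n)) (r : ℝ) :
    (Measure.pi fun _ : Fin n => ρ).real {w | ∀ j ∈ J, r < ‖w j - x‖} =
      (1 - ballMass ρ x r) ^ J.card := by
  classical
  have e : {w : Fin n → EuclideanSpace ℝ (Fin d) | ∀ j ∈ J, r < ‖w j - x‖} =
      Set.univ.pi fun j => if j ∈ J then {z | r < ‖z - x‖} else Set.univ := by
    ext w
    simp only [Set.mem_ofPred_eq, Set.mem_pi, Set.mem_univ, true_imp_iff]
    refine forall_congr' fun j => ?_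
    by_cases h : j ∈ J <;> simp [h]
  rw [e, Measure.real, Measure.pi_pi, ENNReal.toReal_prod]
  have : ∀ j, (ρ (if j ∈ J then {z | r < ‖z - x‖} else Set.univ)).toReal =
      if j ∈ J then (1 - ballMass ρ x r) else 1 := by
    intro j
    by_cases h : j ∈ J
    · rw [if_pos h, if_pos h]; exact measureReal_norm_lt ρ r
    · simp [h]
  simp_rw [this]
  rw [Finset.prod_ite_mem, Finset.univ_inter, Finset.prod_const]

variable {ρ x}

theorem measurableSet_isNearest (m : EuclideanSpace ℝ (Fin d) → ℝ) (I : Finset (Fin n))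
    (i : Fin n) :
    MeasurableSet {X : Fin n → EuclideanSpace ℝ (Fin d) |
      IsNearest x (fun j => (X j, m (X j))) I i} := by
  have : {X : Fin n → EuclideanSpace ℝ (Fin d) |
      IsNearest x (fun j => (X j, m (X j))) I i} = {_X | i ∈ I} ∩ ⋂ j ∈ I,
        ({X | ‖X i - x‖ < ‖X j - x‖} ∪ ({X | ‖X i - x‖ = ‖X j - x‖} ∩ {_X | i ≤ j})) := by
    ext X
    simp [IsNearest]
  rw [this]
  refine (MeasurableSet.const _).inter (MeasurableSet.biInter (Set.to_countable _) fun j _ =>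
    (measurableSet_lt (by fun_prop) (by fun_prop)).union
      ((measurableSet_eq_fun (by fun_prop) (by fun_prop)).inter (MeasurableSet.const _)))

-- Condition on the feature `X i`: each of the other `I.card - 1` features of the subsample has to
-- be farther away, which has probability `1 - ballMass ρ x ‖X i - x‖`, independently. Ties are
-- null.
open Classical in
theorem integral_ite_isNearest (hρ : ∀ r, ρ {z | ‖z - x‖ = r} = 0)
    {g : EuclideanSpace ℝ (Fin d) → ℝ} (hg : Integrable g ρ) {I : Finset (Fin n)} {i : Fin n}
    (hi : i ∈ I) :
    ∫ X, (if IsNearest x (fun j => (X j, g (X j))) I i then g (X i) else 0)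
        ∂(Measure.pi fun _ : Fin n => ρ) =
      ∫ z, g z * (1 - ballMass ρ x ‖z - x‖) ^ (I.card - 1) ∂ρ := by
  obtain ⟨N, rfl⟩ : ∃ N, n = N + 1 := ⟨n - 1, by have := i.pos; omega⟩
  set J : Finset (Fin N) := Finset.univ.filter fun j => i.succAbove j ∈ I with hJ
  have hJc : J.card = I.card - 1 := by
    rw [← Finset.card_erase_of_mem hi, ← Finset.card_map (Fin.succAboveEmb i)]
    congr 1
    ext k
    simp only [hJ, Finset.mem_map, Finset.mem_filter, Finset.mem_univ, true_and,
      Finset.mem_erase, Fin.succAboveEmb_apply]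
    constructor
    · rintro ⟨j, hj, rfl⟩
      exact ⟨Fin.succAbove_ne i j, hj⟩
    · rintro ⟨hk, hkI⟩
      obtain ⟨j, rfl⟩ := Fin.exists_succAbove_eq hk
      exact ⟨j, hkI, rfl⟩
  set S : Set (EuclideanSpace ℝ (Fin d) × (Fin N → EuclideanSpace ℝ (Fin d))) :=
    {p | ∀ j ∈ J, ‖p.1 - x‖ < ‖p.2 j - x‖} with hS
  have hSm : MeasurableSet S := by
    have : S = ⋂ j ∈ J, {p | ‖p.1 - x‖ < ‖p.2 j - x‖} := by
      ext p; simp [hS]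
    rw [this]
    exact MeasurableSet.biInter (Set.to_countable _) fun j _ =>
      measurableSet_lt (by fun_prop) (by fun_prop)
  have h1 : (fun X : Fin (N + 1) → EuclideanSpace ℝ (Fin d) =>
      if IsNearest x (fun j => (X j, g (X j))) I i then g (X i) else 0) =ᵐ[Measure.pi fun _ => ρ]
      fun X => S.indicator (fun p => g p.1)
        (MeasurableEquiv.piFinSuccAbove (fun _ => EuclideanSpace ℝ (Fin d)) i X) := by
    filter_upwards [ae_injective_norm_sub (n := N + 1) hρ] with X hX
    have hiff : IsNearest x (fun j => (X j, g (X j))) I i ↔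
        (MeasurableEquiv.piFinSuccAbove (fun _ => EuclideanSpace ℝ (Fin d)) i X) ∈ S := by
      simp only [IsNearest, hi, true_and, hS, Set.mem_ofPred_eq, hJ, Finset.mem_filter,
        Finset.mem_univ]
      rw [Fin.forall_iff_succAbove i]
      simp only [hi, true_imp_iff, lt_irrefl, le_refl, and_self, or_true, true_and]
      refine forall_congr' fun j => imp_congr_right fun _ => ?_
      have hne : ‖X i - x‖ ≠ ‖X (i.succAbove j) - x‖ := fun h =>
        (Fin.succAbove_ne i j) (hX h).symm
      simp only [hne, false_and, or_false]
      rfl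
    by_cases h : IsNearest x (fun j => (X j, g (X j))) I i
    · rw [if_pos h, Set.indicator_of_mem (hiff.mp h)]
      rfl
    · rw [if_neg h, Set.indicator_of_notMem (fun h' => h (hiff.mpr h'))]
  have hmp := measurePreserving_piFinSuccAbove (fun _ : Fin (N + 1) => ρ) i
  rw [integral_congr_ae h1, hmp.integral_comp' (g := S.indicator fun p => g p.1)]
  have hint : Integrable (S.indicator fun p : EuclideanSpace ℝ (Fin d) ×
      (Fin N → EuclideanSpace ℝ (Fin d)) => g p.1) (ρ.prod (Measure.pi fun _ => ρ)) :=
    (hg.comp_fst _).indicator hSm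
  rw [integral_prod _ hint]
  refine integral_congr_ae (ae_of_all _ fun a => ?_)
  have hsec : ∀ w : Fin N → EuclideanSpace ℝ (Fin d),
      S.indicator (fun p => g p.1) (a, w) =
        {w | ∀ j ∈ J, ‖a - x‖ < ‖w j - x‖}.indicator (fun _ => g a) w := fun w => rfl
  simp_rw [hsec]
  have hsm : MeasurableSet {w : Fin N → EuclideanSpace ℝ (Fin d) | ∀ j ∈ J, ‖a - x‖ < ‖w j - x‖} :=
    measurable_prodMk_left (x := a) hSm
  rw [integral_indicator_const _ hsm, measureReal_pi_forall_norm_lt, hJc, smul_eq_mul, mul_comm]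

/-- Each of the `s` members of a subsample contributes the same integral, and all subsamples agree,
so the mean does not depend on `n`. The scale enters only as a factor and an exponent, which permits
real `s` later on. -/
theorem integral_dnn (hρ : ∀ r, ρ {z | ‖z - x‖ = r} = 0)
    {g : EuclideanSpace ℝ (Fin d) → ℝ} (hg : Integrable g ρ) {s : ℕ} (hsn : s ≤ n) :
    ∫ X, dnn x s (fun j => (X j, g (X j))) ∂(Measure.pi fun _ : Fin n => ρ) =
      s * ∫ z, g z * (1 - ballMass ρ x ‖z - x‖) ^ (s - 1) ∂ρ := by
  classical
  have p : (0 : ℝ) < n.choose s := by exact_mod_cast Nat.choose_pos hsn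
  have hint : ∀ (I : Finset (Fin n)) (i : Fin n), Integrable
      (fun X : Fin n → EuclideanSpace ℝ (Fin d) =>
        if IsNearest x (fun j => (X j, g (X j))) I i then g (X i) else 0)
      (Measure.pi fun _ => ρ) := by
    intro I i
    have h1 : Integrable (fun X : Fin n → EuclideanSpace ℝ (Fin d) => g (X i))
        (Measure.pi fun _ => ρ) :=
      (measurePreserving_eval (fun _ : Fin n => ρ) i).integrable_comp_of_integrable hg
    refine (h1.indicator (measurableSet_isNearest (x := x) g I i)).congr (ae_of_all _ fun X => ?_)
    simp [Set.indicator_apply]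
  unfold dnn oneNN
  rw [integral_const_mul, integral_finsetSum _ fun I _ => integrable_finsetSum _ fun i _ => hint I i]
  have : ∀ I ∈ (Finset.univ : Finset (Fin n)).powersetCard s,
      ∫ X, (∑ i, if IsNearest x (fun j => (X j, g (X j))) I i then g (X i) else 0)
        ∂(Measure.pi fun _ : Fin n => ρ) =
      s * ∫ z, g z * (1 - ballMass ρ x ‖z - x‖) ^ (s - 1) ∂ρ := by
    intro I hI
    have hIc := (Finset.mem_powersetCard.mp hI).2
    rw [integral_finsetSum _ fun i _ => hint I i]
    rw [← Finset.sum_subset (Finset.subset_univ I)]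
    · rw [Finset.sum_congr rfl fun i hi => integral_ite_isNearest hρ hg hi, hIc, Finset.sum_const,
        hIc, nsmul_eq_mul]
    · intro i _ hi
      simp [IsNearest, hi]
  rw [Finset.sum_congr rfl this, Finset.sum_const, Finset.card_powersetCard, Finset.card_univ,
    Fintype.card_fin, nsmul_eq_mul]
  field_simp

theorem integrable_dnn {g : EuclideanSpace ℝ (Fin d) → ℝ} (hg : Integrable g ρ) {s : ℕ}
    (hs : 1 ≤ s) :
    Integrable (fun X : Fin n → EuclideanSpace ℝ (Fin d) => dnn x s (fun j => (X j, g (X j))))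
      (Measure.pi fun _ => ρ) := by
  simp_rw [dnn_eq_sum_nnWeight x _ hs]
  exact memLp_one_iff_integrable.mp
    (memLp_sum_nnRank x (nnWeight n s) (memLp_one_iff_integrable.mpr hg))

end Moments

/-! ### The variance of the regression part -/

section Variance

variable {d n s t : ℕ} {ρ : Measure (EuclideanSpace ℝ (Fin d))} [IsProbabilityMeasure ρ]
  {x : EuclideanSpace ℝ (Fin d)} {m : EuclideanSpace ℝ (Fin d) → ℝ}

/-- The bound has to be free of `t`: this term meets a geometric factor that decays in `s` only. It
uses `t ≤ 2 s (t - s)`, valid since `s` and `t - s` are at least `1`. -/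
theorem extrapolation_mul_le (hd : 0 < d) (hs : 1 ≤ s) (hst : s < t) :
    extrapolation d s t * s ≤ d * s ^ 2 := by
  have h := extrapolation_mul_sub_le hd hs hst
  have hs' : (1 : ℝ) ≤ s := by exact_mod_cast hs
  have hu : (1 : ℝ) ≤ t - s := by
    have : (s : ℝ) + 1 ≤ t := by exact_mod_cast hst
    linarith
  have hd' : (0 : ℝ) < d := by exact_mod_cast hd
  have h1 : (t : ℝ) ≤ 2 * s * (t - s) := by nlinarith
  have h2 : extrapolation d s t * s * (t - s) ≤ d * s ^ 2 * (t - s) := by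
    calc extrapolation d s t * s * (t - s) = extrapolation d s t * (t - s) * s := by ring
      _ ≤ d / 2 * t * s := by gcongr
      _ ≤ d / 2 * (2 * s * (t - s)) * s := by gcongr
      _ = _ := by ring
  exact le_of_mul_le_mul_right h2 (by linarith)

theorem extrapolation_le (hd : 0 < d) (hs : 1 ≤ s) (hst : s < t) :
    extrapolation d s t ≤ d * t := by
  have h := extrapolation_mul_sub_le hd hs hst
  have hw := extrapolation_pos hd hs hst
  have hu : (1 : ℝ) ≤ t - s := by
    have : (s : ℝ) + 1 ≤ t := by exact_mod_cast hst
    linarith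
  have hd' : (0 : ℝ) ≤ d * t := by positivity
  nlinarith

/-- Here the sample has size `t`, as the kernel requires. Cauchy–Schwarz with the bounded absolute
weight sum costs `1 + d`. Near `x` the function is at most `ε`; far from `x` the crude bound of the
weights, with its large coefficient, is good enough because the far mass is geometrically small. -/
theorem twoScaleDNN_sq_le (hd : 0 < d) (hs : 1 ≤ s) (hst : s < t)
    {ε δ : ℝ} (hm : ∀ z, ‖z - x‖ < δ → |m z| ≤ ε)
    (X : Fin t → EuclideanSpace ℝ (Fin d)) :
    twoScaleDNN x s t (fun j => (X j, m (X j))) ^ 2 ≤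
      (1 + d) ^ 2 * ε ^ 2 + (1 + d) *
        ((1 + extrapolation d s t) *
            dnn x t (fun j => (X j, {z | δ ≤ ‖z - x‖}.indicator (fun z => m z ^ 2) (X j))) +
          extrapolation d s t *
            dnn x s (fun j => (X j, {z | δ ≤ ‖z - x‖}.indicator (fun z => m z ^ 2) (X j)))) := by
  set g : EuclideanSpace ℝ (Fin d) → ℝ := {z | δ ≤ ‖z - x‖}.indicator (fun z => m z ^ 2) with hg
  have hg0 : ∀ z, 0 ≤ g z := fun z => Set.indicator_nonneg (fun z _ => sq_nonneg _) z
  have hmg : ∀ z, m z ^ 2 ≤ ε ^ 2 + g z := by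
    intro z
    by_cases hz : δ ≤ ‖z - x‖
    · have : g z = m z ^ 2 := by rw [hg, Set.indicator_of_mem (by exact hz)]
      rw [this]; nlinarith [sq_nonneg ε]
    · have := hm z (not_le.mp hz)
      have h2 : m z ^ 2 ≤ ε ^ 2 := by
        rw [← sq_abs (m z)]
        exact pow_le_pow_left₀ (abs_nonneg _) this 2
      linarith [hg0 z]
  have hω := extrapolation_pos hd hs hst
  have h1d : (0 : ℝ) < 1 + d := by positivity
  set a : Fin t → ℝ := fun j => twoScaleWeight d t s t (nnRank x X j) with ha
  have hsum : ∑ j, |a j| ≤ 1 + d := by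
    have := sum_abs_twoScaleWeight_le (n := t) hd hs hst le_rfl
    rwa [← sum_nnRank x X fun i => |twoScaleWeight d t s t i|] at this
  have hab : ∀ j, |a j| ≤ (1 + extrapolation d s t) * nnWeight t t (nnRank x X j) +
      extrapolation d s t * nnWeight t s (nnRank x X j) := by
    intro j
    have n1 := nnWeight_nonneg t t (nnRank x X j)
    have n2 := nnWeight_nonneg t s (nnRank x X j)
    simp only [ha, twoScaleWeight]
    rw [abs_le]
    constructor <;> nlinarith [mul_nonneg hω.le n1, mul_nonneg hω.le n2]
  rw [twoScaleDNN_eq_sum x hd hs hst]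
  calc (∑ j, a j * m (X j)) ^ 2 ≤ (∑ j, |a j|) * ∑ j, |a j| * m (X j) ^ 2 := by
        refine Finset.sum_sq_le_sum_mul_sum_of_sq_le_mul _ (fun j _ => abs_nonneg _)
          (fun j _ => by positivity) fun j _ => le_of_eq ?_
        rw [mul_pow, ← sq_abs (a j)]; ring
    _ ≤ (1 + d) * ∑ j, |a j| * (ε ^ 2 + g (X j)) := by
        gcongr with j _
        exact hmg _
    _ = (1 + d) * ((∑ j, |a j|) * ε ^ 2 + ∑ j, |a j| * g (X j)) := by
        rw [Finset.sum_mul, ← Finset.sum_add_distrib]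
        simp_rw [mul_add]
    _ ≤ (1 + d) * ((1 + d) * ε ^ 2 + ∑ j, ((1 + extrapolation d s t) *
          nnWeight t t (nnRank x X j) + extrapolation d s t * nnWeight t s (nnRank x X j)) *
            g (X j)) := by
        gcongr with j _
        · exact hg0 _
        · exact hab j
    _ = _ := by
        rw [dnn_eq_sum_nnWeight x _ hs, dnn_eq_sum_nnWeight x _ (by omega : 1 ≤ t)]
        rw [mul_add, ← mul_assoc, ← sq]
        congr 2
        rw [Finset.mul_sum, Finset.mul_sum, ← Finset.sum_add_distrib]
        refine Finset.sum_congr rfl fun j _ => ?_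
        ring

theorem mul_integral_indicator_le (hm2 : MemLp m 2 ρ) (δ : ℝ) (s : ℕ) :
    ∫ z, {z | δ ≤ ‖z - x‖}.indicator (fun z => m z ^ 2) z *
        (1 - ballMass ρ x ‖z - x‖) ^ (s - 1) ∂ρ ≤
      (1 - ballMass ρ x δ) ^ (s - 1) * ∫ z, m z ^ 2 ∂ρ := by
  rw [← integral_const_mul]
  have hb : ∀ r, 0 ≤ 1 - ballMass ρ x r := fun r => sub_nonneg.mpr (ballMass_le_one ρ x r)
  apply integral_mono_of_nonneg
  · exact ae_of_all _ fun z => mul_nonneg (Set.indicator_nonneg (fun z _ => sq_nonneg _) z)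
      (pow_nonneg (hb _) _)
  · exact hm2.integrable_sq.const_mul _
  · refine ae_of_all _ fun z => ?_
    by_cases hz : δ ≤ ‖z - x‖
    · simp only
      rw [Set.indicator_of_mem (by exact hz), mul_comm]
      gcongr
      · exact hb _
      · exact ballMass_mono ρ x hz
    · simp only
      rw [Set.indicator_of_notMem (by exact hz), zero_mul]
      exact mul_nonneg (pow_nonneg (hb _) _) (sq_nonneg _)

theorem integral_twoScaleDNN_sq_le (hd : 0 < d) (hρ : ∀ r, ρ {z | ‖z - x‖ = r} = 0)
    (hm2 : MemLp m 2 ρ) (hs : 1 ≤ s) (hst : s < t) {ε δ : ℝ}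
    (hm : ∀ z, ‖z - x‖ < δ → |m z| ≤ ε) :
    ∫ X, twoScaleDNN x s t (fun j => (X j, m (X j))) ^ 2 ∂(Measure.pi fun _ : Fin t => ρ) ≤
      (1 + d) ^ 2 * ε ^ 2 + (1 + d) ^ 2 * (∫ z, m z ^ 2 ∂ρ) *
        (2 * (t ^ 2 * (1 - ballMass ρ x δ) ^ (t - 1)) +
          s ^ 2 * (1 - ballMass ρ x δ) ^ (s - 1)) := by
  set g : EuclideanSpace ℝ (Fin d) → ℝ := {z | δ ≤ ‖z - x‖}.indicator (fun z => m z ^ 2) with hg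
  have hgint : Integrable g ρ :=
    hm2.integrable_sq.indicator (measurableSet_le measurable_const (by fun_prop))
  have hω := extrapolation_pos hd hs hst
  have h1d : (0 : ℝ) < 1 + d := by positivity
  have ht : 1 ≤ t := by omega
  set β := 1 - ballMass ρ x δ with hβ
  have hβ0 : 0 ≤ β := sub_nonneg.mpr (ballMass_le_one ρ x δ)
  set V := ∫ z, m z ^ 2 ∂ρ with hV
  have hV0 : 0 ≤ V := integral_nonneg fun z => sq_nonneg _
  have it := (integrable_dnn (n := t) (x := x) hgint ht).const_mul (1 + extrapolation d s t)
  have is := (integrable_dnn (n := t) (x := x) hgint hs).const_mul (extrapolation d s t)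
  calc _ ≤ ∫ X, ((1 + d) ^ 2 * ε ^ 2 + (1 + d) *
        ((1 + extrapolation d s t) * dnn x t (fun j => (X j, g (X j))) +
          extrapolation d s t * dnn x s (fun j => (X j, g (X j)))))
            ∂(Measure.pi fun _ : Fin t => ρ) := by
        apply integral_mono_of_nonneg (ae_of_all _ fun X => sq_nonneg _)
        · exact (integrable_const _).add ((it.add is).const_mul _)
        · exact ae_of_all _ fun X => twoScaleDNN_sq_le hd hs hst hm X
    _ = (1 + d) ^ 2 * ε ^ 2 + (1 + d) *
        ((1 + extrapolation d s t) * (t * ∫ z, g z * (1 - ballMass ρ x ‖z - x‖) ^ (t - 1) ∂ρ) +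
          extrapolation d s t * (s * ∫ z, g z * (1 - ballMass ρ x ‖z - x‖) ^ (s - 1) ∂ρ)) := by
        have e1 := integral_add (integrable_const ((1 + d : ℝ) ^ 2 * ε ^ 2))
          ((it.add is).const_mul (1 + d : ℝ))
        simp only [Pi.add_apply] at e1
        rw [e1, integral_const_mul (1 + d : ℝ), integral_add it is, integral_const_mul (1 + extrapolation d s t),
          integral_const_mul (extrapolation d s t), integral_dnn hρ hgint le_rfl,
          integral_dnn hρ hgint hst.le]
        simp
    _ ≤ (1 + d) ^ 2 * ε ^ 2 + (1 + d) *
        ((1 + extrapolation d s t) * (t * (β ^ (t - 1) * V)) +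
          extrapolation d s t * (s * (β ^ (s - 1) * V))) := by
        gcongr
        · exact mul_integral_indicator_le hm2 δ t
        · exact mul_integral_indicator_le hm2 δ s
    _ = (1 + d) ^ 2 * ε ^ 2 + (1 + d) *
        ((1 + extrapolation d s t) * (t * (β ^ (t - 1) * V)) +
          (extrapolation d s t * s) * (β ^ (s - 1) * V)) := by ring
    _ ≤ (1 + d) ^ 2 * ε ^ 2 + (1 + d) *
        (((1 + d) * (2 * t)) * (t * (β ^ (t - 1) * V)) +
          ((1 + d) * s ^ 2) * (β ^ (s - 1) * V)) := by
        have h1 := extrapolation_le hd hs hst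
        have h2 := extrapolation_mul_le hd hs hst
        have ht' : (1 : ℝ) ≤ t := by exact_mod_cast ht
        have hd' : (0 : ℝ) < d := by exact_mod_cast hd
        have h3 : 1 + extrapolation d s t ≤ (1 + d) * (2 * t) := by nlinarith
        have h4 : extrapolation d s t * s ≤ (1 + d) * s ^ 2 := by nlinarith [sq_nonneg (s : ℝ)]
        gcongr
    _ = _ := by ring

theorem exists_variance_twoScaleDNN_le (hd : 0 < d) (hρ : ∀ r, ρ {z | ‖z - x‖ = r} = 0)
    (hpos : ∀ δ, 0 < δ → 0 < ballMass ρ x δ) (hm2 : MemLp m 2 ρ) (hmc : ContinuousAt m x)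
    (hmx : m x = 0) {ε : ℝ} (hε : 0 < ε) :
    ∃ N : ℕ, 1 ≤ N ∧ ∀ n s t : ℕ, N ≤ s → s < t → t ≤ n →
      variance (fun X : Fin n → EuclideanSpace ℝ (Fin d) =>
        twoScaleDNN x s t (fun j => (X j, m (X j)))) (Measure.pi fun _ => ρ) ≤ ε * (t / n) := by
  have h1d : (0 : ℝ) < 1 + d := by positivity
  set V := ∫ z, m z ^ 2 ∂ρ with hV
  have hV0 : 0 ≤ V := integral_nonneg fun z => sq_nonneg _
  -- Hoeffding's factor `2` leaves `ε / 2` for the second moment of the kernel: `ε / 4` for the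
  -- points near `x` and `ε / 4` for the far ones.
  obtain ⟨e, he, hee⟩ : ∃ e : ℝ, 0 < e ∧ (1 + d) ^ 2 * e ^ 2 ≤ ε / 4 := by
    refine ⟨Real.sqrt ε / (2 * (1 + d)), by positivity, le_of_eq ?_⟩
    rw [div_pow, Real.sq_sqrt hε.le]
    field_simp
    norm_num
  obtain ⟨δ, hδ, hmδ⟩ := Metric.continuousAt_iff.mp hmc e he
  have hm : ∀ z, ‖z - x‖ < δ → |m z| ≤ e := fun z hz => by
    have := hmδ (by rwa [dist_eq_norm])
    rw [Real.dist_eq, hmx, sub_zero] at this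
    exact this.le
  set β := 1 - ballMass ρ x δ with hβ
  have hβ0 : 0 ≤ β := sub_nonneg.mpr (ballMass_le_one ρ x δ)
  have hβ1 : β < 1 := by have := hpos δ hδ; linarith
  have hlim : Tendsto (fun k : ℕ => (k : ℝ) ^ 2 * β ^ (k - 1)) atTop (𝓝 0) := by
    rw [← tendsto_add_atTop_iff_nat 1]
    have h2 := tendsto_pow_const_mul_const_pow_of_lt_one 2 hβ0 hβ1
    have h1 := tendsto_pow_const_mul_const_pow_of_lt_one 1 hβ0 hβ1
    have h0 := tendsto_pow_const_mul_const_pow_of_lt_one 0 hβ0 hβ1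
    have := (h2.add (h1.const_mul 2)).add h0
    simp only [mul_zero, add_zero] at this
    refine this.congr fun k => ?_
    rw [Nat.add_sub_cancel]
    push_cast
    ring
  obtain ⟨c, hc, hcc⟩ : ∃ c : ℝ, 0 < c ∧ (1 + d) ^ 2 * V * (3 * c) ≤ ε / 4 := by
    refine ⟨ε / (12 * ((1 + d) ^ 2 * (V + 1))), by positivity, ?_⟩
    have : (1 + d : ℝ) ^ 2 * V * (3 * (ε / (12 * ((1 + d) ^ 2 * (V + 1))))) =
      ε / 4 * (V / (V + 1)) := by field_simp; ring
    rw [this]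
    exact mul_le_of_le_one_right (by positivity) (div_le_one_of_le₀ (by linarith) (by linarith))
  obtain ⟨N, hN⟩ := eventually_atTop.mp (hlim.eventually (ge_mem_nhds hc))
  refine ⟨max N 1, le_max_right _ _, fun n s t hNs hst htn => ?_⟩
  have hs : 1 ≤ s := (le_max_right _ _).trans hNs
  have hsN : N ≤ s := (le_max_left _ _).trans hNs
  have hmem : ∀ n' : ℕ, MemLp (fun X : Fin n' → EuclideanSpace ℝ (Fin d) =>
      twoScaleDNN x s t (fun j => (X j, m (X j)))) 2 (Measure.pi fun _ => ρ) := fun n' => by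
    simp_rw [twoScaleDNN_eq_sum x hd hs hst]
    exact memLp_sum_nnRank x (twoScaleWeight d n' s t) hm2
  have h1 := variance_le_of_sum_perm ρ (n := n) (t := t) (by omega) htn (hmem t)
    (hmem n).1.aemeasurable (fun e => by
      filter_upwards [ae_injective_norm_sub hρ] with X hX
      exact sum_perm_twoScaleDNN x (fun j => (X j, m (X j))) hX e hst.le le_rfl)
  refine h1.trans ?_
  have h2 := integral_twoScaleDNN_sq_le hd hρ hm2 hs hst hm
  have h3 : (2 * (t ^ 2 * β ^ (t - 1)) + s ^ 2 * β ^ (s - 1) : ℝ) ≤ 3 * c := by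
    have := hN s hsN
    have := hN t (by omega)
    linarith
  have h4 : (1 + d : ℝ) ^ 2 * V * (2 * (t ^ 2 * β ^ (t - 1)) + s ^ 2 * β ^ (s - 1)) ≤ ε / 4 :=
    (mul_le_mul_of_nonneg_left h3 (by positivity)).trans hcc
  calc _ ≤ 2 * (t / n : ℝ) * (ε / 4 + ε / 4) := by
        gcongr
        exact h2.trans (add_le_add hee h4)
    _ = _ := by ring

end Variance

/-! ### Second differences, masses of small balls and Gaussian-type integrals -/

/-- `b` is the second derivative at `0` on the diagonal. Symmetrizing removes the first-order term,
and `q h + q (-h) - b h` has derivative `q'(h) - q'(-h) - 2 q''(0) h = o(‖h‖)`, so the mean value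
inequality applies. -/
theorem exists_isLittleO_second_difference {E : Type*} [NormedAddCommGroup E] [NormedSpace ℝ E]
    {q : E → ℝ} (hq : ContDiffAt ℝ 2 q 0) (hq0 : q 0 = 0) :
    ∃ (b : E → ℝ) (C : ℝ), 0 ≤ C ∧ Continuous b ∧ (∀ (c : ℝ) v, b (c • v) = c ^ 2 * b v) ∧
      (∀ v, |b v| ≤ C * ‖v‖ ^ 2) ∧
      (fun h => q h + q (-h) - b h) =o[𝓝 0] fun h => ‖h‖ ^ 2 := by
  set A := fderiv ℝ (fderiv ℝ q) 0 with hA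
  have hsymm : ∀ v w, A v w = A w v :=
    hq.isSymmSndFDerivAt (by simp)
  have hd2 : HasFDerivAt (fderiv ℝ q) A 0 :=
    ((hq.fderiv_right (m := 1) (by norm_num)).differentiableAt (by norm_num)).hasFDerivAt
  have hdiff : ∀ᶠ h in 𝓝 (0 : E), DifferentiableAt ℝ q h := by
    filter_upwards [hq.eventually (by simp)] with h hh
    exact hh.differentiableAt (by norm_num)
  refine ⟨fun v => A v v, ‖A‖, A.opNorm_nonneg, by fun_prop, ?_, ?_, ?_⟩
  · intro c v
    simp only [map_smul, smul_apply, smul_eq_mul]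
    ring
  · intro v
    have := A.le_opNorm₂ v v
    rw [Real.norm_eq_abs] at this
    rw [sq, ← mul_assoc]; exact this
  · rw [isLittleO_iff]
    intro ε hε
    have h1 := (hasFDerivAt_iff_isLittleO_nhds_zero.mp hd2).def (show 0 < ε / 2 by positivity)
    obtain ⟨r, hr, hball⟩ := Metric.eventually_nhds_iff_ball.mp (h1.and hdiff)
    filter_upwards [Metric.ball_mem_nhds (0 : E) hr] with h hh
    have hh' : ‖h‖ < r := by simpa using hh
    have hsub : ∀ u ∈ Metric.closedBall (0 : E) ‖h‖, u ∈ Metric.ball (0 : E) r ∧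
        -u ∈ Metric.ball (0 : E) r := by
      intro u hu
      have : ‖u‖ ≤ ‖h‖ := by simpa using hu
      constructor <;> simpa using this.trans_lt hh'
    have hder : ∀ u ∈ Metric.closedBall (0 : E) ‖h‖,
        HasFDerivWithinAt (fun u => q u + q (-u) - A u u)
          (fderiv ℝ q u - fderiv ℝ q (-u) - (2 : ℝ) • A u) (Metric.closedBall (0 : E) ‖h‖) u := by
      intro u hu
      obtain ⟨hu1, hu2⟩ := hsub u hu
      have d1 := (hball u hu1).2.hasFDerivAt
      have d2 : HasFDerivAt (fun u => q (-u)) (-(fderiv ℝ q (-u))) u := by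
        have h0 := (hball (-u) hu2).2.hasFDerivAt
        exact (h0.comp u (hasFDerivAt_id u).neg).congr_fderiv (by ext v; simp)
      have d3 : HasFDerivAt (fun u => A u u) ((2 : ℝ) • A u) u := by
        have h0 := A.hasFDerivAt (x := u) |>.clm_apply (hasFDerivAt_id u)
        exact h0.congr_fderiv (by ext v; simp [hsymm v u, two_mul])
      have := (d1.add d2).sub d3
      refine (HasFDerivAt.congr_fderiv this ?_).hasFDerivWithinAt
      ext v; simp [sub_eq_add_neg]
    have hbound : ∀ u ∈ Metric.closedBall (0 : E) ‖h‖,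
        ‖fderiv ℝ q u - fderiv ℝ q (-u) - (2 : ℝ) • A u‖ ≤ ε * ‖h‖ := by
      intro u hu
      obtain ⟨hu1, hu2⟩ := hsub u hu
      have hu' : ‖u‖ ≤ ‖h‖ := by simpa using hu
      have b1 := (hball u hu1).1
      have b2 := (hball (-u) hu2).1
      simp only [zero_add, map_neg, norm_neg] at b1 b2
      have e : fderiv ℝ q u - fderiv ℝ q (-u) - (2 : ℝ) • A u =
          (fderiv ℝ q u - fderiv ℝ q 0 - A u) - (fderiv ℝ q (-u) - fderiv ℝ q 0 - -A u) := by
        rw [two_smul]; abel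
      rw [e]
      refine (norm_sub_le _ _).trans ?_
      nlinarith
    have := (convex_closedBall (0 : E) ‖h‖).norm_image_sub_le_of_norm_hasFDerivWithin_le hder hbound
      (x := 0) (y := h) (by simp) (by simp)
    simp only [hq0, neg_zero, map_zero, add_zero, sub_zero] at this
    rw [norm_pow, norm_norm]
    simpa [sq, mul_assoc] using this

section Analysis

variable {d : ℕ}

theorem integrable_norm_pow_mul_exp (hd : 0 < d) (k : ℕ) {c : ℝ} (hc : 0 < c) :
    Integrable fun v : EuclideanSpace ℝ (Fin d) => ‖v‖ ^ k * Real.exp (-(c * ‖v‖ ^ d)) := by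
  have : Nonempty (Fin d) := ⟨⟨0, hd⟩⟩
  rw [integrable_fun_norm_addHaar volume (f := fun y => y ^ k * Real.exp (-(c * y ^ d)))]
  have h := integrableOn_rpow_mul_exp_neg_mul_rpow (p := d) (s := ((d - 1 + k : ℕ) : ℝ)) (b := c)
    (by have : (0 : ℝ) ≤ ((d - 1 + k : ℕ) : ℝ) := Nat.cast_nonneg _
        linarith) (by exact_mod_cast hd) hc
  refine h.congr_fun (fun y _ => ?_) measurableSet_Ioi
  simp only [Real.rpow_natCast, finrank_euclideanSpace, Fintype.card_fin, smul_eq_mul, pow_add,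
    neg_mul]
  ring

/-- This is the cancellation behind the bias reduction. The integral `J l` of `exp (-(l κ ‖v‖ ^ d))
b v` equals `l ^ (-(1 + 2/d)) J 1`, by the substitution `v ↦ l ^ (1/d) v` and the degree-two
homogeneity of `b`. Computing `J'(1)` from this formula and under the integral sign gives the claim.
-/
theorem integral_gaussian_type_eq_zero (hd : 0 < d) {b : EuclideanSpace ℝ (Fin d) → ℝ} {C κ : ℝ}
    (hb : Continuous b) (hbs : ∀ (c : ℝ) v, b (c • v) = c ^ 2 * b v)
    (hbC : ∀ v, |b v| ≤ C * ‖v‖ ^ 2) (hκ : 0 < κ) :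
    ∫ v, ((1 + 2 / d : ℝ) - κ * ‖v‖ ^ d) * Real.exp (-(κ * ‖v‖ ^ d)) * b v = 0 := by
  have hd' : (0 : ℝ) < d := by exact_mod_cast hd
  have hmaj : ∀ (k : ℕ) {c : ℝ}, 0 < c → Integrable fun v : EuclideanSpace ℝ (Fin d) =>
      C * (‖v‖ ^ k * Real.exp (-(c * ‖v‖ ^ d))) := fun k c hc =>
    (integrable_norm_pow_mul_exp hd k hc).const_mul C
  have hF : ∀ l : ℝ, 0 < l → Integrable fun v : EuclideanSpace ℝ (Fin d) =>
      Real.exp (-(l * κ * ‖v‖ ^ d)) * b v := by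
    intro l hl
    refine (hmaj 2 (mul_pos hl hκ)).mono' (by fun_prop) (ae_of_all _ fun v => ?_)
    rw [norm_mul, Real.norm_eq_abs, Real.norm_eq_abs, Real.abs_exp]
    calc _ ≤ Real.exp (-(l * κ * ‖v‖ ^ d)) * (C * ‖v‖ ^ 2) := by gcongr; exact hbC v
      _ = _ := by ring
  set J : ℝ → ℝ := fun l => ∫ v : EuclideanSpace ℝ (Fin d), Real.exp (-(l * κ * ‖v‖ ^ d)) * b v
    with hJ
  have hscale : ∀ l : ℝ, 0 < l → J l = l ^ (-(1 + 2 / d : ℝ)) * J 1 := by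
    intro l hl
    set R : ℝ := l ^ (1 / d : ℝ) with hR
    have hR0 : 0 < R := Real.rpow_pos_of_pos hl _
    have hRd : R ^ d = l := by
      rw [hR, ← Real.rpow_natCast, ← Real.rpow_mul hl.le]
      simp [hd'.ne']
    have hR2 : R ^ 2 * l = l ^ (1 + 2 / d : ℝ) := by
      rw [hR, ← Real.rpow_natCast, ← Real.rpow_mul hl.le, Real.rpow_add hl, Real.rpow_one, mul_comm]
      congr 2
      push_cast; ring
    have h := Measure.integral_comp_smul (volume : Measure (EuclideanSpace ℝ (Fin d)))
      (fun v => Real.exp (-(1 * κ * ‖v‖ ^ d)) * b v) R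
    simp only [hbs, norm_smul, mul_pow, Real.norm_eq_abs, abs_of_pos hR0, hRd, one_mul,
      finrank_euclideanSpace, Fintype.card_fin, smul_eq_mul, abs_inv, abs_of_pos hl] at h
    have h1 : ∫ v : EuclideanSpace ℝ (Fin d),
        Real.exp (-(κ * (l * ‖v‖ ^ d))) * (R ^ 2 * b v) = R ^ 2 * J l := by
      rw [hJ, ← integral_const_mul]
      refine integral_congr_ae (ae_of_all _ fun v => ?_)
      simp only
      rw [show κ * (l * ‖v‖ ^ d) = l * κ * ‖v‖ ^ d by ring]
      ring
    have h2 : J 1 = ∫ v : EuclideanSpace ℝ (Fin d), Real.exp (-(κ * ‖v‖ ^ d)) * b v := by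
      simp [hJ]
    rw [h1, ← h2] at h
    rw [Real.rpow_neg hl.le, ← hR2]
    field_simp
    field_simp at h
    linarith
  have hder : HasDerivAt J (∫ v : EuclideanSpace ℝ (Fin d),
      -(κ * ‖v‖ ^ d) * Real.exp (-(1 * κ * ‖v‖ ^ d)) * b v) 1 := by
    refine (hasDerivAt_integral_of_dominated_loc_of_deriv_le (μ := volume) (s := Set.Ioi (1 / 2))
      (F := fun l (v : EuclideanSpace ℝ (Fin d)) => Real.exp (-(l * κ * ‖v‖ ^ d)) * b v)
      (F' := fun l v => -(κ * ‖v‖ ^ d) * Real.exp (-(l * κ * ‖v‖ ^ d)) * b v)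
      (bound := fun v => κ * (C * (‖v‖ ^ (d + 2) * Real.exp (-(1 / 2 * κ * ‖v‖ ^ d)))))
      (Ioi_mem_nhds (by norm_num)) ?_ (hF 1 one_pos) ?_ ?_ ?_ ?_).2
    · exact Eventually.of_forall fun l => by fun_prop
    · fun_prop
    · refine ae_of_all _ fun v l hl => ?_
      have hl' : (1 / 2 : ℝ) < l := hl
      rw [norm_mul, norm_mul, norm_neg, Real.norm_eq_abs, Real.norm_eq_abs, Real.norm_eq_abs,
        Real.abs_exp, abs_of_nonneg (by positivity)]
      calc _ ≤ κ * ‖v‖ ^ d * Real.exp (-(1 / 2 * κ * ‖v‖ ^ d)) * (C * ‖v‖ ^ 2) := by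
            gcongr
            exact hbC v
        _ = _ := by ring
    · exact (hmaj (d + 2) (by positivity)).const_mul κ
    · refine ae_of_all _ fun v l _ => ?_
      have h1 : HasDerivAt (fun l : ℝ => -(l * κ * ‖v‖ ^ d)) (-(κ * ‖v‖ ^ d)) l := by
        have := ((hasDerivAt_id l).mul_const (κ * ‖v‖ ^ d)).neg
        simp only [one_mul] at this
        refine this.congr_of_eventuallyEq (Eventually.of_forall fun l => ?_)
        simp [mul_assoc]
      have := (h1.exp).mul_const (b v)
      exact this.congr_deriv (by ring)
  have hder2 : HasDerivAt J (-(1 + 2 / d : ℝ) * J 1) 1 := by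
    have h1 : HasDerivAt (fun l : ℝ => l ^ (-(1 + 2 / d : ℝ)) * J 1) (-(1 + 2 / d : ℝ) * J 1) 1 := by
      have := (Real.hasDerivAt_rpow_const (x := 1) (p := -(1 + 2 / d : ℝ))
        (Or.inl one_ne_zero)).mul_const (J 1)
      simpa using this
    refine h1.congr_of_eventuallyEq ?_
    filter_upwards [Ioi_mem_nhds (zero_lt_one' ℝ)] with l hl
    exact hscale l hl
  have heq := hder.unique hder2
  have hint1 : Integrable fun v : EuclideanSpace ℝ (Fin d) =>
      -(κ * ‖v‖ ^ d) * Real.exp (-(1 * κ * ‖v‖ ^ d)) * b v := by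
    refine ((hmaj (d + 2) hκ).const_mul κ).mono' (by fun_prop) (ae_of_all _ fun v => ?_)
    rw [norm_mul, norm_mul, norm_neg, Real.norm_eq_abs, Real.norm_eq_abs, Real.norm_eq_abs,
      Real.abs_exp, abs_of_nonneg (by positivity), one_mul]
    calc _ ≤ κ * ‖v‖ ^ d * Real.exp (-(κ * ‖v‖ ^ d)) * (C * ‖v‖ ^ 2) := by
          gcongr
          exact hbC v
      _ = _ := by ring
  have hsplit : ∫ v : EuclideanSpace ℝ (Fin d),
      ((1 + 2 / d : ℝ) - κ * ‖v‖ ^ d) * Real.exp (-(κ * ‖v‖ ^ d)) * b v =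
      (1 + 2 / d : ℝ) * J 1 + ∫ v : EuclideanSpace ℝ (Fin d),
        -(κ * ‖v‖ ^ d) * Real.exp (-(1 * κ * ‖v‖ ^ d)) * b v := by
    rw [hJ, ← integral_const_mul, ← integral_add ((hF 1 one_pos).const_mul _) hint1]
    refine integral_congr_ae (ae_of_all _ fun v => ?_)
    simp only [one_mul]
    ring
  rw [hsplit, heq]
  ring

theorem tendsto_ballMass_div_pow {ρ : Measure (EuclideanSpace ℝ (Fin d))} [IsProbabilityMeasure ρ]
    {x : EuclideanSpace ℝ (Fin d)} {f : EuclideanSpace ℝ (Fin d) → ℝ} (hf : Measurable f)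
    (hf0 : ∀ z, 0 ≤ f z) (hρ : ρ = volume.withDensity fun z => ENNReal.ofReal (f z))
    (hfc : ContinuousAt f x) :
    Tendsto (fun r => ballMass ρ x r / r ^ d) (𝓝[>] 0)
      (𝓝 (f x * volume.real (Metric.closedBall (0 : EuclideanSpace ℝ (Fin d)) 1))) := by
  set V := volume.real (Metric.closedBall (0 : EuclideanSpace ℝ (Fin d)) 1) with hV
  have hvol : ∀ r : ℝ, 0 ≤ r → volume.real (Metric.closedBall x r) = r ^ d * V := by
    intro r hr
    rw [Measure.addHaar_real_closedBall' volume x hr, finrank_euclideanSpace, Fintype.card_fin]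
  have hmass : ∀ r, ballMass ρ x r = ∫ z in Metric.closedBall x r, f z := by
    intro r
    rw [ballMass, hρ, Measure.real, withDensity_apply _ Metric.isClosed_closedBall.measurableSet,
      integral_eq_lintegral_of_nonneg_ae (ae_of_all _ hf0) hf.aestronglyMeasurable]
  have hs : Tendsto (fun r => Metric.closedBall x r) (𝓝[>] (0 : ℝ)) (𝓝 x).smallSets :=
    (tendsto_closedBall_smallSets x).mono_left nhdsWithin_le_nhds
  have h := hfc.integral_sub_linear_isLittleO_ae (μ := volume)
    (hf.stronglyMeasurable.stronglyMeasurableAtFilter) hs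
  have h2 : (fun r => ballMass ρ x r - r ^ d * V * f x) =o[𝓝[>] 0] fun r : ℝ => r ^ d := by
    refine IsLittleO.trans_isBigO (g := fun r => volume.real (Metric.closedBall x r)) ?_ ?_
    · refine h.congr' ?_ EventuallyEq.rfl
      filter_upwards [self_mem_nhdsWithin] with r hr
      rw [hvol r (le_of_lt hr), smul_eq_mul, hmass]
    · refine IsBigO.of_bound V ?_
      filter_upwards [self_mem_nhdsWithin] with r hr
      rw [hvol r (le_of_lt hr), norm_mul, mul_comm, Real.norm_eq_abs V,
        abs_of_nonneg measureReal_nonneg]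
  have h3 := h2.tendsto_div_nhds_zero.add_const (f x * V)
  rw [zero_add] at h3
  refine h3.congr' ?_
  filter_upwards [self_mem_nhdsWithin] with r hr
  have : r ^ d ≠ 0 := (pow_pos hr d).ne'
  field_simp
  ring

end Analysis

/-! ### The bias of the two-scale estimator -/

/-- Up to a power of `s`, the derivative of `s ^ (1 + 2 / d) * a ^ (s - 1)` in `s`. -/
noncomputable def tiltedPow (d : ℕ) (s a : ℝ) : ℝ :=
  ((1 + 2 / d : ℝ) + s * Real.log a) * a ^ (s - 1)

theorem measurable_tiltedPow (d : ℕ) (s : ℝ) : Measurable (tiltedPow d s) := by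
  unfold tiltedPow
  fun_prop

theorem abs_log_mul_self_le_one {a : ℝ} (ha : 0 ≤ a) (ha1 : a ≤ 1) : |Real.log a| * a ≤ 1 := by
  rcases ha.eq_or_lt with rfl | ha
  · simp
  have h1 := Real.one_sub_inv_le_log_of_pos ha
  rw [abs_of_nonpos (Real.log_nonpos ha.le ha1)]
  have : a⁻¹ * a = 1 := inv_mul_cancel₀ ha.ne'
  nlinarith

/-- One factor of the power `a ^ (s - 1)` is spent on taming the logarithm, since `|log a| a ≤ 1`;
this is why `s - 2` appears. At `a = 0` the power vanishes. -/
theorem abs_tiltedPow_le {d : ℕ} {s a c : ℝ} (hs : 2 < s) (ha : 0 ≤ a) (hac : a ≤ c)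
    (hc : c ≤ 1) : |tiltedPow d s a| ≤ ((1 + 2 / d : ℝ) + s) * c ^ (s - 2) := by
  have hp : (0 : ℝ) ≤ 1 + 2 / d := by positivity
  rcases ha.eq_or_lt with rfl | ha
  · unfold tiltedPow
    rw [Real.zero_rpow (by linarith), mul_zero, abs_zero]
    exact mul_nonneg (by linarith) (Real.rpow_nonneg hac _)
  have e : a ^ (s - 1) = a * a ^ (s - 2) := by
    rw [show s - 1 = 1 + (s - 2) by ring, Real.rpow_add ha, Real.rpow_one]
  have h1 := abs_log_mul_self_le_one ha.le (hac.trans hc)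
  unfold tiltedPow
  rw [e, ← mul_assoc, abs_mul, abs_of_nonneg (Real.rpow_nonneg ha.le _)]
  refine mul_le_mul ?_ (Real.rpow_le_rpow ha.le hac (by linarith)) (Real.rpow_nonneg ha.le _)
    (by linarith)
  rw [abs_mul, abs_of_pos ha]
  calc |(1 + 2 / d : ℝ) + s * Real.log a| * a
      ≤ ((1 + 2 / d : ℝ) + s * |Real.log a|) * a := by
        gcongr
        refine (abs_add_le _ _).trans ?_
        rw [abs_of_nonneg hp, abs_mul, abs_of_pos (by linarith : 0 < s)]
    _ = (1 + 2 / d : ℝ) * a + s * (|Real.log a| * a) := by ring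
    _ ≤ (1 + 2 / d : ℝ) * 1 + s * 1 := by
        gcongr
        exact hac.trans hc
    _ = _ := by ring

theorem abs_log_one_sub_le {u : ℝ} (hu : 0 ≤ u) (hu2 : u ≤ 1 / 2) :
    |Real.log (1 - u)| ≤ 2 * u := by
  have h0 : 0 < 1 - u := by linarith
  have h1 := Real.one_sub_inv_le_log_of_pos h0
  rw [abs_of_nonpos (Real.log_nonpos h0.le (by linarith))]
  have h2 : (1 - u)⁻¹ ≤ 1 + 2 * u := by
    rw [inv_le_iff_one_le_mul₀ h0]
    nlinarith
  linarith

/-- Supplies the integrable majorant near `x`. The exponent is halved because `s - 1 ≥ s / 2`. -/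
theorem abs_tiltedPow_one_sub_le {d : ℕ} {s u : ℝ} (hs : 2 ≤ s) (hu : 0 ≤ u) (hu2 : u ≤ 1 / 2) :
    |tiltedPow d s (1 - u)| ≤ ((1 + 2 / d : ℝ) + 2 * (s * u)) * Real.exp (-(s * u / 2)) := by
  have hp : (0 : ℝ) ≤ 1 + 2 / d := by positivity
  have h0 : 0 < 1 - u := by linarith
  unfold tiltedPow
  rw [abs_mul, abs_of_nonneg (Real.rpow_nonneg h0.le _)]
  have h1 : |(1 + 2 / d : ℝ) + s * Real.log (1 - u)| ≤ (1 + 2 / d : ℝ) + 2 * (s * u) := by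
    refine (abs_add_le _ _).trans ?_
    rw [abs_of_nonneg hp, abs_mul, abs_of_pos (by linarith : 0 < s)]
    have := mul_le_mul_of_nonneg_left (abs_log_one_sub_le hu hu2) (by linarith : 0 ≤ s)
    linarith
  refine mul_le_mul h1 ?_ (Real.rpow_nonneg h0.le _) (by positivity)
  rw [Real.rpow_def_of_pos h0]
  apply Real.exp_le_exp.mpr
  have := Real.log_le_sub_one_of_pos h0
  nlinarith

theorem tendsto_tiltedPow {d : ℕ} {u : ℝ → ℝ} {L : ℝ}
    (hu : Tendsto u atTop (𝓝 0)) (hsu : Tendsto (fun s => s * u s) atTop (𝓝 L)) :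
    Tendsto (fun s => tiltedPow d s (1 - u s)) atTop
      (𝓝 (((1 + 2 / d : ℝ) - L) * Real.exp (-L))) := by
  have h1 : Tendsto (fun s => 1 - u s) atTop (𝓝 1) := by simpa using hu.const_sub 1
  have hlog : Tendsto (fun s => Real.log (1 - u s)) atTop (𝓝 0) := by
    simpa using h1.log one_ne_zero
  have hpos : ∀ᶠ s in atTop, 0 < 1 - u s := h1.eventually (lt_mem_nhds one_pos)
  have hslog : Tendsto (fun s => s * Real.log (1 - u s)) atTop (𝓝 (-L)) := by
    have lo : Tendsto (fun s => -(s * u s) * (1 - u s)⁻¹) atTop (𝓝 (-L)) := by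
      simpa using hsu.neg.mul (h1.inv₀ one_ne_zero)
    refine tendsto_of_tendsto_of_tendsto_of_le_of_le' lo hsu.neg ?_ ?_
    · filter_upwards [hpos, eventually_gt_atTop 0] with s hs hs0
      have := Real.one_sub_inv_le_log_of_pos hs
      calc -(s * u s) * (1 - u s)⁻¹ = s * (1 - (1 - u s)⁻¹) := by field_simp; ring
        _ ≤ _ := by gcongr
    · filter_upwards [hpos, eventually_gt_atTop 0] with s hs hs0
      have := Real.log_le_sub_one_of_pos hs
      nlinarith
  have hexp : Tendsto (fun s => (1 - u s) ^ (s - 1)) atTop (𝓝 (Real.exp (-L))) := by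
    have h2 : Tendsto (fun s => Real.exp (s * Real.log (1 - u s) - Real.log (1 - u s))) atTop
        (𝓝 (Real.exp (-L))) := by
      have := (hslog.sub hlog)
      rw [sub_zero] at this
      exact (Real.continuous_exp.tendsto _).comp this
    refine h2.congr' ?_
    filter_upwards [hpos] with s hs
    rw [Real.rpow_def_of_pos hs]
    congr 1
    ring
  have := (hslog.const_add (1 + 2 / d : ℝ)).mul hexp
  simpa [tiltedPow, sub_eq_add_neg] using this

section Bias

variable {d : ℕ} {ρ : Measure (EuclideanSpace ℝ (Fin d))} [IsProbabilityMeasure ρ]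
  {x : EuclideanSpace ℝ (Fin d)} {f m : EuclideanSpace ℝ (Fin d) → ℝ}

theorem tendsto_integral_rescaled (hd : 0 < d) {φ : ℝ → ℝ} (hφm : Measurable φ)
    (hφ0 : ∀ r, 0 ≤ φ r) {κ δ : ℝ} (hκ : 0 < κ)
    (hφ : Tendsto (fun r => φ r / r ^ d) (𝓝[>] 0) (𝓝 κ))
    (hδ : 0 < δ) (hlow : ∀ r, 0 < r → r < δ → κ / 2 * r ^ d ≤ φ r)
    (hup : ∀ r, 0 < r → r < δ → φ r ≤ 2 * κ * r ^ d) (hhalf : ∀ r, r < δ → φ r ≤ 1 / 2)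
    {Q b : EuclideanSpace ℝ (Fin d) → ℝ} {C : ℝ} (hC : 0 ≤ C)
    (hQm : AEStronglyMeasurable Q volume) (hQ0 : Q 0 = 0)
    (hb : Continuous b) (hbs : ∀ (c : ℝ) v, b (c • v) = c ^ 2 * b v)
    (hbC : ∀ v, |b v| ≤ C * ‖v‖ ^ 2) (hQb : (fun h => Q h - b h) =o[𝓝 0] fun h => ‖h‖ ^ 2)
    (hQC : ∀ h, ‖h‖ < δ → |Q h| ≤ (C + 1) * ‖h‖ ^ 2) :
    Tendsto (fun s : ℝ => s ^ (1 + 2 / d : ℝ) * ∫ h in Metric.ball (0 : EuclideanSpace ℝ (Fin d)) δ,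
      tiltedPow d s (1 - φ ‖h‖) * Q h) atTop (𝓝 0) := by
  have hd' : (0 : ℝ) < d := by exact_mod_cast hd
  -- `s ^ (-1/d)` is the typical distance of the nearest of `s` points. The Jacobian `R ^ d = 1 / s`
  -- turns the prefactor `s ^ (1 + 2/d)` into `R ^ (-2)`, exactly the scaling of the quadratic form
  -- `b`.
  set R : ℝ → ℝ := fun s => s ^ (-(1 / d : ℝ)) with hR
  have hR0 : ∀ s, 0 < s → 0 < R s := fun s hs => Real.rpow_pos_of_pos hs _
  have hRd : ∀ s, 0 < s → R s ^ d = s⁻¹ := by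
    intro s hs
    simp only [hR]
    rw [← Real.rpow_natCast, ← Real.rpow_mul hs.le, neg_mul, one_div, inv_mul_cancel₀ hd'.ne',
      Real.rpow_neg_one]
  have hR2 : ∀ s, 0 < s → s ^ (1 + 2 / d : ℝ) * s⁻¹ = (R s ^ 2)⁻¹ := by
    intro s hs
    simp only [hR]
    rw [← Real.rpow_natCast, ← Real.rpow_mul hs.le, ← Real.rpow_neg hs.le, ← Real.rpow_neg_one,
      ← Real.rpow_add hs]
    congr 1
    push_cast; ring
  have hRt : Tendsto R atTop (𝓝 0) := tendsto_rpow_neg_atTop (by positivity)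
  set G : ℝ → EuclideanSpace ℝ (Fin d) → ℝ := fun s =>
    (Metric.ball (0 : EuclideanSpace ℝ (Fin d)) δ).indicator
      fun h => tiltedPow d s (1 - φ ‖h‖) * Q h with hG
  have hGm : ∀ s, AEStronglyMeasurable (G s) volume := fun s =>
    (((measurable_tiltedPow d s).comp (by fun_prop)).aestronglyMeasurable.mul hQm).indicator
      measurableSet_ball
  have hchange : ∀ s, 0 < s → s ^ (1 + 2 / d : ℝ) * ∫ h, G s h =
      ∫ v, (R s ^ 2)⁻¹ * G s (R s • v) := by
    intro s hs
    have h := Measure.integral_comp_smul (volume : Measure (EuclideanSpace ℝ (Fin d))) (G s) (R s)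
    rw [finrank_euclideanSpace, Fintype.card_fin, hRd s hs, inv_inv, abs_of_pos hs,
      smul_eq_mul] at h
    rw [integral_const_mul, h, ← hR2 s hs]
    field_simp
  have hlim : Tendsto (fun s : ℝ => ∫ v, (R s ^ 2)⁻¹ * G s (R s • v)) atTop
      (𝓝 (∫ v, ((1 + 2 / d : ℝ) - κ * ‖v‖ ^ d) * Real.exp (-(κ * ‖v‖ ^ d)) * b v)) := by
    -- The rate `κ / 4` combines `φ r ≥ (κ / 2) r ^ d` with the halved exponent of
    -- `abs_tiltedPow_one_sub_le`.
    refine tendsto_integral_filter_of_dominated_convergence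
      (fun v => (C + 1) * (1 + 2 / d : ℝ) * (‖v‖ ^ 2 * Real.exp (-(κ / 4 * ‖v‖ ^ d))) +
        (C + 1) * (4 * κ) * (‖v‖ ^ (d + 2) * Real.exp (-(κ / 4 * ‖v‖ ^ d)))) ?_ ?_ ?_ ?_
    · filter_upwards [eventually_gt_atTop 0] with s hs
      have hqmp : Measure.QuasiMeasurePreserving (fun v : EuclideanSpace ℝ (Fin d) => R s • v)
          volume volume := by
        refine ⟨by fun_prop, ?_⟩
        rw [Measure.map_addHaar_smul volume (hR0 s hs).ne']
        exact Measure.smul_absolutelyContinuous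
      exact ((hGm s).comp_quasiMeasurePreserving hqmp).const_mul _
    · filter_upwards [eventually_ge_atTop 2] with s hs
      have hs0 : 0 < s := by linarith
      have hRs := hR0 s hs0
      refine ae_of_all _ fun v => ?_
      have hnn : 0 ≤ (C + 1) * (1 + 2 / d : ℝ) * (‖v‖ ^ 2 * Real.exp (-(κ / 4 * ‖v‖ ^ d))) +
        (C + 1) * (4 * κ) * (‖v‖ ^ (d + 2) * Real.exp (-(κ / 4 * ‖v‖ ^ d))) := by positivity
      by_cases hv : R s • v ∈ Metric.ball (0 : EuclideanSpace ℝ (Fin d)) δ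
      · rw [hG]
        simp only [Set.indicator_of_mem hv]
        have hv' : ‖R s • v‖ < δ := by simpa using hv
        have hnorm : ‖R s • v‖ = R s * ‖v‖ := by rw [norm_smul, Real.norm_eq_abs, abs_of_pos hRs]
        rcases eq_or_ne v 0 with rfl | hv0
        · simp only [smul_zero, hQ0, mul_zero, norm_zero]
          simp only [norm_zero] at hnn
          exact hnn
        have hr0 : 0 < ‖R s • v‖ := by
          rw [hnorm]; exact mul_pos hRs (norm_pos_iff.mpr hv0)
        have hlo := hlow _ hr0 hv'
        have hu := hup _ hr0 hv'
        have hsr : s * ‖R s • v‖ ^ d = ‖v‖ ^ d := by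
          rw [hnorm, mul_pow, hRd s hs0]; field_simp
        have h1 := abs_tiltedPow_one_sub_le (d := d) hs (hφ0 ‖R s • v‖) (hhalf _ hv')
        have h2 : s * φ ‖R s • v‖ ≤ 2 * κ * ‖v‖ ^ d := by
          rw [← hsr]; nlinarith
        have h3 : κ / 2 * ‖v‖ ^ d ≤ s * φ ‖R s • v‖ := by
          rw [← hsr]; nlinarith
        have h4 := hQC _ hv'
        rw [norm_mul, norm_mul, Real.norm_eq_abs, Real.norm_eq_abs, Real.norm_eq_abs,
          abs_of_pos (by positivity)]
        calc _ ≤ (R s ^ 2)⁻¹ * ((((1 + 2 / d : ℝ) + 2 * (2 * κ * ‖v‖ ^ d)) *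
              Real.exp (-(κ / 4 * ‖v‖ ^ d))) * ((C + 1) * ‖R s • v‖ ^ 2)) := by
              gcongr
              refine h1.trans ?_
              gcongr
              linarith
          _ = _ := by
              rw [hnorm]
              field_simp
              ring
      · rw [hG]
        simp only [Set.indicator_of_notMem hv, mul_zero, norm_zero]
        exact hnn
    · exact ((integrable_norm_pow_mul_exp hd 2 (by positivity)).const_mul _).add
        ((integrable_norm_pow_mul_exp hd (d + 2) (by positivity)).const_mul _)
    · refine ae_of_all _ fun v => ?_
      rcases eq_or_ne v 0 with rfl | hv0
      · have hb0 : b 0 = 0 := by simpa using hbs 0 0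
        have : ∀ s, (R s ^ 2)⁻¹ * G s (R s • (0 : EuclideanSpace ℝ (Fin d))) = 0 := by
          intro s
          simp [hG, hQ0]
        simp_rw [this, hb0, mul_zero]
        exact tendsto_const_nhds
      have hv0' : 0 < ‖v‖ := norm_pos_iff.mpr hv0
      have hRv : Tendsto (fun s => R s • v) atTop (𝓝 0) := by
        simpa using hRt.smul_const v
      have hnorm : ∀ s, 0 < s → ‖R s • v‖ = R s * ‖v‖ := fun s hs => by
        rw [norm_smul, Real.norm_eq_abs, abs_of_pos (hR0 s hs)]
      have hr : Tendsto (fun s => ‖R s • v‖) atTop (𝓝[>] 0) := by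
        rw [tendsto_nhdsWithin_iff]
        refine ⟨by simpa using hRv.norm, ?_⟩
        filter_upwards [eventually_gt_atTop 0] with s hs
        rw [hnorm s hs]
        exact mul_pos (hR0 s hs) hv0'
      have hsφ : Tendsto (fun s => s * φ ‖R s • v‖) atTop (𝓝 (κ * ‖v‖ ^ d)) := by
        refine ((hφ.comp hr).mul_const (‖v‖ ^ d)).congr' ?_
        filter_upwards [eventually_gt_atTop 0] with s hs
        simp only [Function.comp]
        rw [hnorm s hs, mul_pow, hRd s hs]
        field_simp
      have hφt : Tendsto (fun s => φ ‖R s • v‖) atTop (𝓝 0) := by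
        have := hsφ.mul tendsto_inv_atTop_zero
        rw [mul_zero] at this
        refine this.congr' ?_
        filter_upwards [eventually_gt_atTop 0] with s hs
        field_simp
      have h1 := tendsto_tiltedPow (d := d) hφt hsφ
      have h2 : Tendsto (fun s => (R s ^ 2)⁻¹ * Q (R s • v)) atTop (𝓝 (b v)) := by
        have h3 := (hQb.comp_tendsto hRv).tendsto_div_nhds_zero
        have h4 := (h3.mul_const (‖v‖ ^ 2)).add_const (b v)
        rw [zero_mul, zero_add] at h4
        refine h4.congr' ?_
        filter_upwards [eventually_gt_atTop 0] with s hs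
        simp only [Function.comp]
        rw [hnorm s hs, hbs]
        have := hR0 s hs
        field_simp
        ring
      refine (h1.mul h2).congr' ?_
      filter_upwards [hRv.eventually (Metric.ball_mem_nhds 0 hδ)] with s hs
      have hs' : R s • v ∈ Metric.ball (0 : EuclideanSpace ℝ (Fin d)) δ := hs
      rw [hG]
      simp only [Set.indicator_of_mem hs']
      ring
  rw [integral_gaussian_type_eq_zero hd hb hbs hbC hκ] at hlim
  refine hlim.congr' ?_
  filter_upwards [eventually_gt_atTop 0] with s hs
  rw [← hchange s hs, hG, integral_indicator measurableSet_ball]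

theorem tendsto_tiltedPow_far {β : ℝ} (hβ0 : 0 < β) (hβ1 : β < 1) :
    Tendsto (fun s : ℝ => s ^ (1 + 2 / d : ℝ) * (((1 + 2 / d : ℝ) + s) * β ^ (s - 2))) atTop
      (𝓝 0) := by
  have hl : 0 < -Real.log β := by
    have := Real.log_neg hβ0 hβ1
    linarith
  have h1 := tendsto_rpow_mul_exp_neg_mul_atTop_nhds_zero (1 + 2 / d : ℝ) _ hl
  have h2 := tendsto_rpow_mul_exp_neg_mul_atTop_nhds_zero (1 + 2 / d + 1 : ℝ) _ hl
  have h := ((h1.const_mul (1 + 2 / d : ℝ)).add h2).mul_const (β ^ (-2 : ℝ))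
  rw [mul_zero, add_zero, zero_mul] at h
  refine h.congr' ?_
  filter_upwards [eventually_gt_atTop 0] with s hs
  have e : β ^ (s - 2) = Real.exp (- -Real.log β * s) * β ^ (-2 : ℝ) := by
    rw [sub_eq_add_neg, Real.rpow_add hβ0, neg_neg, Real.rpow_def_of_pos hβ0 s]
  rw [e, Real.rpow_add hs (1 + 2 / d : ℝ) 1, Real.rpow_one]
  ring

/-- Outside a small ball the integrand is geometrically small. Inside, the tilt depends only on `‖z
- x‖`, so the density times `m` may be replaced by half of its symmetrization, whose leading term is
quadratic, and `tendsto_integral_rescaled` applies. -/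
theorem tendsto_rpow_mul_integral_tiltedPow (hd : 0 < d) (hf : Measurable f)
    (hf0 : ∀ z, 0 ≤ f z) (hρ : ρ = volume.withDensity fun z => ENNReal.ofReal (f z))
    (hfc : ContinuousAt f x) (hfx : 0 < f x) (hm : Integrable m ρ) (hmx : m x = 0)
    (hq : ContDiffAt ℝ 2 (fun h => f (x + h) * m (x + h)) 0) :
    Tendsto (fun s : ℝ => s ^ (1 + 2 / d : ℝ) *
      ∫ z, tiltedPow d s (1 - ballMass ρ x ‖z - x‖) * m z ∂ρ) atTop (𝓝 0) := by
  set q : EuclideanSpace ℝ (Fin d) → ℝ := fun h => f (x + h) * m (x + h) with hqdef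
  have hq0 : q 0 = 0 := by simp [hqdef, hmx]
  obtain ⟨b, C, hC, hb, hbs, hbC, hQb⟩ := exists_isLittleO_second_difference hq hq0
  set φ := ballMass ρ x with hφdef
  have hφ0 : ∀ r, 0 ≤ φ r := fun r => measureReal_nonneg
  have hφ1 : ∀ r, φ r ≤ 1 := ballMass_le_one ρ x
  have hφm : Measurable φ := (ballMass_mono ρ x).measurable
  set κ := f x * volume.real (Metric.closedBall (0 : EuclideanSpace ℝ (Fin d)) 1) with hκdef
  have hκ : 0 < κ := by
    refine mul_pos hfx ?_
    rw [Measure.real, ENNReal.toReal_pos_iff]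
    exact ⟨Metric.measure_closedBall_pos _ _ one_pos, measure_closedBall_lt_top⟩
  have hφ := tendsto_ballMass_div_pow hf hf0 hρ hfc
  have hφz : Tendsto φ (𝓝[>] 0) (𝓝 0) := by
    have h1 : Tendsto (fun r : ℝ => r ^ d) (𝓝[>] 0) (𝓝 0) := by
      have := ((continuous_pow d).tendsto (0 : ℝ)).mono_left (nhdsWithin_le_nhds (s := Set.Ioi 0))
      rwa [zero_pow hd.ne'] at this
    have := hφ.mul h1
    rw [mul_zero] at this
    refine this.congr' ?_
    filter_upwards [self_mem_nhdsWithin] with r hr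
    have : r ^ d ≠ 0 := (pow_pos hr d).ne'
    field_simp
    rfl
  have hev : ∀ᶠ r in 𝓝[>] (0 : ℝ), κ / 2 * r ^ d ≤ φ r ∧ φ r ≤ 2 * κ * r ^ d ∧ φ r ≤ 1 / 2 := by
    filter_upwards [hφ.eventually (le_mem_nhds (show κ / 2 < κ by linarith)),
      hφ.eventually (ge_mem_nhds (show κ < 2 * κ by linarith)),
      hφz.eventually (ge_mem_nhds (show (0 : ℝ) < 1 / 2 by norm_num)), self_mem_nhdsWithin]
      with r h1 h2 h3 hr
    have hr' : 0 < r ^ d := pow_pos hr d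
    rw [le_div_iff₀ hr'] at h1
    rw [div_le_iff₀ hr'] at h2
    exact ⟨h1, h2, h3⟩
  obtain ⟨δ₁, hδ₁, hball⟩ := (mem_nhdsGT_iff_exists_Ioo_subset).mp hev
  have hQev := hQb.def one_pos
  obtain ⟨δ₂, hδ₂, hball₂⟩ := Metric.eventually_nhds_iff.mp hQev
  set δ := min δ₁ δ₂ with hδdef
  have hδ : 0 < δ := lt_min hδ₁ hδ₂
  have hlow : ∀ r, 0 < r → r < δ → κ / 2 * r ^ d ≤ φ r := fun r h0 h1 =>
    (hball ⟨h0, h1.trans_le (min_le_left _ _)⟩).1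
  have hup : ∀ r, 0 < r → r < δ → φ r ≤ 2 * κ * r ^ d := fun r h0 h1 =>
    (hball ⟨h0, h1.trans_le (min_le_left _ _)⟩).2.1
  -- Stated for all `r < δ`, including `r ≤ 0`, where the estimates on `𝓝[>] 0` say nothing;
  -- monotonicity reduces it to a radius of at least `δ / 2`.
  have hhalf : ∀ r, r < δ → φ r ≤ 1 / 2 := fun r h1 => by
    refine (ballMass_mono ρ x (le_max_left r (δ / 2))).trans ?_
    have h2 : max r (δ / 2) < δ := max_lt h1 (by linarith)
    exact (hball ⟨lt_max_of_lt_right (by linarith), h2.trans_le (min_le_left _ _)⟩).2.2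
  set Q : EuclideanSpace ℝ (Fin d) → ℝ := fun h => q h + q (-h) with hQdef
  have hQC : ∀ h, ‖h‖ < δ → |Q h| ≤ (C + 1) * ‖h‖ ^ 2 := by
    intro h hh
    have h1 := hball₂ (y := h) (by simpa using hh.trans_le (min_le_right _ _))
    rw [one_mul, norm_pow, norm_norm, Real.norm_eq_abs] at h1
    have h2 := abs_sub_abs_le_abs_sub (Q h) (b h)
    have h3 := hbC h
    simp only [hQdef] at h2 ⊢
    linarith
  have hfm : Integrable (fun z => f z * m z) := by
    rw [hρ, integrable_withDensity_iff_integrable_smul' (by fun_prop) (by simp)] at hm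
    refine hm.congr (ae_of_all _ fun z => ?_)
    simp [ENNReal.toReal_ofReal (hf0 z)]
  have hqint : Integrable q := hfm.comp_add_left x
  have hqneg : Integrable fun h => q (-h) := hqint.comp_neg
  have hQm : AEStronglyMeasurable Q volume := (hqint.add hqneg).1
  have hnear := tendsto_integral_rescaled hd hφm hφ0 hκ hφ hδ hlow hup hhalf hC
    hQm (by simp [hQdef, hq0]) hb hbs hbC hQb hQC
  set β := 1 - φ (δ / 2) with hβ
  have hβ1 : β < 1 := by
    have h1 := hlow (δ / 2) (by positivity) (by linarith)
    have h2 : 0 < κ / 2 * (δ / 2) ^ d := by positivity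
    linarith
  have hβ0 : 0 < β := by
    have := hhalf (δ / 2) (by linarith)
    linarith
  set B : Set (EuclideanSpace ℝ (Fin d)) := Metric.ball x δ with hB
  have hΨm : ∀ s, Measurable fun z => tiltedPow d s (1 - φ ‖z - x‖) := fun s =>
    (measurable_tiltedPow d s).comp ((measurable_ballMass_norm ρ x).const_sub 1)
  have hΨint : ∀ s, 2 < s → Integrable (fun z => tiltedPow d s (1 - φ ‖z - x‖) * m z) ρ := by
    intro s hs
    refine (hm.norm.const_mul ((1 + 2 / d : ℝ) + s)).mono'
      ((hΨm s).aestronglyMeasurable.mul hm.1) (ae_of_all _ fun z => ?_)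
    rw [norm_mul]
    refine mul_le_mul_of_nonneg_right ?_ (norm_nonneg _)
    have := abs_tiltedPow_le (d := d) hs (sub_nonneg.mpr (hφ1 ‖z - x‖))
      (sub_le_self 1 (hφ0 ‖z - x‖)) le_rfl
    simpa using this
  have hfar : Tendsto (fun s : ℝ => s ^ (1 + 2 / d : ℝ) *
      ∫ z in Bᶜ, tiltedPow d s (1 - φ ‖z - x‖) * m z ∂ρ) atTop (𝓝 0) := by
    have h := (tendsto_tiltedPow_far (d := d) hβ0 hβ1).mul_const (∫ z, ‖m z‖ ∂ρ)
    rw [zero_mul] at h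
    refine squeeze_zero_norm' ?_ h
    filter_upwards [eventually_gt_atTop 2] with s hs
    have hs0 : 0 < s := by linarith
    have hpw : 0 < s ^ (1 + 2 / d : ℝ) := Real.rpow_pos_of_pos hs0 _
    rw [norm_mul, Real.norm_eq_abs, abs_of_pos hpw, mul_assoc]
    refine mul_le_mul_of_nonneg_left ?_ hpw.le
    have hc : 0 ≤ ((1 + 2 / d : ℝ) + s) * β ^ (s - 2) := by positivity
    calc _ ≤ ∫ z in Bᶜ, ((1 + 2 / d : ℝ) + s) * β ^ (s - 2) * ‖m z‖ ∂ρ := by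
          refine norm_integral_le_of_norm_le (hm.norm.const_mul _).integrableOn ?_
          filter_upwards [ae_restrict_mem measurableSet_ball.compl] with z hz
          rw [norm_mul]
          refine mul_le_mul_of_nonneg_right ?_ (norm_nonneg _)
          have hz' : δ ≤ ‖z - x‖ := by simpa [hB, dist_eq_norm] using hz
          refine abs_tiltedPow_le hs (sub_nonneg.mpr (hφ1 _)) ?_ hβ1.le
          exact sub_le_sub_left (ballMass_mono ρ x (by linarith)) 1
      _ ≤ ∫ z, ((1 + 2 / d : ℝ) + s) * β ^ (s - 2) * ‖m z‖ ∂ρ :=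
          setIntegral_le_integral (hm.norm.const_mul _)
            (ae_of_all _ fun z => mul_nonneg hc (norm_nonneg _))
      _ = _ := integral_const_mul _ _
  have hnear2 : ∀ s, 2 < s → ∫ z in B, tiltedPow d s (1 - φ ‖z - x‖) * m z ∂ρ =
      1 / 2 * ∫ h in Metric.ball (0 : EuclideanSpace ℝ (Fin d)) δ,
        tiltedPow d s (1 - φ ‖h‖) * Q h := by
    intro s hs
    set G : EuclideanSpace ℝ (Fin d) → ℝ :=
      (Metric.ball (0 : EuclideanSpace ℝ (Fin d)) δ).indicator
        fun h => tiltedPow d s (1 - φ ‖h‖) * q h with hG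
    have hball0 : ∀ h : EuclideanSpace ℝ (Fin d), x + h ∈ B ↔ h ∈ Metric.ball 0 δ := by
      intro h; simp [hB, dist_eq_norm]
    have e1 : ∫ z in B, tiltedPow d s (1 - φ ‖z - x‖) * m z ∂ρ = ∫ h, G h := by
      rw [← integral_indicator measurableSet_ball]
      conv_lhs => rw [hρ]
      rw [integral_withDensity_eq_integral_toReal_smul (by fun_prop) (by simp),
        ← integral_add_left_eq_self _ x]
      refine integral_congr_ae (ae_of_all _ fun h => ?_)
      simp only [hG]
      by_cases hh : h ∈ Metric.ball (0 : EuclideanSpace ℝ (Fin d)) δ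
      · rw [Set.indicator_of_mem hh, Set.indicator_of_mem ((hball0 h).mpr hh),
          ENNReal.toReal_ofReal (hf0 _), smul_eq_mul, add_sub_cancel_left]
        simp only [hqdef]
        ring
      · rw [Set.indicator_of_notMem hh, Set.indicator_of_notMem (fun h' => hh ((hball0 h).mp h')),
          smul_zero]
    have hGint : Integrable G := by
      refine Integrable.indicator ?_ measurableSet_ball
      refine (hqint.norm.const_mul ((1 + 2 / d : ℝ) + s)).mono'
        (((measurable_tiltedPow d s).comp (by fun_prop)).aestronglyMeasurable.mul hqint.1)
        (ae_of_all _ fun h => ?_)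
      rw [norm_mul]
      refine mul_le_mul_of_nonneg_right ?_ (norm_nonneg _)
      have := abs_tiltedPow_le (d := d) hs (sub_nonneg.mpr (hφ1 ‖h‖))
        (sub_le_self 1 (hφ0 ‖h‖)) le_rfl
      simpa using this
    have e2 : ∫ h in Metric.ball (0 : EuclideanSpace ℝ (Fin d)) δ,
        tiltedPow d s (1 - φ ‖h‖) * Q h = (∫ h, G h) + ∫ h, G (-h) := by
      rw [← integral_add hGint hGint.comp_neg, ← integral_indicator measurableSet_ball]
      refine integral_congr_ae (ae_of_all _ fun h => ?_)
      by_cases hh : h ∈ Metric.ball (0 : EuclideanSpace ℝ (Fin d)) δ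
      · have hh' : -h ∈ Metric.ball (0 : EuclideanSpace ℝ (Fin d)) δ := by simpa using hh
        simp only [hG, Set.indicator_of_mem hh, Set.indicator_of_mem hh', norm_neg, hQdef]
        ring
      · have hh' : -h ∉ Metric.ball (0 : EuclideanSpace ℝ (Fin d)) δ := by simpa using hh
        simp only [hG, Set.indicator_of_notMem hh, Set.indicator_of_notMem hh', add_zero]
    rw [e1, e2, integral_neg_eq_self G volume]
    ring
  have := (hnear.const_mul (1 / 2)).add hfar
  rw [mul_zero, add_zero] at this
  refine this.congr' ?_
  filter_upwards [eventually_gt_atTop 2] with s hs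
  rw [← integral_add_compl measurableSet_ball (hΨint s hs), hnear2 s hs]
  ring

end Bias

/-! ### The two-scale bias as a mean value over real scales -/

section Bias

variable {d : ℕ} {ρ : Measure (EuclideanSpace ℝ (Fin d))} [IsProbabilityMeasure ρ]
  {x : EuclideanSpace ℝ (Fin d)} {f m : EuclideanSpace ℝ (Fin d) → ℝ}

theorem hasDerivAt_rpow_sub_one {a s : ℝ} (ha : 0 ≤ a) (hs : 1 < s) :
    HasDerivAt (fun s : ℝ => a ^ (s - 1)) (Real.log a * a ^ (s - 1)) s := by
  rcases ha.eq_or_lt with rfl | ha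
  · rw [Real.log_zero, zero_mul]
    refine (hasDerivAt_const s (0 : ℝ)).congr_of_eventuallyEq ?_
    filter_upwards [Ioi_mem_nhds hs] with r hr
    have hr' : (1 : ℝ) < r := hr
    exact Real.zero_rpow (by linarith)
  · have h := ((hasDerivAt_id s).sub_const 1).const_rpow ha
    simpa using h

/-- Differentiation under the integral sign: for `r > 2` the factor `|log a| a ^ (r - 1)` is at most
`|log a| a ≤ 1`, so `‖m‖` is a majorant. -/
theorem hasDerivAt_rpow_mul_integral (hm : Integrable m ρ) {s : ℝ} (hs : 2 < s) :
    HasDerivAt (fun s : ℝ => s ^ (1 + 2 / d : ℝ) *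
        ∫ z, (1 - ballMass ρ x ‖z - x‖) ^ (s - 1) * m z ∂ρ)
      (s ^ (2 / d : ℝ) * ∫ z, tiltedPow d s (1 - ballMass ρ x ‖z - x‖) * m z ∂ρ) s := by
  have hs0 : 0 < s := by linarith
  have ha0 : ∀ z, 0 ≤ 1 - ballMass ρ x ‖z - x‖ := fun z => sub_nonneg.mpr (ballMass_le_one ρ x _)
  have ha1 : ∀ z, 1 - ballMass ρ x ‖z - x‖ ≤ 1 := fun z => sub_le_self 1 measureReal_nonneg
  have ham : Measurable fun z => 1 - ballMass ρ x ‖z - x‖ :=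
    (measurable_ballMass_norm ρ x).const_sub 1
  have hpow : ∀ s : ℝ, 1 < s → Integrable
      (fun z => (1 - ballMass ρ x ‖z - x‖) ^ (s - 1) * m z) ρ := by
    intro s hs
    refine hm.norm.mono' ((ham.pow_const _).aestronglyMeasurable.mul hm.1)
      (ae_of_all _ fun z => ?_)
    rw [norm_mul, Real.norm_eq_abs, abs_of_nonneg (Real.rpow_nonneg (ha0 z) _)]
    exact mul_le_of_le_one_left (norm_nonneg _) (Real.rpow_le_one (ha0 z) (ha1 z) (by linarith))
  obtain ⟨hlogint, hder⟩ := hasDerivAt_integral_of_dominated_loc_of_deriv_le (μ := ρ) (x₀ := s)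
    (s := Set.Ioi 2)
    (F := fun s z => (1 - ballMass ρ x ‖z - x‖) ^ (s - 1) * m z)
    (F' := fun s z => Real.log (1 - ballMass ρ x ‖z - x‖) *
      (1 - ballMass ρ x ‖z - x‖) ^ (s - 1) * m z)
    (bound := fun z => ‖m z‖) (Ioi_mem_nhds hs)
    (Eventually.of_forall fun r => (ham.pow_const _).aestronglyMeasurable.mul hm.1)
    (hpow s (by linarith))
    ((ham.log.mul (ham.pow_const _)).aestronglyMeasurable.mul hm.1)
    (ae_of_all _ fun z r hr => by
      have hr' : (2 : ℝ) < r := hr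
      rw [norm_mul]
      refine mul_le_of_le_one_left (norm_nonneg _) ?_
      rw [norm_mul, Real.norm_eq_abs, Real.norm_eq_abs,
        abs_of_nonneg (Real.rpow_nonneg (ha0 z) _)]
      refine le_trans ?_ (abs_log_mul_self_le_one (ha0 z) (ha1 z))
      refine mul_le_mul_of_nonneg_left ?_ (abs_nonneg _)
      exact Real.rpow_le_self_of_le_one (ha0 z) (ha1 z) (by linarith))
    hm.norm
    (ae_of_all _ fun z r hr => by
      have hr' : (2 : ℝ) < r := hr
      exact (hasDerivAt_rpow_sub_one (ha0 z) (by linarith)).mul_const (m z))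
  have h1 := Real.hasDerivAt_rpow_const (x := s) (p := (1 + 2 / d : ℝ)) (Or.inl hs0.ne')
  refine (h1.mul hder).congr_deriv ?_
  have e1 : ∫ z, tiltedPow d s (1 - ballMass ρ x ‖z - x‖) * m z ∂ρ =
      (1 + 2 / d : ℝ) * ∫ z, (1 - ballMass ρ x ‖z - x‖) ^ (s - 1) * m z ∂ρ +
      s * ∫ z, Real.log (1 - ballMass ρ x ‖z - x‖) *
        (1 - ballMass ρ x ‖z - x‖) ^ (s - 1) * m z ∂ρ := by
    rw [← integral_const_mul, ← integral_const_mul,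
      ← integral_add ((hpow s (by linarith)).const_mul _) (hlogint.const_mul _)]
    refine integral_congr_ae (ae_of_all _ fun z => ?_)
    simp only [tiltedPow]
    ring
  rw [e1, show (1 + 2 / d : ℝ) - 1 = 2 / d by ring, Real.rpow_add hs0, Real.rpow_one]
  ring

theorem two_scale_difference (hd : 0 < d) {s t : ℕ} (hs : 1 ≤ s) (hst : s < t) (u v : ℝ) :
    ((1 + extrapolation d s t) * (t * v) - extrapolation d s t * (s * u)) *
        ((t : ℝ) ^ (2 / d : ℝ) - (s : ℝ) ^ (2 / d : ℝ)) =
      (t : ℝ) ^ (1 + 2 / d : ℝ) * v - (s : ℝ) ^ (1 + 2 / d : ℝ) * u := by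
  have hs0 : (0 : ℝ) < s := by exact_mod_cast hs
  have ht0 : (0 : ℝ) < t := by exact_mod_cast (by omega : 0 < t)
  have h1 := sub_pos.mpr (scaleRate_lt hd hs hst)
  have ps := scaleRate_pos (d := d) hs
  have pt := scaleRate_pos (d := d) (s := t) (by omega)
  have es : (s : ℝ) ^ (2 / d : ℝ) = (scaleRate d s)⁻¹ := by
    rw [scaleRate, neg_div, Real.rpow_neg hs0.le, inv_inv]
  have et : (t : ℝ) ^ (2 / d : ℝ) = (scaleRate d t)⁻¹ := by
    rw [scaleRate, neg_div, Real.rpow_neg ht0.le, inv_inv]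
  rw [Real.rpow_add hs0, Real.rpow_add ht0, Real.rpow_one, Real.rpow_one, es, et, extrapolation]
  field_simp
  ring

/-- By `two_scale_difference` the two-scale bias is a quotient of increments of `H(s) = s ^ (1 +
2/d) ∫ ...` and of `s ^ (2/d)`. Cauchy's mean value theorem replaces it by a quotient of
derivatives, so the bound is insensitive to the gap between the scales. -/
theorem exists_abs_two_scale_bias_le (hd : 0 < d) (hf : Measurable f)
    (hf0 : ∀ z, 0 ≤ f z) (hρ : ρ = volume.withDensity fun z => ENNReal.ofReal (f z))
    (hfc : ContinuousAt f x) (hfx : 0 < f x) (hm : Integrable m ρ) (hmx : m x = 0)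
    (hq : ContDiffAt ℝ 2 (fun h => f (x + h) * m (x + h)) 0) {ε : ℝ} (hε : 0 < ε) :
    ∃ N : ℕ, 1 ≤ N ∧ ∀ s t : ℕ, N ≤ s → s < t →
      |(1 + extrapolation d s t) *
          (t * ∫ z, m z * (1 - ballMass ρ x ‖z - x‖) ^ (t - 1) ∂ρ) -
        extrapolation d s t * (s * ∫ z, m z * (1 - ballMass ρ x ‖z - x‖) ^ (s - 1) ∂ρ)| ≤
      ε * scaleRate d s := by
  have hd' : (0 : ℝ) < d := by exact_mod_cast hd
  have hlim := tendsto_rpow_mul_integral_tiltedPow hd hf hf0 hρ hfc hfx hm hmx hq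
  -- Compensates the factor `d / 2` coming from the derivative of `s ^ (2/d)`.
  have hε' : 0 < 2 / d * ε := by positivity
  obtain ⟨M, hM⟩ := eventually_atTop.mp
    ((tendsto_zero_iff_abs_tendsto_zero _).mp hlim |>.eventually (ge_mem_nhds hε'))
  refine ⟨max 3 ⌈M⌉₊, by simp, fun s t hs hst => ?_⟩
  have hs3 : 3 ≤ s := (le_max_left _ _).trans hs
  have hsM : M ≤ s := (Nat.le_ceil M).trans (by exact_mod_cast (le_max_right _ _).trans hs)
  have hs3' : (3 : ℝ) ≤ s := by exact_mod_cast hs3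
  have hst' : (s : ℝ) < t := by exact_mod_cast hst
  have hcast : ∀ r : ℕ, 1 ≤ r → ∫ z, m z * (1 - ballMass ρ x ‖z - x‖) ^ (r - 1) ∂ρ =
      ∫ z, (1 - ballMass ρ x ‖z - x‖) ^ ((r : ℝ) - 1) * m z ∂ρ := by
    intro r hr
    refine integral_congr_ae (ae_of_all _ fun z => ?_)
    simp only
    rw [← Real.rpow_natCast, Nat.cast_sub hr, Nat.cast_one, mul_comm]
  have hH := fun r : ℝ => hasDerivAt_rpow_mul_integral (d := d) (x := x) hm (s := r)
  obtain ⟨ξ, ⟨hξ1, hξ2⟩, hξ⟩ := exists_ratio_hasDerivAt_eq_ratio_slope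
    (fun s : ℝ => s ^ (1 + 2 / d : ℝ) * ∫ z, (1 - ballMass ρ x ‖z - x‖) ^ (s - 1) * m z ∂ρ)
    (fun s => s ^ (2 / d : ℝ) * ∫ z, tiltedPow d s (1 - ballMass ρ x ‖z - x‖) * m z ∂ρ) hst'
    (fun r hr => (hH r (by linarith [hr.1])).continuousAt.continuousWithinAt)
    (fun r hr => hH r (by linarith [hr.1]))
    (fun s : ℝ => s ^ (2 / d : ℝ)) (fun s => (2 / d : ℝ) * s ^ (2 / d - 1 : ℝ))
    (fun r hr => (Real.continuousAt_rpow_const r _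
      (Or.inl (by linarith [hr.1] : (0 : ℝ) < r).ne')).continuousWithinAt)
    (fun r hr => Real.hasDerivAt_rpow_const (Or.inl (by linarith [hr.1] : (0 : ℝ) < r).ne'))
  have hξ0 : 0 < ξ := by linarith
  rw [← hcast s (by omega), ← hcast t (by omega), ← two_scale_difference hd (by omega) hst] at hξ
  set D := (1 + extrapolation d s t) *
          (t * ∫ z, m z * (1 - ballMass ρ x ‖z - x‖) ^ (t - 1) ∂ρ) -
        extrapolation d s t * (s * ∫ z, m z * (1 - ballMass ρ x ‖z - x‖) ^ (s - 1) ∂ρ)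
  set I := ∫ z, tiltedPow d ξ (1 - ballMass ρ x ‖z - x‖) * m z ∂ρ with hI
  have hg : (0 : ℝ) < (t : ℝ) ^ (2 / d : ℝ) - (s : ℝ) ^ (2 / d : ℝ) :=
    sub_pos.mpr (Real.rpow_lt_rpow (by linarith) hst' (by positivity))
  have hD : ξ ^ (2 / d : ℝ) * I = D * (2 / d * ξ ^ (2 / d - 1 : ℝ)) := by
    apply mul_left_cancel₀ hg.ne'
    linear_combination hξ
  have hrate : ξ ^ (-(2 / d) : ℝ) ≤ scaleRate d s := by
    unfold scaleRate
    rw [neg_div]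
    exact Real.rpow_le_rpow_of_nonpos (by linarith) hξ1.le (by
      have : (0 : ℝ) < 2 / d := by positivity
      linarith)
  have hbd := hM ξ (by linarith)
  rw [Function.comp_apply, ← hI] at hbd
  have hD2 : D = d / 2 * ξ ^ (-(2 / d) : ℝ) * (ξ ^ (1 + 2 / d : ℝ) * I) := by
    have e1 : ξ ^ (2 / d - 1 : ℝ) = ξ ^ (2 / d : ℝ) / ξ := by
      rw [Real.rpow_sub hξ0, Real.rpow_one]
    have hp : 0 < ξ ^ (2 / d : ℝ) := Real.rpow_pos_of_pos hξ0 _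
    rw [e1] at hD
    rw [Real.rpow_neg hξ0.le, Real.rpow_add hξ0, Real.rpow_one]
    field_simp at hD ⊢
    linarith
  have hr0 : 0 ≤ ξ ^ (-(2 / d) : ℝ) := (Real.rpow_pos_of_pos hξ0 _).le
  rw [hD2, abs_mul, abs_of_nonneg (by positivity)]
  calc _ ≤ d / 2 * ξ ^ (-(2 / d) : ℝ) * (2 / d * ε) := by gcongr
    _ = ε * ξ ^ (-(2 / d) : ℝ) := by field_simp
    _ ≤ _ := by gcongr

end Bias

/-! ### Characteristic functions of weighted sums -/

section CharFun

theorem norm_prod_sub_prod_le {ι : Type*} (s : Finset ι) {z w : ι → ℂ}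
    (hz : ∀ i ∈ s, ‖z i‖ ≤ 1) (hw : ∀ i ∈ s, ‖w i‖ ≤ 1) :
    ‖∏ i ∈ s, z i - ∏ i ∈ s, w i‖ ≤ ∑ i ∈ s, ‖z i - w i‖ := by
  classical
  induction s using Finset.induction_on with
  | empty => simp
  | insert a s ha ih =>
    rw [Finset.prod_insert ha, Finset.prod_insert ha, Finset.sum_insert ha]
    have h1 : ‖∏ i ∈ s, z i‖ ≤ 1 := by
      rw [norm_prod]
      exact Finset.prod_le_one (fun _ _ => norm_nonneg _)
        fun i hi => hz i (Finset.mem_insert_of_mem hi)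
    have h2 := ih (fun i hi => hz i (Finset.mem_insert_of_mem hi))
      (fun i hi => hw i (Finset.mem_insert_of_mem hi))
    have h3 := hw a (Finset.mem_insert_self a s)
    calc ‖z a * ∏ i ∈ s, z i - w a * ∏ i ∈ s, w i‖
        = ‖(z a - w a) * ∏ i ∈ s, z i + w a * (∏ i ∈ s, z i - ∏ i ∈ s, w i)‖ := by ring_nf
      _ ≤ ‖z a - w a‖ * ‖∏ i ∈ s, z i‖ + ‖w a‖ * ‖∏ i ∈ s, z i - ∏ i ∈ s, w i‖ := by
          rw [← norm_mul, ← norm_mul]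
          exact norm_add_le _ _
      _ ≤ ‖z a - w a‖ * 1 + 1 * ∑ i ∈ s, ‖z i - w i‖ := by gcongr
      _ = _ := by ring

variable {η : Measure ℝ} [IsProbabilityMeasure η]

theorem exists_norm_charFun_sub_exp_le (h2 : MemLp id 2 η) (h0 : ∫ e, e ∂η = 0) {ε : ℝ}
    (hε : 0 < ε) :
    ∃ δ : ℝ, 0 < δ ∧ ∀ u : ℝ, |u| ≤ δ →
      ‖charFun η u - Complex.exp (-((∫ e, e ^ 2 ∂η : ℝ) * u ^ 2 / 2 : ℝ))‖ ≤ ε * u ^ 2 := by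
  set v : ℝ := ∫ e, e ^ 2 ∂η with hv
  have hv0 : 0 ≤ v := integral_nonneg fun e => sq_nonneg e
  have hT : (fun u : ℝ => charFun η u - (1 - (v * u ^ 2 / 2 : ℝ))) =o[𝓝 0]
      fun u : ℝ => u ^ 2 := by
    have h := taylor_isLittleO_univ (x₀ := (0 : ℝ)) (contDiff_charFun (n := 2) h2)
    have e : ∀ t : ℝ, taylorWithinEval (charFun η) 2 Set.univ 0 t =
        1 - (v * t ^ 2 / 2 : ℝ) := by
      intro t
      have h' := taylorWithinEval_charFun_two_zero (P := η) (X := id) aemeasurable_id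
        (by rwa [Measure.map_id]) t
      rw [Measure.map_id] at h'
      rw [h']
      simp [h0, hv]
    simp_rw [e, sub_zero] at h
    exact h
  obtain ⟨δ, hδ, hδT⟩ := Metric.eventually_nhds_iff.mp (hT.def (half_pos hε))
  -- The three bounds serve the Taylor remainder, the estimate `y ^ 2 ≤ (ε / 2) u ^ 2` for `y = v u
  -- ^ 2 / 2`, and `y ≤ 1`.
  refine ⟨min (δ / 2) (min (ε / (2 * (v ^ 2 + 1))) (1 / (v + 1))), by positivity,
    fun u hu => ?_⟩
  have hu1 : |u| ≤ δ / 2 := hu.trans (min_le_left _ _)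
  have hu2 : |u| ≤ ε / (2 * (v ^ 2 + 1)) :=
    hu.trans ((min_le_right _ _).trans (min_le_left _ _))
  have hu3 : |u| ≤ 1 / (v + 1) := hu.trans ((min_le_right _ _).trans (min_le_right _ _))
  have hu3' : |u| ≤ 1 := hu3.trans (by rw [div_le_one (by positivity)]; linarith)
  rw [le_div_iff₀ (by positivity)] at hu2 hu3
  have hb := hδT (y := u) (by simpa using hu1.trans_lt (by linarith))
  set y : ℝ := v * u ^ 2 / 2 with hy
  have hy0 : 0 ≤ y := by positivity
  have hsq : u ^ 2 = |u| * |u| := by rw [← sq, sq_abs]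
  have hau := abs_nonneg u
  have hy1 : y ≤ 1 := by
    rw [hy, hsq]
    nlinarith [mul_nonneg hau hau, mul_nonneg hv0 hau]
  have hyn : ‖(-(y : ℂ))‖ = y := by rw [norm_neg, Complex.norm_real, Real.norm_of_nonneg hy0]
  have hE := Complex.norm_exp_sub_one_sub_id_le (x := -(y : ℂ)) (by rw [hyn]; exact hy1)
  rw [hyn] at hE
  have hyy : y ^ 2 ≤ ε / 2 * u ^ 2 := by
    have e1 : y ^ 2 = v ^ 2 / 4 * u ^ 2 * u ^ 2 := by rw [hy]; ring
    have e2 : u ^ 2 ≤ |u| := by rw [hsq]; nlinarith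
    have e3 : v ^ 2 / 4 * u ^ 2 ≤ ε / 2 := by nlinarith [sq_nonneg v]
    rw [e1]
    exact mul_le_mul_of_nonneg_right e3 (sq_nonneg u)
  calc ‖charFun η u - Complex.exp (-(y : ℂ))‖
      = ‖(charFun η u - (1 - (y : ℂ))) - (Complex.exp (-(y : ℂ)) - 1 - -(y : ℂ))‖ := by ring_nf
    _ ≤ ‖charFun η u - (1 - (y : ℂ))‖ + ‖Complex.exp (-(y : ℂ)) - 1 - -(y : ℂ)‖ :=
        norm_sub_le _ _
    _ ≤ ε / 2 * u ^ 2 + ε / 2 * u ^ 2 := by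
        refine add_le_add ?_ (hE.trans hyy)
        simpa using hb
    _ = _ := by ring

/-- A Lindeberg-type estimate for weighted i.i.d. variables. Since `δ` depends neither on `n` nor on
the weights, it serves triangular arrays. -/
theorem exists_norm_prod_charFun_sub_exp_le (h2 : MemLp id 2 η) (h0 : ∫ e, e ∂η = 0) {ε : ℝ}
    (hε : 0 < ε) :
    ∃ δ : ℝ, 0 < δ ∧ ∀ (n : ℕ) (q : ℕ → ℝ) (a : ℝ), (∀ i < n, |a * q i| ≤ δ) →
      ‖∏ i ∈ Finset.range n, charFun η (a * q i) - Complex.exp (-((∫ e, e ^ 2 ∂η : ℝ) *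
        (a ^ 2 * ∑ i ∈ Finset.range n, q i ^ 2) / 2 : ℝ))‖ ≤
        ε * (a ^ 2 * ∑ i ∈ Finset.range n, q i ^ 2) := by
  obtain ⟨δ, hδ, h⟩ := exists_norm_charFun_sub_exp_le h2 h0 hε
  refine ⟨δ, hδ, fun n q a hq => ?_⟩
  have hv0 : 0 ≤ ∫ e, e ^ 2 ∂η := integral_nonneg fun e => sq_nonneg e
  have e1 : Complex.exp (-((∫ e, e ^ 2 ∂η : ℝ) *
        (a ^ 2 * ∑ i ∈ Finset.range n, q i ^ 2) / 2 : ℝ)) =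
      ∏ i ∈ Finset.range n, Complex.exp (-((∫ e, e ^ 2 ∂η : ℝ) * (a * q i) ^ 2 / 2 : ℝ)) := by
    rw [← Complex.exp_sum]
    congr 1
    rw [Finset.sum_neg_distrib, ← Complex.ofReal_sum, ← Finset.sum_div, ← Finset.mul_sum]
    simp_rw [mul_pow, ← Finset.mul_sum]
  rw [e1]
  refine (norm_prod_sub_prod_le _ (fun i _ => norm_charFun_le_one _) fun i _ => ?_).trans ?_
  · rw [← Complex.ofReal_neg, Complex.norm_exp, Complex.ofReal_re, Real.exp_le_one_iff,
      neg_nonpos]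
    positivity
  · refine (Finset.sum_le_sum fun i hi => h _ (hq i (Finset.mem_range.mp hi))).trans_eq ?_
    simp_rw [mul_pow, ← Finset.mul_sum]

end CharFun

/-! ### The noise sum weighted by ranks -/

section Noise

variable {d n : ℕ} (ρ : Measure (EuclideanSpace ℝ (Fin d))) [IsProbabilityMeasure ρ]
  (η : Measure ℝ) [IsProbabilityMeasure η]

theorem measurable_sum_nnRank_mul (x : EuclideanSpace ℝ (Fin d)) (q : ℕ → ℝ) :
    Measurable fun p : (Fin n → EuclideanSpace ℝ (Fin d)) × (Fin n → ℝ) =>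
      ∑ j, q (nnRank x p.1 j) * p.2 j :=
  Finset.measurable_sum _ fun j _ => ((measurable_comp_nnRank x q j).comp measurable_fst).mul
    ((measurable_pi_apply j).comp measurable_snd)

/-- For fixed features the inner integral is a product over observations of `charFun η` at the
weight of their rank; by `prod_nnRank` it does not depend on the features, so the outer integral is
trivial. -/
theorem integral_exp_sum_nnRank (x : EuclideanSpace ℝ (Fin d)) (q : ℕ → ℝ) (a : ℝ) :
    ∫ p, Complex.exp (Complex.I * ((a * ∑ j, q (nnRank x p.1 j) * p.2 j : ℝ) : ℂ))
      ∂((Measure.pi fun _ : Fin n => ρ).prod (Measure.pi fun _ : Fin n => η)) =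
    ∏ i ∈ Finset.range n, charFun η (a * q i) := by
  have hm : Measurable fun p : (Fin n → EuclideanSpace ℝ (Fin d)) × (Fin n → ℝ) =>
      Complex.exp (Complex.I * ((a * ∑ j, q (nnRank x p.1 j) * p.2 j : ℝ) : ℂ)) :=
    Complex.measurable_exp.comp (measurable_const.mul (Complex.measurable_ofReal.comp
      (measurable_const.mul (measurable_sum_nnRank_mul x q))))
  rw [integral_prod]
  · have : ∀ X : Fin n → EuclideanSpace ℝ (Fin d),
        ∫ e, Complex.exp (Complex.I * ((a * ∑ j, q (nnRank x X j) * e j : ℝ) : ℂ))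
          ∂(Measure.pi fun _ : Fin n => η) = ∏ i ∈ Finset.range n, charFun η (a * q i) := by
      intro X
      rw [← prod_nnRank x X fun i => charFun η (a * q i)]
      simp_rw [charFun_apply_real]
      rw [← integral_fintype_prod_eq_prod
        (f := fun (j : Fin n) (e : ℝ) => Complex.exp ((a * q (nnRank x X j) : ℝ) * e * Complex.I))]
      refine integral_congr_ae (ae_of_all _ fun e => ?_)
      simp only
      rw [← Complex.exp_sum]
      congr 1
      push_cast
      rw [Finset.mul_sum, Finset.mul_sum]
      exact Finset.sum_congr rfl fun j _ => by ring
    simp_rw [this]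
    simp
  · refine Integrable.of_bound hm.aestronglyMeasurable 1 (ae_of_all _ fun p => ?_)
    rw [mul_comm, Complex.norm_exp_ofReal_mul_I]

theorem integrable_sum_nnRank_mul (x : EuclideanSpace ℝ (Fin d)) (q : ℕ → ℝ)
    (hη : Integrable id η) :
    Integrable (fun p : (Fin n → EuclideanSpace ℝ (Fin d)) × (Fin n → ℝ) =>
      ∑ j, q (nnRank x p.1 j) * p.2 j)
      ((Measure.pi fun _ : Fin n => ρ).prod (Measure.pi fun _ : Fin n => η)) := by
  refine integrable_finsetSum _ fun j _ => ?_
  have h : Integrable (fun p : (Fin n → EuclideanSpace ℝ (Fin d)) × (Fin n → ℝ) => p.2 j)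
      ((Measure.pi fun _ : Fin n => ρ).prod (Measure.pi fun _ : Fin n => η)) :=
    ((measurePreserving_eval (fun _ : Fin n => η) j).integrable_comp_of_integrable hη).comp_snd _
  exact h.bdd_mul (c := ∑ i ∈ Finset.range n, |q i|)
    ((measurable_comp_nnRank x q j).comp measurable_fst).aestronglyMeasurable
    (ae_of_all _ fun p => abs_comp_nnRank_le x q j p.1)

theorem integral_sum_nnRank_mul (x : EuclideanSpace ℝ (Fin d)) (q : ℕ → ℝ)
    (hη : Integrable id η) (h0 : ∫ e, e ∂η = 0) :
    ∫ p, ∑ j, q (nnRank x p.1 j) * p.2 j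
      ∂((Measure.pi fun _ : Fin n => ρ).prod (Measure.pi fun _ : Fin n => η)) = 0 := by
  rw [integral_prod _ (integrable_sum_nnRank_mul ρ η x q hη)]
  refine integral_eq_zero_of_ae (ae_of_all _ fun X => ?_)
  have hj : ∀ j : Fin n, ∫ e : Fin n → ℝ, e j ∂(Measure.pi fun _ : Fin n => η) = 0 := by
    intro j
    rw [← h0]
    exact integral_comp_eval (μ := fun _ : Fin n => η) (f := id) (i := j)
      hη.aestronglyMeasurable
  have hi : ∀ j : Fin n, Integrable (fun e : Fin n → ℝ => e j) (Measure.pi fun _ : Fin n => η) :=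
    fun j => (measurePreserving_eval (fun _ : Fin n => η) j).integrable_comp_of_integrable hη
  simp only [Pi.zero_apply]
  rw [integral_finsetSum _ fun j _ => (hi j).const_mul _]
  exact Finset.sum_eq_zero fun j _ => by rw [integral_const_mul, hj, mul_zero]

end Noise

/-! ### The two-scale estimator in the regression model with independent noise -/

/-- The regression model with feature law `ρ`, noise law `η`, density `f` and regression function
`mu`, together with the regularity at `x` on which the asymptotics depend. -/
structure RegularArm {d : ℕ} (ρ : Measure (EuclideanSpace ℝ (Fin d))) (η : Measure ℝ)
    (f mu : EuclideanSpace ℝ (Fin d) → ℝ) (x : EuclideanSpace ℝ (Fin d)) : Prop where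
  measurable_density : Measurable f
  density_nonneg : ∀ z, 0 ≤ f z
  eq_withDensity : ρ = volume.withDensity fun z => ENNReal.ofReal (f z)
  mem_support : x ∈ ρ.support
  density_pos : 0 < f x
  contDiffAt_density : ContDiffAt ℝ 2 f x
  contDiffAt_regression : ContDiffAt ℝ 2 mu x
  measurable_regression : Measurable mu
  regression_memLp : MemLp mu 2 ρ
  noise_memLp : MemLp id 2 η
  noise_mean : ∫ e, e ∂η = 0

/-- The two-scale estimator as a function of the features and the noise. -/
noncomputable def armEstimator {d n : ℕ} (mu : EuclideanSpace ℝ (Fin d) → ℝ)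
    (x : EuclideanSpace ℝ (Fin d)) (s t : ℕ)
    (p : (Fin n → EuclideanSpace ℝ (Fin d)) × (Fin n → ℝ)) : ℝ :=
  twoScaleDNN x s t fun j => (p.1 j, mu (p.1 j) + p.2 j)

namespace RegularArm

variable {d : ℕ} {ρ : Measure (EuclideanSpace ℝ (Fin d))} {η : Measure ℝ}
  {f mu : EuclideanSpace ℝ (Fin d) → ℝ} {x : EuclideanSpace ℝ (Fin d)}

theorem sphere_null (h : RegularArm ρ η f mu x) (hd : 0 < d) (r : ℝ) :
    ρ {z | ‖z - x‖ = r} = 0 := by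
  have : Nonempty (Fin d) := ⟨⟨0, hd⟩⟩
  have hac : ρ ≪ volume := h.eq_withDensity ▸ withDensity_absolutelyContinuous _ _
  refine hac ?_
  have : {z | ‖z - x‖ = r} = Metric.sphere x r := by
    ext z
    simp
  rw [this]
  exact Measure.addHaar_sphere _ _ _

theorem noise_integrable [IsProbabilityMeasure η] (h : RegularArm ρ η f mu x) : Integrable id η :=
  h.noise_memLp.integrable (by norm_num)

variable [IsProbabilityMeasure ρ]

theorem ballMass_pos (h : RegularArm ρ η f mu x) {δ : ℝ} (hδ : 0 < δ) : 0 < ballMass ρ x δ :=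
  ENNReal.toReal_pos (((Measure.mem_support_iff_forall x).mp h.mem_support _
    (Metric.closedBall_mem_nhds x hδ)).ne') (measure_ne_top _ _)

theorem memLp_sub_const (h : RegularArm ρ η f mu x) : MemLp (fun z => mu z - mu x) 2 ρ :=
  h.regression_memLp.sub (memLp_const (mu x))

theorem integrable_sub_const (h : RegularArm ρ η f mu x) : Integrable (fun z => mu z - mu x) ρ :=
  h.memLp_sub_const.integrable (by norm_num)

end RegularArm

section Arm

variable {d n s t : ℕ} {ρ : Measure (EuclideanSpace ℝ (Fin d))} [IsProbabilityMeasure ρ]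
  {η : Measure ℝ} [IsProbabilityMeasure η] {f mu : EuclideanSpace ℝ (Fin d) → ℝ}
  {x : EuclideanSpace ℝ (Fin d)}

/-- The weights sum to one, so the constant `mu x` can be taken out. -/
theorem armEstimator_eq (hd : 0 < d) (hs : 1 ≤ s) (hst : s < t) (htn : t ≤ n)
    (mu : EuclideanSpace ℝ (Fin d) → ℝ) (x : EuclideanSpace ℝ (Fin d))
    (p : (Fin n → EuclideanSpace ℝ (Fin d)) × (Fin n → ℝ)) :
    armEstimator mu x s t p = twoScaleDNN x s t (fun j => (p.1 j, mu (p.1 j) - mu x)) +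
      (mu x + ∑ j, twoScaleWeight d n s t (nnRank x p.1 j) * p.2 j) := by
  rw [armEstimator, twoScaleDNN_eq_sum x hd hs hst, twoScaleDNN_eq_sum x hd hs hst]
  have h1 : ∑ j, twoScaleWeight d n s t (nnRank x p.1 j) * mu x = mu x := by
    rw [← Finset.sum_mul, sum_nnRank x p.1 fun i => twoScaleWeight d n s t i,
      sum_twoScaleWeight hs hst htn, one_mul]
  conv_rhs => rw [← h1]
  simp only [mul_add, mul_sub, h1, Finset.sum_add_distrib, Finset.sum_sub_distrib]
  ring

theorem measurable_armEstimator (hd : 0 < d) (hs : 1 ≤ s) (hst : s < t) (hmu : Measurable mu) :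
    Measurable (armEstimator (n := n) mu x s t) := by
  have : armEstimator (n := n) mu x s t = fun p =>
      ∑ j, twoScaleWeight d n s t (nnRank x p.1 j) * (mu (p.1 j) + p.2 j) :=
    funext fun p => twoScaleDNN_eq_sum x hd hs hst _
  rw [this]
  refine Finset.measurable_sum _ fun j _ => ?_
  have h1 : Measurable fun p : (Fin n → EuclideanSpace ℝ (Fin d)) × (Fin n → ℝ) =>
      twoScaleWeight d n s t (nnRank x p.1 j) :=
    (measurable_comp_nnRank x (twoScaleWeight d n s t) j).comp measurable_fst
  exact h1.mul ((hmu.comp ((measurable_pi_apply j).comp measurable_fst)).add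
    ((measurable_pi_apply j).comp measurable_snd))

theorem memLp_twoScaleDNN_pi {p : ENNReal} {g : EuclideanSpace ℝ (Fin d) → ℝ} (hd : 0 < d)
    (hs : 1 ≤ s) (hst : s < t) (hg : MemLp g p ρ) :
    MemLp (fun X : Fin n → EuclideanSpace ℝ (Fin d) =>
      twoScaleDNN x s t (fun j => (X j, g (X j)))) p (Measure.pi fun _ => ρ) := by
  simp_rw [twoScaleDNN_eq_sum x hd hs hst]
  exact memLp_sum_nnRank x (twoScaleWeight d n s t) hg

namespace RegularArm

theorem integrable_armEstimator (h : RegularArm ρ η f mu x) (hd : 0 < d) (hs : 1 ≤ s)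
    (hst : s < t) (htn : t ≤ n) :
    Integrable (armEstimator mu x s t)
      ((Measure.pi fun _ : Fin n => ρ).prod (Measure.pi fun _ : Fin n => η)) := by
  simp_rw [funext (armEstimator_eq hd hs hst htn mu x)]
  have h1 := memLp_one_iff_integrable.mp (memLp_twoScaleDNN_pi (n := n) (x := x) hd hs hst
    (memLp_one_iff_integrable.mpr h.integrable_sub_const))
  exact (h1.comp_fst _).add ((integrable_const _).add
    (integrable_sum_nnRank_mul ρ η x _ h.noise_integrable))

theorem integral_armEstimator (h : RegularArm ρ η f mu x) (hd : 0 < d) (hs : 1 ≤ s)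
    (hst : s < t) (htn : t ≤ n) :
    ∫ p, armEstimator mu x s t p
      ∂((Measure.pi fun _ : Fin n => ρ).prod (Measure.pi fun _ : Fin n => η)) =
    ∫ X, twoScaleDNN x s t (fun j => (X j, mu (X j) - mu x)) ∂(Measure.pi fun _ : Fin n => ρ) +
      mu x := by
  simp_rw [armEstimator_eq hd hs hst htn mu x]
  have h1 := memLp_one_iff_integrable.mp (memLp_twoScaleDNN_pi (n := n) (x := x) hd hs hst
    (memLp_one_iff_integrable.mpr h.integrable_sub_const))
  have h2 := integrable_sum_nnRank_mul (n := n) ρ η x (twoScaleWeight d n s t) h.noise_integrable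
  have h3 := h1.comp_fst (Measure.pi fun _ : Fin n => η)
  have h4 : Integrable (fun p : (Fin n → EuclideanSpace ℝ (Fin d)) × (Fin n → ℝ) =>
      mu x + ∑ j, twoScaleWeight d n s t (nnRank x p.1 j) * p.2 j)
      ((Measure.pi fun _ : Fin n => ρ).prod (Measure.pi fun _ : Fin n => η)) :=
    (integrable_const _).add h2
  rw [integral_add h3 h4, integral_add (integrable_const _) h2,
    integral_sum_nnRank_mul ρ η x _ h.noise_integrable h.noise_mean, add_zero,
    integral_fun_fst (fun X : Fin n → EuclideanSpace ℝ (Fin d) =>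
      twoScaleDNN x s t (fun j => (X j, mu (X j) - mu x)))]
  simp

theorem exists_abs_bias_le (h : RegularArm ρ η f mu x) (hd : 0 < d) {ε : ℝ} (hε : 0 < ε) :
    ∃ N : ℕ, 1 ≤ N ∧ ∀ n s t : ℕ, N ≤ s → s < t → t ≤ n →
      |∫ p, armEstimator mu x s t p
        ∂((Measure.pi fun _ : Fin n => ρ).prod (Measure.pi fun _ : Fin n => η)) - mu x| ≤
      ε * scaleRate d s := by
  have hq : ContDiffAt ℝ 2 (fun z : EuclideanSpace ℝ (Fin d) =>
      f (x + z) * (mu (x + z) - mu x)) 0 := by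
    have e : ContDiffAt ℝ 2 (fun z : EuclideanSpace ℝ (Fin d) => x + z) 0 := by fun_prop
    have h1 : ContDiffAt ℝ 2 (fun z => f (x + z)) 0 :=
      ContDiffAt.comp (g := f) 0 (by simpa using h.contDiffAt_density) e
    have h2 : ContDiffAt ℝ 2 (fun z => mu (x + z)) 0 :=
      ContDiffAt.comp (g := mu) 0 (by simpa using h.contDiffAt_regression) e
    exact h1.mul (h2.sub contDiffAt_const)
  obtain ⟨N, hN1, hN⟩ := exists_abs_two_scale_bias_le hd h.measurable_density h.density_nonneg
    h.eq_withDensity h.contDiffAt_density.continuousAt h.density_pos h.integrable_sub_const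
    (sub_self _) hq hε
  refine ⟨N, hN1, fun n s t hs hst htn => ?_⟩
  have hs1 : 1 ≤ s := hN1.trans hs
  rw [h.integral_armEstimator hd hs1 hst htn, add_sub_cancel_right]
  simp_rw [twoScaleDNN_eq_extrapolation x hd hs1 hst]
  rw [integral_sub, integral_const_mul, integral_const_mul,
    integral_dnn (h.sphere_null hd) h.integrable_sub_const htn,
    integral_dnn (h.sphere_null hd) h.integrable_sub_const (by omega)]
  · exact hN s t hs hst
  · exact (integrable_dnn h.integrable_sub_const (by omega)).const_mul _
  · exact (integrable_dnn h.integrable_sub_const hs1).const_mul _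

end RegularArm

theorem integral_abs_sub_le_sqrt_variance {Ω : Type*} [MeasurableSpace Ω] {P : Measure Ω}
    [IsProbabilityMeasure P] {V : Ω → ℝ} (hV : MemLp V 2 P) :
    ∫ ω, |V ω - ∫ ω', V ω' ∂P| ∂P ≤ Real.sqrt (variance V P) := by
  have h1 : MemLp (fun ω => |V ω - ∫ ω', V ω' ∂P|) 2 P := (hV.sub (memLp_const _)).abs
  refine Real.le_sqrt_of_sq_le ?_
  have h2 := variance_nonneg (fun ω => |V ω - ∫ ω', V ω' ∂P|) P
  rw [variance_eq_sub h1] at h2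
  rw [variance_eq_integral hV.aemeasurable]
  simp only [Pi.pow_apply, sq_abs] at h2
  linarith

namespace RegularArm

/-- The quantitative central limit theorem for one arm. Half of `ε` pays for dropping the regression
part, through `‖exp (i y) - 1‖ ≤ |y|` and its standard deviation; the other half pays for the
Gaussian approximation of the noise product. -/
theorem exists_norm_integral_exp_sub_le (h : RegularArm ρ η f mu x) (hd : 0 < d) {B ε : ℝ}
    (hB : 0 < B) (hε : 0 < ε) :
    ∃ (N : ℕ) (c : ℝ), 1 ≤ N ∧ 0 < c ∧ ∀ n s t : ℕ, N ≤ s → s < t → t ≤ n → (t : ℝ) / n ≤ c →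
      ∀ a : ℝ, a ^ 2 * ∑ i ∈ Finset.range n, twoScaleWeight d n s t i ^ 2 ≤ B →
      ‖∫ p, Complex.exp (Complex.I * ((a * (armEstimator mu x s t p -
            ∫ p', armEstimator mu x s t p'
              ∂((Measure.pi fun _ : Fin n => ρ).prod (Measure.pi fun _ : Fin n => η))) : ℝ) : ℂ))
          ∂((Measure.pi fun _ : Fin n => ρ).prod (Measure.pi fun _ : Fin n => η)) -
        Complex.exp (-((∫ e, e ^ 2 ∂η : ℝ) *
          (a ^ 2 * ∑ i ∈ Finset.range n, twoScaleWeight d n s t i ^ 2) / 2 : ℝ))‖ ≤ ε := by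
  obtain ⟨δ, hδ, hprod⟩ := exists_norm_prod_charFun_sub_exp_le h.noise_memLp h.noise_mean
    (ε := ε / (2 * B)) (by positivity)
  obtain ⟨N, hN1, hvar⟩ := exists_variance_twoScaleDNN_le (m := fun z => mu z - mu x) hd
    (h.sphere_null hd) (fun r hr => h.ballMass_pos hr) h.memLp_sub_const
    (h.contDiffAt_regression.continuousAt.sub continuousAt_const) (sub_self _)
    (ε := (ε / 2) ^ 2 / (8 * B)) (by positivity)
  -- Since `Sq ≥ r / 8`, the normalization forces `a ^ 2 r ≤ 8 B`; this `c` then makes every `|a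
  -- w_i|` at most `δ`.
  refine ⟨N, δ ^ 2 / (8 * B * (1 + d) ^ 2), hN1, by positivity,
    fun n s t hs hst htn hc a ha => ?_⟩
  have hs1 : 1 ≤ s := hN1.trans hs
  set Sq := ∑ i ∈ Finset.range n, twoScaleWeight d n s t i ^ 2 with hSq
  set r : ℝ := (t : ℝ) / n with hr
  have hr0 : 0 ≤ r := by positivity
  have hrS : r / 8 ≤ Sq := le_sum_sq_twoScaleWeight hd hs1 hst htn
  have har : a ^ 2 * r ≤ 8 * B := by nlinarith [sq_nonneg a]
  have hq : ∀ i < n, |a * twoScaleWeight d n s t i| ≤ δ := by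
    intro i hi
    have h1 := abs_twoScaleWeight_le hd hs1 hst htn hi
    refine abs_le_of_sq_le_sq ?_ hδ.le
    have h2 : (twoScaleWeight d n s t i) ^ 2 ≤ ((1 + d) * r) ^ 2 := by
      rw [← sq_abs]
      exact pow_le_pow_left₀ (abs_nonneg _) h1 2
    rw [le_div_iff₀ (by positivity)] at hc
    calc (a * twoScaleWeight d n s t i) ^ 2 = a ^ 2 * (twoScaleWeight d n s t i) ^ 2 := by ring
      _ ≤ a ^ 2 * ((1 + d) * r) ^ 2 := by gcongr
      _ = (a ^ 2 * r) * (r * (1 + d) ^ 2) := by ring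
      _ ≤ (8 * B) * (r * (1 + d) ^ 2) := by gcongr
      _ = r * (8 * B * (1 + d) ^ 2) := by ring
      _ ≤ δ ^ 2 := hc
  set 𝔪 := (Measure.pi fun _ : Fin n => ρ).prod (Measure.pi fun _ : Fin n => η) with h𝔪
  set M : (Fin n → EuclideanSpace ℝ (Fin d)) → ℝ :=
    fun X => twoScaleDNN x s t (fun j => (X j, mu (X j) - mu x)) with hM
  have hM2 : MemLp M 2 (Measure.pi fun _ => ρ) :=
    memLp_twoScaleDNN_pi (g := fun z => mu z - mu x) hd hs1 hst h.memLp_sub_const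
  have hdev : ∀ p, armEstimator mu x s t p - ∫ p', armEstimator mu x s t p' ∂𝔪 =
      (M p.1 - ∫ X, M X ∂(Measure.pi fun _ => ρ)) +
        ∑ j, twoScaleWeight d n s t (nnRank x p.1 j) * p.2 j := by
    intro p
    rw [h.integral_armEstimator hd hs1 hst htn, armEstimator_eq hd hs1 hst htn]
    ring
  have hmT : Measurable (armEstimator (n := n) mu x s t) :=
    measurable_armEstimator hd hs1 hst h.measurable_regression
  have hmexp : ∀ g : (Fin n → EuclideanSpace ℝ (Fin d)) × (Fin n → ℝ) → ℝ, Measurable g →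
      Integrable (fun p => Complex.exp (Complex.I * ((g p : ℝ) : ℂ))) 𝔪 := by
    intro g hg
    refine Integrable.of_bound (Complex.measurable_exp.comp (measurable_const.mul
      (Complex.measurable_ofReal.comp hg))).aestronglyMeasurable 1 (ae_of_all _ fun p => ?_)
    rw [mul_comm, Complex.norm_exp_ofReal_mul_I]
  have hnoise := hprod n (twoScaleWeight d n s t) a hq
  rw [← integral_exp_sum_nnRank ρ η x] at hnoise
  have hI1 := hmexp (fun p => a * (armEstimator mu x s t p - ∫ p', armEstimator mu x s t p' ∂𝔪))
    (measurable_const.mul (hmT.sub_const _))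
  have hI2 := hmexp (fun p => a * ∑ j, twoScaleWeight d n s t (nnRank x p.1 j) * p.2 j)
    (measurable_const.mul (measurable_sum_nnRank_mul x _))
  have hMint : Integrable (fun X => |M X - ∫ X', M X' ∂(Measure.pi fun _ => ρ)|)
      (Measure.pi fun _ => ρ) :=
    ((hM2.integrable (by norm_num)).sub (integrable_const _)).abs
  have hreg : ‖∫ p, Complex.exp (Complex.I * ((a * (armEstimator mu x s t p -
        ∫ p', armEstimator mu x s t p' ∂𝔪) : ℝ) : ℂ)) ∂𝔪 -
      ∫ p, Complex.exp (Complex.I * ((a * ∑ j, twoScaleWeight d n s t (nnRank x p.1 j) * p.2 j :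
        ℝ) : ℂ)) ∂𝔪‖ ≤ ε / 2 := by
    rw [← integral_sub hI1 hI2]
    calc _ ≤ ∫ p, |a| * |M p.1 - ∫ X, M X ∂(Measure.pi fun _ => ρ)| ∂𝔪 := by
          refine norm_integral_le_of_norm_le ((hMint.comp_fst _).const_mul _)
            (ae_of_all _ fun p => ?_)
          rw [hdev, mul_add, Complex.ofReal_add, mul_add, Complex.exp_add, ← sub_one_mul, norm_mul]
          rw [mul_comm Complex.I ((a * ∑ j, twoScaleWeight d n s t (nnRank x p.1 j) * p.2 j : ℝ) : ℂ),
            Complex.norm_exp_ofReal_mul_I, mul_one]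
          refine Real.norm_exp_I_mul_ofReal_sub_one_le.trans ?_
          rw [Real.norm_eq_abs, abs_mul]
      _ = |a| * ∫ X, |M X - ∫ X', M X' ∂(Measure.pi fun _ => ρ)| ∂(Measure.pi fun _ => ρ) := by
          rw [integral_const_mul, integral_fun_fst
            (fun X => |M X - ∫ X', M X' ∂(Measure.pi fun _ => ρ)|)]
          simp
      _ ≤ |a| * Real.sqrt (variance M (Measure.pi fun _ => ρ)) := by
          gcongr
          exact integral_abs_sub_le_sqrt_variance hM2
      _ ≤ ε / 2 := by
          rw [← Real.sqrt_sq_eq_abs, ← Real.sqrt_mul (sq_nonneg a)]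
          refine Real.sqrt_le_iff.mpr ⟨by positivity, ?_⟩
          calc a ^ 2 * variance M (Measure.pi fun _ => ρ)
              ≤ a ^ 2 * ((ε / 2) ^ 2 / (8 * B) * r) := by
                gcongr
                exact hvar n s t hs hst htn
            _ = (a ^ 2 * r) * ((ε / 2) ^ 2 / (8 * B)) := by ring
            _ ≤ (8 * B) * ((ε / 2) ^ 2 / (8 * B)) := by gcongr
            _ = (ε / 2) ^ 2 := by field_simp
  refine (norm_sub_le_norm_sub_add_norm_sub _ _ _).trans
    ((add_le_add hreg (hnoise.trans ?_)).trans_eq (add_halves ε))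
  calc ε / (2 * B) * (a ^ 2 * Sq) ≤ ε / (2 * B) * B := by gcongr
    _ = ε / 2 := by field_simp

end RegularArm

theorem map_pi_prod_response (hmu : Measurable mu) :
    ((Measure.pi fun _ : Fin n => ρ).prod (Measure.pi fun _ : Fin n => η)).map
      (fun p (j : Fin n) => (p.1 j, mu (p.1 j) + p.2 j)) =
    Measure.pi fun _ : Fin n => (ρ.prod η).map fun p => (p.1, mu p.1 + p.2) := by
  have hm : Measurable fun p : EuclideanSpace ℝ (Fin d) × ℝ => (p.1, mu p.1 + p.2) :=
    measurable_fst.prodMk ((hmu.comp measurable_fst).add measurable_snd)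
  have h1 := (measurePreserving_arrowProdEquivProdArrow (EuclideanSpace ℝ (Fin d)) ℝ (Fin n)
    (fun _ => ρ) (fun _ => η)).map_eq
  have h2 : Measurable fun p : (Fin n → EuclideanSpace ℝ (Fin d)) × (Fin n → ℝ) =>
      fun j : Fin n => (p.1 j, mu (p.1 j) + p.2 j) :=
    measurable_pi_lambda _ fun j => ((measurable_pi_apply j).comp measurable_fst).prodMk
      ((hmu.comp ((measurable_pi_apply j).comp measurable_fst)).add
        ((measurable_pi_apply j).comp measurable_snd))
  rw [← h1, Measure.map_map h2 (MeasurableEquiv.measurable _)]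
  exact Measure.pi_map_pi (μ := fun _ : Fin n => ρ.prod η)
    (f := fun _ p => (p.1, mu p.1 + p.2)) (fun _ => hm.aemeasurable)

end Arm

/-! ### Identification of the treatment effect -/

section CondIndep

/-- Conditional independence is independence under almost every conditional distribution
`condExpKernel P m' ω`, where the expectation of the product factorizes. -/
theorem condExp_mul_of_condIndepFun {Ω β β' : Type*} {m' : MeasurableSpace Ω} [mΩ : MeasurableSpace Ω]
    [StandardBorelSpace Ω] [MeasurableSpace β] [MeasurableSpace β']
    [MeasurableSpace.CountableOrCountablyGenerated Ω (β × β')] {P : Measure Ω}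
    [IsProbabilityMeasure P] {hm' : m' ≤ mΩ} {F : Ω → β} {G : Ω → β'}
    (hF : Measurable F) (hG : Measurable G) (h : CondIndepFun m' hm' F G P) {φ : β → ℝ}
    {ψ : β' → ℝ} (hφ : Measurable φ) (hψ : Measurable ψ) (hφi : Integrable (fun ω => φ (F ω)) P)
    (hψi : Integrable (fun ω => ψ (G ω)) P) (hi : Integrable (fun ω => φ (F ω) * ψ (G ω)) P) :
    P[fun ω => φ (F ω) * ψ (G ω) | m'] =ᵐ[P]
      fun ω => (P[fun ω => φ (F ω) | m']) ω * (P[fun ω => ψ (G ω) | m']) ω := by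
  have h1 := (condIndepFun_iff_map_prod_eq_prod_map_map hF hG).mp h
  filter_upwards [ae_of_ae_trim hm' h1, condExp_ae_eq_integral_condExpKernel hm' hi,
    condExp_ae_eq_integral_condExpKernel hm' hφi, condExp_ae_eq_integral_condExpKernel hm' hψi]
    with ω hω e1 e2 e3
  rw [e1, e2, e3]
  rw [Kernel.map_apply _ (hF.prodMk hG), Kernel.prod_apply, Kernel.map_apply _ hF,
    Kernel.map_apply _ hG] at hω
  have hind : IndepFun F G (condExpKernel P m' ω) :=
    (indepFun_iff_map_prod_eq_prod_map_map hF.aemeasurable hG.aemeasurable).mpr hω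
  exact hind.integral_fun_comp_mul_comp hF.aemeasurable hG.aemeasurable
    hφ.aestronglyMeasurable hψ.aestronglyMeasurable

end CondIndep

/-! ### Consequences of the regression model of one arm -/

section RegressionModel

variable {Ω : Type*} [MeasurableSpace Ω] {d : ℕ} {P G : Measure Ω}
  {X : Ω → EuclideanSpace ℝ (Fin d)} {W : Ω → Fin 2} {R : Ω → ℝ}
  {f μ : EuclideanSpace ℝ (Fin d) → ℝ} {x : EuclideanSpace ℝ (Fin d)}

/-- Conditioning on a null event yields the zero measure, whose support is empty. Both arms
therefore have positive probability. -/
theorem measure_treatment_ne_zero (a : Fin 2) (hx : x ∈ ((armMeasure P W a).map X).support) :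
    P (W ⁻¹' {a}) ≠ 0 := by
  intro h
  rw [armMeasure, cond_eq_zero_of_meas_eq_zero h, Measure.map_zero, Measure.support_zero] at hx
  exact hx

theorem setIntegral_noise [IsProbabilityMeasure G] (hX : Measurable X)
    (h : RegularModelAt G X R f μ x) {B : Set (EuclideanSpace ℝ (Fin d))} (hB : MeasurableSet B) :
    ∫ ω in X ⁻¹' B, (R ω - μ (X ω)) ∂G = 0 := by
  have h1 := h.noise_indep.integral_fun_comp_mul_comp (f := B.indicator fun _ => (1 : ℝ))
    (g := fun e => e) hX.aemeasurable h.noise_memLp.aestronglyMeasurable.aemeasurable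
    (measurable_const.indicator hB).aestronglyMeasurable measurable_id.aestronglyMeasurable
  rw [h.noise_mean, mul_zero] at h1
  rw [← integral_indicator (hX hB), ← h1]
  refine integral_congr_ae (ae_of_all _ fun ω => ?_)
  by_cases hω : X ω ∈ B <;> simp [hω]

theorem RegularModelAt.regression_memLp
    (h : RegularModelAt G X R f μ x) : MemLp (fun ω => μ (X ω)) 2 G := by
  have := h.response_memLp.sub h.noise_memLp
  refine this.congr_norm ?_ (ae_of_all _ fun ω => ?_)
  · exact this.aestronglyMeasurable.congr (ae_of_all _ fun ω => by simp)
  · simp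

theorem RegularModelAt.density_pos
    (h : RegularModelAt G X R f μ x) (hx : x ∈ (G.map X).support) : 0 < f x := by
  obtain ⟨U, -, hxU, ⟨c, C, hc, hcC⟩, -⟩ := h.exists_nhds
  exact hc.trans_le (hcC x ⟨hxU, hx⟩).1

theorem RegularModelAt.contDiffAt
    (h : RegularModelAt G X R f μ x) : ContDiffAt ℝ 2 f x ∧ ContDiffAt ℝ 2 μ x := by
  obtain ⟨U, hU, hxU, -, hf, hμ, -⟩ := h.exists_nhds
  exact ⟨hf.contDiffAt (hU.mem_nhds hxU), hμ.contDiffAt (hU.mem_nhds hxU)⟩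

theorem RegularModelAt.regularArm [IsProbabilityMeasure G]
    (hX : Measurable X) (h : RegularModelAt G X R f μ x) (hx : x ∈ (G.map X).support) :
    RegularArm (G.map X) (G.map fun ω => R ω - μ (X ω)) f μ x where
  measurable_density := h.measurable_density
  density_nonneg := h.density_nonneg
  eq_withDensity := h.map_eq_withDensity
  mem_support := hx
  density_pos := h.density_pos hx
  contDiffAt_density := h.contDiffAt.1
  contDiffAt_regression := h.contDiffAt.2
  measurable_regression := h.measurable_regression
  regression_memLp := (memLp_map_measure_iff h.measurable_regression.aestronglyMeasurable
    hX.aemeasurable).mpr h.regression_memLp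
  noise_memLp := (memLp_map_measure_iff aestronglyMeasurable_id
    h.noise_memLp.aestronglyMeasurable.aemeasurable).mpr h.noise_memLp
  noise_mean := by
    rw [integral_map h.noise_memLp.aestronglyMeasurable.aemeasurable
      measurable_id'.aestronglyMeasurable]
    exact h.noise_mean

theorem RegularModelAt.integral_noise_sq_pos [IsProbabilityMeasure G]
    (h : RegularModelAt G X R f μ x) :
    0 < ∫ e, e ^ 2 ∂(G.map fun ω => R ω - μ (X ω)) := by
  have hn := h.noise_memLp.aestronglyMeasurable.aemeasurable
  rw [integral_map hn (measurable_id'.pow_const 2).aestronglyMeasurable]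
  have := h.noise_variance_pos
  rw [variance_eq_integral hn, h.noise_mean] at this
  simpa using this

theorem RegularModelAt.map_prod_response [IsProbabilityMeasure G]
    (hX : Measurable X) (h : RegularModelAt G X R f μ x) :
    ((G.map X).prod (G.map fun ω => R ω - μ (X ω))).map (fun p => (p.1, μ p.1 + p.2)) =
      G.map fun ω => (X ω, R ω) := by
  have hn := h.noise_memLp.aestronglyMeasurable.aemeasurable
  rw [← (indepFun_iff_map_prod_eq_prod_map_map hX.aemeasurable hn).mp h.noise_indep,
    AEMeasurable.map_map_of_aemeasurable _ (hX.aemeasurable.prodMk hn)]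
  · simp [Function.comp_def]
  · exact (measurable_fst.prodMk
      ((h.measurable_regression.comp measurable_fst).add measurable_snd)).aemeasurable

end RegressionModel

section Identification

variable {Ω : Type*} [MeasurableSpace Ω] [StandardBorelSpace Ω] {d : ℕ} {P : Measure Ω}
  [IsProbabilityMeasure P] {X : Ω → EuclideanSpace ℝ (Fin d)} {W : Ω → Fin 2}
  {Y : Fin 2 → Ω → ℝ} {f μ : EuclideanSpace ℝ (Fin d) → ℝ} {x : EuclideanSpace ℝ (Fin d)}

/-- Given `X`, unconfoundedness makes the conditional expectation of `Y a · 1{W = a}` the product of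
those of `Y a` and `1{W = a}`; pulling out the first, `X`-measurable factor shows that `E[Y a | X] ·
1{W = a}` has the same conditional expectation. -/
theorem setIntegral_potentialOutcome {hX : Measurable X} (hW : Measurable W)
    (hY : ∀ a, Measurable (Y a)) (hYint : ∀ a, Integrable (Y a) P)
    (hunc : Unconfounded P X hX W Y) (a : Fin 2) {B : Set (EuclideanSpace ℝ (Fin d))}
    (hB : MeasurableSet B) :
    ∫ ω in X ⁻¹' B ∩ W ⁻¹' {a}, Y a ω ∂P =
      ∫ ω in X ⁻¹' B ∩ W ⁻¹' {a}, (P[Y a | MeasurableSpace.comap X inferInstance]) ω ∂P := by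
  have hle := hX.comap_le
  set A := W ⁻¹' {a} with hA
  have hAm : MeasurableSet A := hW (measurableSet_singleton a)
  have hBm : MeasurableSet[MeasurableSpace.comap X inferInstance] (X ⁻¹' B) := ⟨B, hB, rfl⟩
  set ψ : Fin 2 → ℝ := fun b => if b = a then 1 else 0 with hψ
  have hmul : ∀ (g : Ω → ℝ) (ω : Ω), g ω * ψ (W ω) = A.indicator g ω := by
    intro g ω
    by_cases hω : W ω = a
    · simp [hψ, hA, hω]
    · simp [hψ, hA, hω]
  have hψm : Measurable ψ := measurable_of_finite ψ
  have hψi : Integrable (fun ω => ψ (W ω)) P := by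
    refine Integrable.of_bound (hψm.comp hW).aestronglyMeasurable 1 (ae_of_all _ fun ω => ?_)
    simp only [hψ]
    split_ifs <;> simp
  have hpair : Measurable fun ω => (Y 0 ω, Y 1 ω) := (hY 0).prodMk (hY 1)
  obtain ⟨φ, hφm, hφ⟩ : ∃ φ : ℝ × ℝ → ℝ, Measurable φ ∧ ∀ ω, φ (Y 0 ω, Y 1 ω) = Y a ω := by
    fin_cases a
    · exact ⟨Prod.fst, measurable_fst, fun _ => rfl⟩
    · exact ⟨Prod.snd, measurable_snd, fun _ => rfl⟩
  have hYψ : Integrable (fun ω => Y a ω * ψ (W ω)) P := by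
    simp_rw [hmul]
    exact (hYint a).indicator hAm
  have hEψ : Integrable (P[Y a | MeasurableSpace.comap X inferInstance] * fun ω => ψ (W ω)) P := by
    have : (P[Y a | MeasurableSpace.comap X inferInstance] * fun ω => ψ (W ω)) = A.indicator (P[Y a | MeasurableSpace.comap X inferInstance]) := funext fun ω => hmul _ ω
    rw [this]
    exact integrable_condExp.indicator hAm
  have h1 := condExp_mul_of_condIndepFun hpair hW hunc hφm hψm (by simpa only [hφ] using hYint a)
    hψi (by simpa only [hφ] using hYψ)
  simp only [hφ] at h1
  have h2 := condExp_mul_of_stronglyMeasurable_left (μ := P) (m := MeasurableSpace.comap X inferInstance)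
    (stronglyMeasurable_condExp (f := Y a)) hEψ hψi
  rw [← setIntegral_indicator hAm, ← setIntegral_indicator hAm]
  calc ∫ ω in X ⁻¹' B, A.indicator (Y a) ω ∂P = ∫ ω in X ⁻¹' B, Y a ω * ψ (W ω) ∂P := by
        simp_rw [hmul]
    _ = ∫ ω in X ⁻¹' B, (P[fun ω => Y a ω * ψ (W ω) | MeasurableSpace.comap X inferInstance]) ω ∂P :=
        (setIntegral_condExp hle hYψ hBm).symm
    _ = ∫ ω in X ⁻¹' B, (P[P[Y a | MeasurableSpace.comap X inferInstance] * (fun ω => ψ (W ω)) | MeasurableSpace.comap X inferInstance]) ω ∂P := by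
        refine integral_congr_ae (ae_restrict_of_ae ?_)
        filter_upwards [h1, h2] with ω e1 e2
        rw [e1, e2, Pi.mul_apply]
    _ = ∫ ω in X ⁻¹' B, (P[Y a | MeasurableSpace.comap X inferInstance] * fun ω => ψ (W ω)) ω ∂P := setIntegral_condExp hle hEψ hBm
    _ = _ := by
        refine integral_congr_ae (ae_of_all _ fun ω => ?_)
        exact hmul _ ω

/-- Within arm `a` the observed response is `Y a` and the noise has zero integral over each `X⁻¹ B`,
so `μ` and the version `g` of `E[Y a | X]` have equal integrals over every measurable `B`. -/
theorem exists_condExp_potentialOutcome_eq {hX : Measurable X} (hW : Measurable W)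
    (hY : ∀ a, Measurable (Y a)) (hYint : ∀ a, Integrable (Y a) P)
    (hunc : Unconfounded P X hX W Y) (a : Fin 2)
    (hx : x ∈ ((armMeasure P W a).map X).support)
    (hreg : RegularModelAt (armMeasure P W a) X (observedResponse W Y) f μ x) :
    ∃ g : EuclideanSpace ℝ (Fin d) → ℝ, Measurable g ∧
      (P[Y a | MeasurableSpace.comap X inferInstance]) = (fun ω => g (X ω)) ∧
      g =ᵐ[(armMeasure P W a).map X] μ := by
  obtain ⟨g, hg, hgX⟩ := (stronglyMeasurable_condExp (f := Y a) (μ := P)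
    (m := MeasurableSpace.comap X inferInstance)).measurable.exists_eq_measurable_comp
  refine ⟨g, hg, hgX, ?_⟩
  have hA := measure_treatment_ne_zero a hx
  have hAm : MeasurableSet (W ⁻¹' {a}) := hW (measurableSet_singleton a)
  have : IsProbabilityMeasure (armMeasure P W a) := cond_isProbabilityMeasure hA
  have hGdef : armMeasure P W a = (P (W ⁻¹' {a}))⁻¹ • P.restrict (W ⁻¹' {a}) := rfl
  have hcond : ∀ (B : Set (EuclideanSpace ℝ (Fin d))) (φ : Ω → ℝ), MeasurableSet B →
      ∫ ω in X ⁻¹' B, φ ω ∂(armMeasure P W a) =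
        ((P (W ⁻¹' {a}))⁻¹).toReal * ∫ ω in X ⁻¹' B ∩ W ⁻¹' {a}, φ ω ∂P := by
    intro B φ hB
    rw [hGdef, Measure.restrict_smul, integral_smul_measure, Measure.restrict_restrict (hX hB),
      smul_eq_mul]
  have hgi : Integrable (fun ω => g (X ω)) (armMeasure P W a) := by
    rw [hGdef]
    have h1 : Integrable (fun ω => g (X ω)) P := by
      have := integrable_condExp (f := Y a) (μ := P) (m := MeasurableSpace.comap X inferInstance)
      rw [hgX] at this
      exact this
    exact h1.restrict.smul_measure (ENNReal.inv_ne_top.mpr hA)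
  have hμi := hreg.regression_memLp.integrable (by norm_num)
  have hRY : ∀ᵐ ω ∂(armMeasure P W a), observedResponse W Y ω = Y a ω :=
    ae_cond_of_forall_mem hAm fun ω hω => by
      have : W ω = a := hω
      simp [observedResponse, this]
  have hgi' := (integrable_map_measure hg.aestronglyMeasurable hX.aemeasurable
    (μ := armMeasure P W a)).mpr hgi
  have hμi' := (integrable_map_measure hreg.measurable_regression.aestronglyMeasurable
    hX.aemeasurable (μ := armMeasure P W a)).mpr hμi
  refine hgi'.ae_eq_of_forall_setIntegral_eq _ _ hμi' fun B hB _ => ?_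
  rw [setIntegral_map hB hg.aestronglyMeasurable hX.aemeasurable,
    setIntegral_map hB hreg.measurable_regression.aestronglyMeasurable hX.aemeasurable]
  have h1 := setIntegral_noise hX hreg hB
  have h2 := setIntegral_potentialOutcome hW hY hYint hunc a hB
  rw [hgX] at h2
  have hRi := hreg.response_memLp.integrable (by norm_num)
  rw [integral_sub hRi.integrableOn hμi.integrableOn, sub_eq_zero] at h1
  rw [← h1, hcond B _ hB, ← Function.comp_def g X, ← h2, ← hcond B _ hB]
  exact integral_congr_ae (ae_restrict_of_ae (hRY.mono fun ω hω => hω.symm))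

/-- If the equality failed, then by continuity it would fail on a neighborhood `V` of `x`, to which
the treated features give positive mass, although the identity holds almost everywhere there. -/
theorem treatmentEffect_eq {hX : Measurable X} (hW : Measurable W)
    (hY : ∀ a, Measurable (Y a)) (hYint : ∀ a, Integrable (Y a) P)
    (hunc : Unconfounded P X hX W Y) {f μ : Fin 2 → EuclideanSpace ℝ (Fin d) → ℝ}
    (hx : ∀ a, x ∈ ((armMeasure P W a).map X).support)
    (hreg : ∀ a, RegularModelAt (armMeasure P W a) X (observedResponse W Y) (f a) (μ a) x)
    {τ : EuclideanSpace ℝ (Fin d) → ℝ} (hτ : IsTreatmentEffect P X Y τ) (hτx : ContinuousAt τ x) :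
    τ x = μ 1 x - μ 0 x := by
  by_contra hne
  obtain ⟨g1, hg1, hg1X, hg1μ⟩ :=
    exists_condExp_potentialOutcome_eq hW hY hYint hunc 1 (hx 1) (hreg 1)
  obtain ⟨g0, hg0, hg0X, hg0μ⟩ :=
    exists_condExp_potentialOutcome_eq hW hY hYint hunc 0 (hx 0) (hreg 0)
  have hcont : ContinuousAt (fun z => μ 1 z - μ 0 z) x :=
    (hreg 1).contDiffAt.2.continuousAt.sub (hreg 0).contDiffAt.2.continuousAt
  have hV : ∀ᶠ z in 𝓝 x, τ z ≠ μ 1 z - μ 0 z ∧ 0 < f 0 z :=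
    (((hτx.sub hcont).eventually_ne (sub_ne_zero.mpr hne)).mono fun _ => sub_ne_zero.mp).and
      ((hreg 0).contDiffAt.1.continuousAt.eventually (lt_mem_nhds ((hreg 0).density_pos (hx 0))))
  obtain ⟨V, hVs, hVo, hxV⟩ := eventually_nhds_iff.mp hV
  have hpos : 0 < (armMeasure P W 1).map X V :=
    (Measure.mem_support_iff_forall x).mp (hx 1) _ (hVo.mem_nhds hxV)
  refine hpos.ne' ?_
  -- `g0 = μ 0` is known only almost everywhere for the control features. As `f 0 > 0` on `V`, it
  -- holds Lebesgue-almost everywhere there, hence also for the treated features.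
  have hnull : (armMeasure P W 1).map X (V ∩ {z | g0 z ≠ μ 0 z}) = 0 := by
    have hN : (armMeasure P W 0).map X {z | g0 z ≠ μ 0 z} = 0 := hg0μ
    rw [(hreg 0).map_eq_withDensity,
      withDensity_apply_eq_zero ((hreg 0).measurable_density.ennreal_ofReal)] at hN
    have hac : (armMeasure P W 1).map X ≪ volume :=
      (hreg 1).map_eq_withDensity ▸ withDensity_absolutelyContinuous _ _
    refine hac (measure_mono_null ?_ hN)
    intro z hz
    refine ⟨?_, hz.2⟩
    exact (ENNReal.ofReal_pos.mpr (hVs z hz.1).2).ne'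
  have hac : armMeasure P W 1 ≪ P := cond_absolutelyContinuous
  have h1 : ∀ᵐ ω ∂(armMeasure P W 1), τ (X ω) = g1 (X ω) - g0 (X ω) := by
    refine hac.ae_le ?_
    filter_upwards [hτ, condExp_sub (hYint 1) (hYint 0)
      (MeasurableSpace.comap X inferInstance)] with ω e1 e2
    have e3 : (P[fun ω => Y 1 ω - Y 0 ω | MeasurableSpace.comap X inferInstance]) ω =
      (P[Y 1 - Y 0 | MeasurableSpace.comap X inferInstance]) ω := rfl
    rw [e1, e3, e2, Pi.sub_apply, hg1X, hg0X]
  have h2 := ae_of_ae_map hX.aemeasurable hg1μ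
  have h3 : ∀ᵐ ω ∂(armMeasure P W 1), X ω ∉ V ∩ {z | g0 z ≠ μ 0 z} :=
    ae_of_ae_map hX.aemeasurable (measure_eq_zero_iff_ae_notMem.mp hnull)
  rw [Measure.map_apply hX hVo.measurableSet, measure_eq_zero_iff_ae_notMem]
  filter_upwards [h1, h2, h3] with ω e1 e2 e3 hω
  have e4 : g0 (X ω) = μ 0 (X ω) := by
    by_contra hc
    exact e3 ⟨hω, hc⟩
  exact (hVs (X ω) hω).1 (by rw [e1, e2, e4])

end Identification

/-! ### The asymptotic distribution of the effect estimator -/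

section Asymptotics

variable {d : ℕ}

theorem RegularArm.tendsto_integral_exp_sub {ρ : Measure (EuclideanSpace ℝ (Fin d))}
    [IsProbabilityMeasure ρ] {η : Measure ℝ} [IsProbabilityMeasure η]
    {f mu : EuclideanSpace ℝ (Fin d) → ℝ} {x : EuclideanSpace ℝ (Fin d)}
    (h : RegularArm ρ η f mu x) (hd : 0 < d) {n s t : ℕ → ℕ} (hs : Tendsto s atTop atTop)
    (hst : ∀ k, s k < t k) (htn : ∀ k, t k ≤ n k)
    (ht : Tendsto (fun k => (t k : ℝ) / n k) atTop (𝓝 0)) {B : ℝ} (hB : 0 < B) {c : ℕ → ℝ}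
    (hc : ∀ k, c k ^ 2 * ∑ i ∈ Finset.range (n k), twoScaleWeight d (n k) (s k) (t k) i ^ 2 ≤ B) :
    Tendsto (fun k =>
      ∫ p, Complex.exp (Complex.I * ((c k * (armEstimator mu x (s k) (t k) p -
            ∫ p', armEstimator mu x (s k) (t k) p' ∂((Measure.pi fun _ : Fin (n k) => ρ).prod
              (Measure.pi fun _ : Fin (n k) => η))) : ℝ) : ℂ))
          ∂((Measure.pi fun _ : Fin (n k) => ρ).prod (Measure.pi fun _ : Fin (n k) => η)) -
        Complex.exp (-((∫ e, e ^ 2 ∂η : ℝ) * (c k ^ 2 *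
          ∑ i ∈ Finset.range (n k), twoScaleWeight d (n k) (s k) (t k) i ^ 2) / 2 : ℝ)))
      atTop (𝓝 0) := by
  rw [Metric.tendsto_nhds]
  intro ε hε
  obtain ⟨N, b, -, hb, hN⟩ := h.exists_norm_integral_exp_sub_le hd hB (half_pos hε)
  filter_upwards [hs.eventually_ge_atTop N, ht.eventually (ge_mem_nhds hb)] with k h1 h2
  rw [dist_zero_right]
  exact (hN _ _ _ h1 (hst k) (htn k) h2 _ (hc k)).trans_lt (half_lt_self hε)

theorem measurable_twoScaleDNN {n s t : ℕ} (hd : 0 < d) (hs : 1 ≤ s) (hst : s < t)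
    (x : EuclideanSpace ℝ (Fin d)) :
    Measurable fun z : Fin n → EuclideanSpace ℝ (Fin d) × ℝ => twoScaleDNN x s t z := by
  simp_rw [twoScaleDNN_eq_sum x hd hs hst]
  refine Finset.measurable_sum _ fun j _ => ?_
  have h1 : Measurable fun z : Fin n → EuclideanSpace ℝ (Fin d) × ℝ =>
      twoScaleWeight d n s t (nnRank x (fun l => (z l).1) j) :=
    (measurable_comp_nnRank x (twoScaleWeight d n s t) j).comp
      (measurable_pi_lambda _ fun l => measurable_fst.comp (measurable_pi_apply l))
  exact h1.mul (measurable_snd.comp (measurable_pi_apply j))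

theorem map_twoScaleDNN_eq {Ω S : Type*} [MeasurableSpace Ω] [MeasurableSpace S] {G : Measure Ω}
    [IsProbabilityMeasure G] {ν : Measure S} [IsProbabilityMeasure ν]
    {X : Ω → EuclideanSpace ℝ (Fin d)} {R : Ω → ℝ} {f μ : EuclideanSpace ℝ (Fin d) → ℝ}
    {x : EuclideanSpace ℝ (Fin d)} (hX : Measurable X) (h : RegularModelAt G X R f μ x)
    {n s t : ℕ} {Z : Fin n → S → EuclideanSpace ℝ (Fin d) × ℝ}
    (hZ : IsIIDSample ν (G.map fun ω => (X ω, R ω)) Z) (hd : 0 < d) (hs : 1 ≤ s) (hst : s < t) :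
    ν.map (fun ω => twoScaleDNN x s t fun i => Z i ω) =
      ((Measure.pi fun _ : Fin n => G.map X).prod
        (Measure.pi fun _ : Fin n => G.map fun ω => R ω - μ (X ω))).map (armEstimator μ x s t) := by
  have : IsProbabilityMeasure (G.map X) := Measure.isProbabilityMeasure_map hX.aemeasurable
  have : IsProbabilityMeasure (G.map fun ω => R ω - μ (X ω)) :=
    Measure.isProbabilityMeasure_map h.noise_memLp.aestronglyMeasurable.aemeasurable
  have hZm : ∀ i, AEMeasurable (Z i) ν := fun i => (hZ.hasLaw i).aemeasurable
  have hT := measurable_twoScaleDNN (n := n) hd hs hst x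
  have h1 : ν.map (fun ω i => Z i ω) = Measure.pi fun _ : Fin n => G.map fun ω => (X ω, R ω) := by
    rw [(iIndepFun_iff_map_fun_eq_pi_map hZm).mp hZ.indep]
    congr 1
    funext i
    exact (hZ.hasLaw i).map_eq
  have h2 : Measurable fun p : (Fin n → EuclideanSpace ℝ (Fin d)) × (Fin n → ℝ) =>
      fun j : Fin n => (p.1 j, μ (p.1 j) + p.2 j) :=
    measurable_pi_lambda _ fun j => ((measurable_pi_apply j).comp measurable_fst).prodMk
      ((h.measurable_regression.comp ((measurable_pi_apply j).comp measurable_fst)).add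
        ((measurable_pi_apply j).comp measurable_snd))
  rw [← h.map_prod_response hX, ← map_pi_prod_response h.measurable_regression] at h1
  have h3 := AEMeasurable.map_map_of_aemeasurable hT.aemeasurable
    (aemeasurable_pi_lambda (fun ω i => Z i ω) hZm)
  rw [h1, Measure.map_map hT h2] at h3
  exact h3.symm

theorem tendstoInDistribution_gaussianReal_of_charFun {S : ℕ → Type*} [∀ k, MeasurableSpace (S k)]
    {ν : (k : ℕ) → Measure (S k)} [∀ k, IsProbabilityMeasure (ν k)] {V : (k : ℕ) → S k → ℝ}
    (hV : ∀ k, AEMeasurable (V k) (ν k))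
    (h : ∀ u : ℝ, Tendsto (fun k => charFun ((ν k).map (V k)) u) atTop
      (𝓝 (Complex.exp (-(u ^ 2 / 2 : ℝ))))) :
    TendstoInDistribution V atTop (id : ℝ → ℝ) ν (gaussianReal 0 1) := by
  refine ⟨hV, aemeasurable_id, ?_⟩
  refine ProbabilityMeasure.tendsto_iff_tendsto_charFun.mpr fun u => ?_
  simp only [ProbabilityMeasure.coe_mk, Measure.map_id, charFun_gaussianReal]
  convert! h u using 3
  push_cast
  simp

theorem norm_mul_sub_mul_le {a b a' b' : ℂ} (hb : ‖b‖ ≤ 1) (ha' : ‖a'‖ ≤ 1) :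
    ‖a * b - a' * b'‖ ≤ ‖a - a'‖ + ‖b - b'‖ := by
  calc ‖a * b - a' * b'‖ = ‖(a - a') * b + a' * (b - b')‖ := by ring_nf
    _ ≤ ‖a - a'‖ * ‖b‖ + ‖a'‖ * ‖b - b'‖ := by
        rw [← norm_mul, ← norm_mul]
        exact norm_add_le _ _
    _ ≤ ‖a - a'‖ * 1 + 1 * ‖b - b'‖ := by gcongr
    _ = _ := by ring

end Asymptotics

/-! ### The two arms combined -/

theorem theorem4 {Ω : Type*} [MeasurableSpace Ω] [StandardBorelSpace Ω]
    {S : ℕ → Type*} [∀ k, MeasurableSpace (S k)]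
    (d : ℕ) (hd : 0 < d)
    -- the population
    (P : Measure Ω) [IsProbabilityMeasure P]
    (X : Ω → EuclideanSpace ℝ (Fin d)) (hX : Measurable X)
    (W : Ω → Fin 2) (hW : Measurable W)
    (Y : Fin 2 → Ω → ℝ) (hY : ∀ a, Measurable (Y a)) (hYint : ∀ a, Integrable (Y a) P)
    (hunc : Unconfounded P X hX W Y)
    -- the regression models of the two arms and the target point
    (f μ : Fin 2 → EuclideanSpace ℝ (Fin d) → ℝ) (x : EuclideanSpace ℝ (Fin d))
    (hx : ∀ a, x ∈ ((armMeasure P W a).map X).support)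
    (hreg : ∀ a, RegularModelAt (armMeasure P W a) X (observedResponse W Y) (f a) (μ a) x)
    -- the heterogeneous treatment effect
    (τ : EuclideanSpace ℝ (Fin d) → ℝ) (hτ : IsTreatmentEffect P X Y τ) (hτx : ContinuousAt τ x)
    -- sample sizes and subsampling scales of the two arms along the asymptotic sequence
    (n s₁ s₂ : Fin 2 → ℕ → ℕ)
    (hs₁ : ∀ a k, 1 ≤ s₁ a k ∧ s₁ a k ≤ n a k) (hs₂ : ∀ a k, 1 ≤ s₂ a k ∧ s₂ a k ≤ n a k)
    (hne : ∀ a k, s₁ a k ≠ s₂ a k)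
    (hs₁_top : ∀ a, Tendsto (s₁ a) atTop atTop) (hs₂_top : ∀ a, Tendsto (s₂ a) atTop atTop)
    (hs₁_n : ∀ a, Tendsto (fun k => (s₁ a k : ℝ) / (n a k : ℝ)) atTop (𝓝 0))
    (hs₂_n : ∀ a, Tendsto (fun k => (s₂ a k : ℝ) / (n a k : ℝ)) atTop (𝓝 0))
    -- two independent i.i.d. samples, one from each arm
    (ν : (k : ℕ) → Measure (S k)) [∀ k, IsProbabilityMeasure (ν k)]
    (Z : (a : Fin 2) → (k : ℕ) → Fin (n a k) → S k → EuclideanSpace ℝ (Fin d) × ℝ)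
    (hZ : ∀ a k, IsIIDSample (ν k)
      ((armMeasure P W a).map (fun ω => (X ω, observedResponse W Y ω))) (Z a k))
    (hZindep : ∀ k, IndepFun (fun ω i => Z 1 k i ω) (fun ω i => Z 0 k i ω) (ν k))
    -- the estimator
    (D : (k : ℕ) → S k → ℝ)
    (hD : ∀ k ω, D k ω = effectEstimator x (s₁ 1 k) (s₂ 1 k) (s₁ 0 k) (s₂ 0 k)
      (fun i => Z 1 k i ω) (fun i => Z 0 k i ω)) :
    ∃ σ Λ : ℕ → ℝ,
      (∀ k, 0 < σ k) ∧
      (fun k => σ k ^ 2) =O[atTop] (fun k =>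
        (s₁ 1 k : ℝ) / (n 1 k : ℝ) + (s₂ 1 k : ℝ) / (n 1 k : ℝ) +
          (s₁ 0 k : ℝ) / (n 0 k : ℝ) + (s₂ 0 k : ℝ) / (n 0 k : ℝ)) ∧
      (∀ k, Integrable (D k) (ν k) ∧ Λ k = (∫ ω, D k ω ∂(ν k)) - τ x) ∧
      Λ =o[atTop] (fun k =>
        scaleRate d (s₁ 1 k) + scaleRate d (s₂ 1 k) +
          scaleRate d (s₁ 0 k) + scaleRate d (s₂ 0 k)) ∧
      TendstoInDistribution (fun k ω => (D k ω - τ x - Λ k) / σ k) atTop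
        (id : ℝ → ℝ) ν (gaussianReal 0 1) := by

  have hA : ∀ a, P (W ⁻¹' {a}) ≠ 0 := fun a => measure_treatment_ne_zero a (hx a)
  have hG : ∀ a, IsProbabilityMeasure (armMeasure P W a) := fun a => cond_isProbabilityMeasure (hA a)
  have hτμ : τ x = μ 1 x - μ 0 x := treatmentEffect_eq hW hY hYint hunc hx hreg hτ hτx
  set R := observedResponse W Y with hR
  have harm := fun a => (hreg a).regularArm hX (hx a)
  have hρp : ∀ a, IsProbabilityMeasure ((armMeasure P W a).map X) := fun a =>
    Measure.isProbabilityMeasure_map hX.aemeasurable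
  have hηp : ∀ a, IsProbabilityMeasure ((armMeasure P W a).map fun ω => R ω - μ a (X ω)) :=
    fun a => Measure.isProbabilityMeasure_map
      (hreg a).noise_memLp.aestronglyMeasurable.aemeasurable
  set s : Fin 2 → ℕ → ℕ := fun a k => min (s₁ a k) (s₂ a k) with hs
  set t : Fin 2 → ℕ → ℕ := fun a k => max (s₁ a k) (s₂ a k) with ht
  have hs1 : ∀ a k, 1 ≤ s a k := fun a k => le_min (hs₁ a k).1 (hs₂ a k).1
  have hst : ∀ a k, s a k < t a k := fun a k => min_lt_max.mpr (hne a k)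
  have htn : ∀ a k, t a k ≤ n a k := fun a k => max_le (hs₁ a k).2 (hs₂ a k).2
  have hslim : ∀ a, Tendsto (s a) atTop atTop := fun a =>
    tendsto_atTop.mpr fun N => by
      filter_upwards [(hs₁_top a).eventually_ge_atTop N, (hs₂_top a).eventually_ge_atTop N]
        with k h1 h2 using le_min h1 h2
  have htle : ∀ a k, (t a k : ℝ) / n a k ≤ (s₁ a k : ℝ) / n a k + (s₂ a k : ℝ) / n a k := by
    intro a k
    rw [← add_div]
    refine div_le_div_of_nonneg_right ?_ (Nat.cast_nonneg _)
    exact_mod_cast max_le_add_of_nonneg (Nat.zero_le _) (Nat.zero_le _)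
  have htlim : ∀ a, Tendsto (fun k => (t a k : ℝ) / n a k) atTop (𝓝 0) := fun a =>
    squeeze_zero (fun k => by positivity) (htle a) (by simpa using (hs₁_n a).add (hs₂_n a))
  have hsrate : ∀ a k, scaleRate d (s a k) ≤ scaleRate d (s₁ a k) + scaleRate d (s₂ a k) := by
    intro a k
    have h1 := (scaleRate_pos (d := d) (hs₁ a k).1).le
    have h2 := (scaleRate_pos (d := d) (hs₂ a k).1).le
    rcases min_choice (s₁ a k) (s₂ a k) with h | h <;> simp only [hs, h] <;> linarith
  have hcomm : ∀ a k (z : Fin (n a k) → EuclideanSpace ℝ (Fin d) × ℝ),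
      twoScaleDNN x (s₁ a k) (s₂ a k) z = twoScaleDNN x (s a k) (t a k) z := by
    intro a k z
    rcases le_total (s₁ a k) (s₂ a k) with h | h
    · simp only [hs, ht, min_eq_left h, max_eq_right h]
    · simp only [hs, ht, min_eq_right h, max_eq_left h]
      exact twoScaleDNN_comm _ _ _ _
  set v : Fin 2 → ℝ := fun a => ∫ e, e ^ 2 ∂((armMeasure P W a).map fun ω => R ω - μ a (X ω))
    with hv
  have hv0 : ∀ a, 0 < v a := fun a => (hreg a).integral_noise_sq_pos
  set Q : Fin 2 → ℕ → ℝ := fun a k =>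
    ∑ i ∈ Finset.range (n a k), twoScaleWeight d (n a k) (s a k) (t a k) i ^ 2 with hQ
  have hQ0 : ∀ a k, 0 < Q a k := by
    intro a k
    refine lt_of_lt_of_le ?_ (le_sum_sq_twoScaleWeight hd (hs1 a k) (hst a k) (htn a k))
    have h1 : (0 : ℝ) < t a k := by exact_mod_cast (Nat.zero_le _).trans_lt (hst a k)
    have h2 : (0 : ℝ) < n a k := h1.trans_le (by exact_mod_cast htn a k)
    positivity
  set m : (a : Fin 2) → (k : ℕ) → Measure ((Fin (n a k) → EuclideanSpace ℝ (Fin d)) ×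
      (Fin (n a k) → ℝ)) := fun a k =>
    (Measure.pi fun _ => (armMeasure P W a).map X).prod
      (Measure.pi fun _ => (armMeasure P W a).map fun ω => R ω - μ a (X ω)) with hm
  set T : (a : Fin 2) → (k : ℕ) → S k → ℝ := fun a k ω =>
    twoScaleDNN x (s a k) (t a k) fun i => Z a k i ω with hT
  have hZm : ∀ a k, AEMeasurable (fun ω i => Z a k i ω) (ν k) := fun a k =>
    aemeasurable_pi_lambda _ fun i => ((hZ a k).hasLaw i).aemeasurable
  have hTm : ∀ a k, AEMeasurable (T a k) (ν k) := fun a k =>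
    (measurable_twoScaleDNN hd (hs1 a k) (hst a k) x).comp_aemeasurable (hZm a k)
  have hAm : ∀ a k, Measurable (armEstimator (n := n a k) (μ a) x (s a k) (t a k)) := fun a k =>
    measurable_armEstimator hd (hs1 a k) (hst a k) (hreg a).measurable_regression
  have hlaw : ∀ a k, (ν k).map (T a k) = (m a k).map (armEstimator (μ a) x (s a k) (t a k)) :=
    fun a k => map_twoScaleDNN_eq hX (hreg a) (hZ a k) hd (hs1 a k) (hst a k)
  have htransfer : ∀ a k (φ : ℝ → ℂ), Measurable φ →
      ∫ ω, φ (T a k ω) ∂(ν k) = ∫ p, φ (armEstimator (μ a) x (s a k) (t a k) p) ∂(m a k) := by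
    intro a k φ hφ
    rw [← integral_map (hTm a k) hφ.aestronglyMeasurable, hlaw a k,
      integral_map (hAm a k).aemeasurable hφ.aestronglyMeasurable]
  have hTi : ∀ a k, Integrable (T a k) (ν k) := by
    intro a k
    have h1 := (harm a).integrable_armEstimator hd (hs1 a k) (hst a k) (htn a k)
    have h2 := (integrable_map_measure (μ := m a k) measurable_id.aestronglyMeasurable
      (hAm a k).aemeasurable).mpr h1
    rw [← hlaw a k] at h2
    exact (integrable_map_measure measurable_id.aestronglyMeasurable (hTm a k)).mp h2
  set e : Fin 2 → ℕ → ℝ := fun a k => ∫ p, armEstimator (μ a) x (s a k) (t a k) p ∂(m a k) with he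
  have hTe : ∀ a k, ∫ ω, T a k ω ∂(ν k) = e a k := by
    intro a k
    have h1 := integral_map (hTm a k) (f := id) measurable_id.aestronglyMeasurable
    have h2 := integral_map (μ := m a k) (hAm a k).aemeasurable (f := id)
      measurable_id.aestronglyMeasurable
    rw [hlaw a k, h2] at h1
    exact h1.symm
  have hDT : ∀ k, D k = fun ω => T 1 k ω - T 0 k ω := by
    intro k
    funext ω
    rw [hD, effectEstimator, hcomm 1 k, hcomm 0 k]
  have hDi : ∀ k, Integrable (D k) (ν k) := fun k => by
    rw [hDT]
    exact (hTi 1 k).sub (hTi 0 k)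
  have hDe : ∀ k, ∫ ω, D k ω ∂(ν k) = e 1 k - e 0 k := by
    intro k
    rw [hDT, integral_sub (hTi 1 k) (hTi 0 k), hTe, hTe]
  have hσpos : ∀ k, 0 < v 1 * Q 1 k + v 0 * Q 0 k := fun k =>
    add_pos (mul_pos (hv0 1) (hQ0 1 k)) (mul_pos (hv0 0) (hQ0 0 k))
  -- The variance of the noise parts alone: the regression parts are of smaller order.
  set σ : ℕ → ℝ := fun k => Real.sqrt (v 1 * Q 1 k + v 0 * Q 0 k) with hσ
  have hσ2 : ∀ k, σ k ^ 2 = v 1 * Q 1 k + v 0 * Q 0 k := fun k => Real.sq_sqrt (hσpos k).le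
  have hσ0 : ∀ k, 0 < σ k := fun k => Real.sqrt_pos.mpr (hσpos k)
  refine ⟨σ, fun k => (∫ ω, D k ω ∂(ν k)) - τ x, hσ0, ?_, fun k => ⟨hDi k, rfl⟩, ?_, ?_⟩
  · refine IsBigO.of_bound ((v 1 + v 0) * (1 + d) ^ 2) (Eventually.of_forall fun k => ?_)
    rw [Real.norm_of_nonneg (sq_nonneg _), Real.norm_of_nonneg (by positivity), hσ2]
    have hb : ∀ a, Q a k ≤ (1 + d) ^ 2 * ((s₁ a k : ℝ) / n a k + (s₂ a k : ℝ) / n a k) := fun a =>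
      (sum_sq_twoScaleWeight_le hd (hs1 a k) (hst a k) (htn a k)).trans
        (mul_le_mul_of_nonneg_left (htle a k) (by positivity))
    set r : Fin 2 → ℝ := fun a => (s₁ a k : ℝ) / n a k + (s₂ a k : ℝ) / n a k with hr
    have hr0 : ∀ a, 0 ≤ r a := fun a => by positivity
    calc v 1 * Q 1 k + v 0 * Q 0 k
        ≤ v 1 * ((1 + d) ^ 2 * r 1) + v 0 * ((1 + d) ^ 2 * r 0) :=
          add_le_add (mul_le_mul_of_nonneg_left (hb 1) (hv0 1).le)
            (mul_le_mul_of_nonneg_left (hb 0) (hv0 0).le)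
      _ ≤ (v 1 + v 0) * (1 + d) ^ 2 * (r 1 + r 0) := by
          have h1 : 0 ≤ v 0 * ((1 + d) ^ 2 * r 1) :=
            mul_nonneg (hv0 0).le (mul_nonneg (by positivity) (hr0 1))
          have h2 : 0 ≤ v 1 * ((1 + d) ^ 2 * r 0) :=
            mul_nonneg (hv0 1).le (mul_nonneg (by positivity) (hr0 0))
          linarith
      _ = _ := by
          simp only [hr]
          ring
  · rw [isLittleO_iff]
    intro ε hε
    obtain ⟨N1, -, hN1⟩ := (harm 1).exists_abs_bias_le hd hε
    obtain ⟨N0, -, hN0⟩ := (harm 0).exists_abs_bias_le hd hε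
    filter_upwards [(hslim 1).eventually_ge_atTop N1, (hslim 0).eventually_ge_atTop N0]
      with k h1 h0
    have b1 := hN1 _ _ _ h1 (hst 1 k) (htn 1 k)
    have b0 := hN0 _ _ _ h0 (hst 0 k) (htn 0 k)
    have p := fun a => scaleRate_pos (d := d) (hs₁ a k).1
    have p' := fun a => scaleRate_pos (d := d) (hs₂ a k).1
    rw [hDe, hτμ, Real.norm_eq_abs, Real.norm_of_nonneg
      (add_pos (add_pos (add_pos (p 1) (p' 1)) (p 0)) (p' 0)).le]
    calc |e 1 k - e 0 k - (μ 1 x - μ 0 x)| = |(e 1 k - μ 1 x) - (e 0 k - μ 0 x)| := by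
          congr 1
          ring
      _ ≤ |e 1 k - μ 1 x| + |e 0 k - μ 0 x| := abs_sub _ _
      _ ≤ ε * scaleRate d (s 1 k) + ε * scaleRate d (s 0 k) := add_le_add b1 b0
      _ ≤ ε * (scaleRate d (s₁ 1 k) + scaleRate d (s₂ 1 k)) +
          ε * (scaleRate d (s₁ 0 k) + scaleRate d (s₂ 0 k)) :=
          add_le_add (mul_le_mul_of_nonneg_left (hsrate 1 k) hε.le)
            (mul_le_mul_of_nonneg_left (hsrate 0 k) hε.le)
      _ = _ := by ring
  · have hVm : ∀ k, AEMeasurable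
        (fun ω => (D k ω - τ x - ((∫ ω, D k ω ∂(ν k)) - τ x)) / σ k) (ν k) := fun k =>
      (((hDi k).aemeasurable.sub_const _).sub_const _).div_const _
    refine tendstoInDistribution_gaussianReal_of_charFun hVm fun u => ?_
    set c : ℕ → ℝ := fun k => u / σ k with hc
    have hcB : ∀ a k, c k ^ 2 * Q a k ≤ (u ^ 2 + 1) / v a := by
      intro a k
      have h1 : v a * Q a k ≤ σ k ^ 2 := by
        rw [hσ2]
        have q1 := mul_pos (hv0 1) (hQ0 1 k)
        have q0 := mul_pos (hv0 0) (hQ0 0 k)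
        fin_cases a
        · exact le_add_of_nonneg_left q1.le
        · exact le_add_of_nonneg_right q0.le
      rw [le_div_iff₀ (hv0 a), hc]
      calc (u / σ k) ^ 2 * Q a k * v a = u ^ 2 * ((v a * Q a k) / σ k ^ 2) := by ring
        _ ≤ u ^ 2 * 1 := by
            gcongr
            exact div_le_one_of_le₀ h1 (sq_nonneg _)
        _ ≤ u ^ 2 + 1 := by linarith
    set Φ : Fin 2 → ℕ → ℝ → ℂ := fun a k b =>
      ∫ p, Complex.exp (Complex.I * ((b * (armEstimator (μ a) x (s a k) (t a k) p - e a k) : ℝ) : ℂ))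
        ∂(m a k) with hΦ
    have hΦ1 : ∀ a k b, ‖Φ a k b‖ ≤ 1 := by
      intro a k b
      refine (norm_integral_le_of_norm_le_const (C := 1) (ae_of_all _ fun p => ?_)).trans ?_
      · rw [mul_comm, Complex.norm_exp_ofReal_mul_I]
      · simp [hm]
    set ψ : Fin 2 → ℕ → ℂ := fun a k => Complex.exp (-(v a * (c k ^ 2 * Q a k) / 2 : ℝ)) with hψ
    have hψ1 : ∀ a k, ‖ψ a k‖ ≤ 1 := by
      intro a k
      simp only [hψ]
      rw [← Complex.ofReal_neg, Complex.norm_exp, Complex.ofReal_re, Real.exp_le_one_iff,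
        neg_nonpos]
      have := hv0 a
      have := hQ0 a k
      positivity
    have hlim1 : Tendsto (fun k => Φ 1 k (c k) - ψ 1 k) atTop (𝓝 0) :=
      (harm 1).tendsto_integral_exp_sub hd (hslim 1) (hst 1) (htn 1) (htlim 1)
        (B := (u ^ 2 + 1) / v 1) (div_pos (by positivity) (hv0 1)) (c := c) (hcB 1)
    -- The control estimator is subtracted, hence the argument `-c k`.
    have hlim0 : Tendsto (fun k => Φ 0 k (-c k) - ψ 0 k) atTop (𝓝 0) := by
      have h1 := (harm 0).tendsto_integral_exp_sub hd (hslim 0) (hst 0) (htn 0) (htlim 0)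
        (B := (u ^ 2 + 1) / v 0) (div_pos (by positivity) (hv0 0)) (c := fun k => -c k)
        (fun k => by rw [neg_sq]; exact hcB 0 k)
      simp only [neg_sq] at h1
      exact h1
    -- The shares of the two arms in `σ ^ 2` need not converge, so neither `ψ 1 k` nor `ψ 0 k` need
    -- have a limit; only their product is constant.
    have hprod : ∀ k, ψ 1 k * ψ 0 k = Complex.exp (-(u ^ 2 / 2 : ℝ)) := by
      intro k
      simp only [hψ]
      rw [← Complex.exp_add, ← Complex.ofReal_neg, ← Complex.ofReal_neg, ← Complex.ofReal_neg,
        ← Complex.ofReal_add]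
      congr 2
      have h1 := hσ2 k
      have h2 := (hσ0 k).ne'
      have h3 : c k ^ 2 * (v 1 * Q 1 k + v 0 * Q 0 k) = u ^ 2 := by
        rw [← h1, hc]
        field_simp
      linarith
    have hchar : ∀ k, charFun ((ν k).map
        fun ω => (D k ω - τ x - ((∫ ω, D k ω ∂(ν k)) - τ x)) / σ k) u =
        Φ 1 k (c k) * Φ 0 k (-c k) := by
      intro k
      have hexpm : ∀ (a : Fin 2) (b : ℝ), Measurable fun y : ℝ =>
          Complex.exp (Complex.I * ((b * (y - e a k) : ℝ) : ℂ)) := fun a b =>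
        Complex.measurable_exp.comp (measurable_const.mul (Complex.measurable_ofReal.comp
          (measurable_const.mul (measurable_id.sub_const _))))
      have hind : IndepFun (T 1 k) (T 0 k) (ν k) :=
        (hZindep k).comp (measurable_twoScaleDNN hd (hs1 1 k) (hst 1 k) x)
          (measurable_twoScaleDNN hd (hs1 0 k) (hst 0 k) x)
      have h1 := hind.integral_fun_comp_mul_comp (hTm 1 k) (hTm 0 k)
        (hexpm 1 (c k)).aestronglyMeasurable (hexpm 0 (-c k)).aestronglyMeasurable
      rw [htransfer 1 k _ (hexpm 1 (c k)), htransfer 0 k _ (hexpm 0 (-c k))] at h1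
      rw [charFun_apply_real, integral_map (hVm k) (by fun_prop)]
      refine Eq.trans (integral_congr_ae (ae_of_all _ fun ω => ?_)) h1
      simp only
      rw [← Complex.exp_add, hDe, hDT]
      congr 1
      simp only [hc]
      push_cast
      ring
    simp_rw [hchar]
    rw [tendsto_iff_norm_sub_tendsto_zero]
    refine squeeze_zero (fun k => norm_nonneg _) (fun k => ?_)
      (by simpa using hlim1.norm.add hlim0.norm)
    rw [← hprod k]
    exact norm_mul_sub_mul_le (hΦ1 0 k _) (hψ1 1 k)
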